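/- **Conventions.** For $x,y$ in a group, $[x,y]=xyx^{-1}y^{-1}$, and $o(x)$ is the order of $x$. A finite group $G$ is *monolithic* if the intersection of all its non-trivial normal subgroups is non-trivial. Let $b,n\ge 2$. A *diagonal double Kodaira structure of type $(b,n)$* on a finite group $G$ is an ordered set of $4b+1$ generators $$(r_{11},t_{11},\dots,r_{1b},t_{1b},\,r_{21},t_{21},\dots,r_{2b},t_{2b},\,z)$$ of $G$ with $o(z)=n$ which satisfies the following relations for all $j,k\in\{1,\dots,b\}$. * Surface relations: $$[r_{1b}^{-1},t_{1b}^{-1}]t_{1b}^{-1}\cdots[r_{11}^{-1},t_{11}^{-1}]t_{11}^{-1}\,(t_{11}t_{12}\cdots t_{1b})=z,$$ $$[r_{21}^{-1},t_{21}]t_{21}\cdots[r_{2b}^{-1},t_{2b}]t_{2b}\,(t_{2b}^{-1}\cdots t_{21}^{-1})=z^{-1}.$$ * Action of $r_{1j}$: $[r_{1j},r_{2k}]=1$ if $j\le k$; $[r_{1j},r_{2k}]=z^{-1}r_{2k}r_{2j}^{-1}z\,r_{2j}r_{2k}^{-1}$ if $j>k$; $[r_{1j},t_{2k}]=1$ if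 $j<k$; $[r_{1j},t_{2j}]=z^{-1}$; $[r_{1j},t_{2k}]=[z^{-1},t_{2k}]$ if $j>k$; $[r_{1j},z]=[r_{2j}^{-1},z]$. * Action of $t_{1j}$: $[t_{1j},r_{2k}]=1$ if $j<k$; $[t_{1j},r_{2j}]=t_{2j}^{-1}z\,t_{2j}$; $[t_{1j},r_{2k}]=[t_{2j}^{-1},z]$ if $j>k$; $[t_{1j},t_{2k}]=1$ if $j<k$; $[t_{1j},t_{2j}]=[t_{2j}^{-1},z]$; $[t_{1j},t_{2k}]=t_{2j}^{-1}z\,t_{2j}z^{-1}t_{2k}z\,t_{2j}^{-1}z^{-1}t_{2j}t_{2k}^{-1}$ if $j>k$; $[t_{1j},z]=[t_{2j}^{-1},z]$. A *prestructure of type $n$* on $G$ ($n\ge2$) is an ordered set of nine elements $(r_{11},t_{11},r_{12},t_{12},r_{21},t_{21},r_{22},t_{22},z)$ of $G$, not required to generate $G$, with $o(z)=n$, which satisfies all the above relations for $b=2$ except the surface relations. The group $\operatorname{Aut}(G)$ acts on the prestructures of $G$ componentwise. Let $G(96,201)$, $G(96,202)$, $G(96,204)$ (labels of the GAP database of small groups)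 be the groups generated by $x_1,\dots,x_6$ with the following relations, together with $[x_i,x_j]=1$ for all pairs $i<j$ for which no value of $[x_i,x_j]$ is listed. * $G(96,201)$: $x_1^2=x_2^2=x_4^2=x_5^2=x_6$, $x_3^3=x_6^2=1$, $[x_1,x_2]=x_6$, $[x_3,x_4]=x_5^{-1}$, $[x_3,x_5]=x_4x_5^{-1}$, $[x_4,x_5]=x_6$. * $G(96,202)$: $x_1^2=x_2^2=1$, $x_4^2=x_5^2=x_6$, $x_3^3=x_6^2=1$, $[x_1,x_2]=x_6$, $[x_3,x_4]=x_5^{-1}$, $[x_3,x_5]=x_4x_5^{-1}$, $[x_4,x_5]=x_6$. * $G(96,204)$: $x_1^3=1$, $x_2^2=x_3^2=x_4^2=x_5^2=x_6^2=1$, $[x_1,x_2]=x_3$, $[x_1,x_3]=x_2x_3$, $[x_1,x_4]=x_5$, $[x_1,x_5]=x_4x_5$, $[x_2,x_5]=x_6$, $[x_3,x_4]=x_6$. **Proposition 5.5.** Let $G$ be a monolithic group of order $96$ that admits a prestructure of type $n$. Then $n=2$ and $G$ is isomorphic to one of $G(96,201)$, $G(96,202)$, $G(96,204)$. Conversely,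 these three groups are monolithic of order $96$ and admit prestructures: up to the action of the automorphism group, the number of prestructures (of any type) is $8960$ for $G(96,201)$, $26880$ for $G(96,202)$, and $8960$ for $G(96,204)$. None of these three groups admits a diagonal double Kodaira structure of type $(b,n)$, for any $b,n\ge2$. -/

import Mathlib

open scoped commutatorElement

/-- The monolith of a group: the intersection of all its non-trivial normal subgroups. -/
def monolith (G : Type*) [Group G] : Subgroup G :=
  sInf {N : Subgroup G | N.Normal ∧ N ≠ ⊥}

/-- A group is monolithic if its monolith is non-trivial. -/
def IsMonolithic (G : Type*) [Group G] : Prop :=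
  monolith G ≠ ⊥

/-- An ordered set of `4 b + 1` elements
`(r₁₁, t₁₁, …, r₁b, t₁b, r₂₁, t₂₁, …, r₂b, t₂b, z)` of `G`. The index `j ∈ {1, …, b}` is
represented by an element of `Fin b`. -/
structure KodairaTuple (G : Type*) (b : ℕ) where
  r₁ : Fin b → G
  t₁ : Fin b → G
  r₂ : Fin b → G
  t₂ : Fin b → G
  z : G

namespace KodairaTuple

variable {G : Type*} [Group G] {b : ℕ}

/-- The relations giving the conjugacy action of the `r₁ⱼ` and `t₁ⱼ` on the `r₂ₖ`, `t₂ₖ` and `z`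
in the presentation of the pure braid group on two strands of a closed surface of genus `b`.
Here `⁅x, y⁆ = x * y * x⁻¹ * y⁻¹`. -/
structure ActionRelations (P : KodairaTuple G b) : Prop where
  r₁_r₂_lt : ∀ j k, j < k → ⁅P.r₁ j, P.r₂ k⁆ = 1
  r₁_r₂_eq : ∀ j, ⁅P.r₁ j, P.r₂ j⁆ = 1
  r₁_r₂_gt : ∀ j k, k < j →
    ⁅P.r₁ j, P.r₂ k⁆ = P.z⁻¹ * P.r₂ k * (P.r₂ j)⁻¹ * P.z * P.r₂ j * (P.r₂ k)⁻¹
  r₁_t₂_lt : ∀ j k, j < k → ⁅P.r₁ j, P.t₂ k⁆ = 1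
  r₁_t₂_eq : ∀ j, ⁅P.r₁ j, P.t₂ j⁆ = P.z⁻¹
  r₁_t₂_gt : ∀ j k, k < j → ⁅P.r₁ j, P.t₂ k⁆ = ⁅P.z⁻¹, P.t₂ k⁆
  r₁_z : ∀ j, ⁅P.r₁ j, P.z⁆ = ⁅(P.r₂ j)⁻¹, P.z⁆
  t₁_r₂_lt : ∀ j k, j < k → ⁅P.t₁ j, P.r₂ k⁆ = 1
  t₁_r₂_eq : ∀ j, ⁅P.t₁ j, P.r₂ j⁆ = (P.t₂ j)⁻¹ * P.z * P.t₂ j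
  t₁_r₂_gt : ∀ j k, k < j → ⁅P.t₁ j, P.r₂ k⁆ = ⁅(P.t₂ j)⁻¹, P.z⁆
  t₁_t₂_lt : ∀ j k, j < k → ⁅P.t₁ j, P.t₂ k⁆ = 1
  t₁_t₂_eq : ∀ j, ⁅P.t₁ j, P.t₂ j⁆ = ⁅(P.t₂ j)⁻¹, P.z⁆
  t₁_t₂_gt : ∀ j k, k < j →
    ⁅P.t₁ j, P.t₂ k⁆ = (P.t₂ j)⁻¹ * P.z * P.t₂ j * P.z⁻¹ * P.t₂ k * P.z * (P.t₂ j)⁻¹ * P.z⁻¹ *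
      P.t₂ j * (P.t₂ k)⁻¹
  t₁_z : ∀ j, ⁅P.t₁ j, P.z⁆ = ⁅(P.t₂ j)⁻¹, P.z⁆

/-- The two surface relations
`[r₁b⁻¹, t₁b⁻¹] t₁b⁻¹ ⋯ [r₁₁⁻¹, t₁₁⁻¹] t₁₁⁻¹ (t₁₁ t₁₂ ⋯ t₁b) = z` and
`[r₂₁⁻¹, t₂₁] t₂₁ ⋯ [r₂b⁻¹, t₂b] t₂b (t₂b⁻¹ ⋯ t₂₁⁻¹) = z⁻¹`. -/
structure SurfaceRelations (P : KodairaTuple G b) : Prop where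
  first :
    (List.ofFn fun j => ⁅(P.r₁ j)⁻¹, (P.t₁ j)⁻¹⁆ * (P.t₁ j)⁻¹).reverse.prod *
      (List.ofFn P.t₁).prod = P.z
  second :
    (List.ofFn fun j => ⁅(P.r₂ j)⁻¹, P.t₂ j⁆ * P.t₂ j).prod *
      (List.ofFn fun j => (P.t₂ j)⁻¹).reverse.prod = P.z⁻¹

/-- A diagonal double Kodaira structure of type `(b, n)` on `G`, with `b, n ≥ 2`: an ordered set of
`4 b + 1` generators of `G`, with `z` of order `n`, satisfying the defining relations of the pure
braid group on two strands of a closed surface of genus `b`. -/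
structure IsDiagonalDoubleKodairaStructure (P : KodairaTuple G b) (n : ℕ) : Prop where
  two_le_b : 2 ≤ b
  two_le_n : 2 ≤ n
  orderOf_z : orderOf P.z = n
  generates :
    Subgroup.closure
      (Set.range P.r₁ ∪ Set.range P.t₁ ∪ Set.range P.r₂ ∪ Set.range P.t₂ ∪ {P.z}) = ⊤
  surface : P.SurfaceRelations
  action : P.ActionRelations

/-- A prestructure of type `n ≥ 2` on `G`: an ordered set of nine elements of `G`, with `z` of
order `n`, satisfying all relations of a diagonal double Kodaira structure of type `(2, n)` except
the surface relations. The elements need not generate `G`. -/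
structure IsPrestructure (P : KodairaTuple G 2) (n : ℕ) : Prop where
  two_le_n : 2 ≤ n
  orderOf_z : orderOf P.z = n
  action : P.ActionRelations

/-- The image of a tuple under an automorphism of `G`. -/
def map (φ : MulAut G) (P : KodairaTuple G b) : KodairaTuple G b where
  r₁ j := φ (P.r₁ j)
  t₁ j := φ (P.t₁ j)
  r₂ j := φ (P.r₂ j)
  t₂ j := φ (P.t₂ j)
  z := φ P.z

end KodairaTuple

/-- The set of all prestructures (of any type) on `G`. -/
def Prestructure (G : Type*) [Group G] : Type _ :=
  {P : KodairaTuple G 2 // ∃ n, P.IsPrestructure n}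

/-- Two prestructures are equivalent if an automorphism of `G` carries one to the other. -/
def prestructureSetoid (G : Type*) [Group G] : Setoid (Prestructure G) where
  r P Q := ∃ φ : MulAut G, P.1.map φ = Q.1
  iseqv :=
    { refl := fun _ => ⟨1, rfl⟩
      symm := by
        rintro P Q ⟨φ, h⟩
        refine ⟨φ⁻¹, ?_⟩
        rw [← h]
        simp [KodairaTuple.map]
      trans := by
        rintro P Q R ⟨φ, h⟩ ⟨ψ, h'⟩
        exact ⟨ψ * φ, by rw [← h', ← h]; rfl⟩ }

/-- The number of prestructures on `G` up to the action of `Aut(G)`. -/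
noncomputable def numPrestructuresUpToAut (G : Type*) [Group G] : ℕ :=
  Nat.card (Quotient (prestructureSetoid G))

namespace SmallGroups

abbrev x₁ : FreeGroup (Fin 6) := FreeGroup.of 0
abbrev x₂ : FreeGroup (Fin 6) := FreeGroup.of 1
abbrev x₃ : FreeGroup (Fin 6) := FreeGroup.of 2
abbrev x₄ : FreeGroup (Fin 6) := FreeGroup.of 3
abbrev x₅ : FreeGroup (Fin 6) := FreeGroup.of 4
abbrev x₆ : FreeGroup (Fin 6) := FreeGroup.of 5

/-- Relators for the group with label `(96, 201)` in the GAP database of small groups: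
the central product of `Q₈ = ⟨x₁, x₂⟩` and `SL(2,3) = ⟨x₃, x₄, x₅⟩`.
A relation `u = v` is written `u * v⁻¹`. -/
def rels96_201 : Set (FreeGroup (Fin 6)) :=
  { x₁ ^ 2 * x₆⁻¹,
    x₂ ^ 2 * x₆⁻¹, ⁅x₁, x₂⁆ * x₆⁻¹,
    x₃ ^ 3, ⁅x₁, x₃⁆, ⁅x₂, x₃⁆,
    x₄ ^ 2 * x₆⁻¹, ⁅x₁, x₄⁆, ⁅x₂, x₄⁆, ⁅x₃, x₄⁆ * (x₅⁻¹)⁻¹,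
    x₅ ^ 2 * x₆⁻¹, ⁅x₁, x₅⁆, ⁅x₂, x₅⁆, ⁅x₃, x₅⁆ * (x₄ * x₅⁻¹)⁻¹, ⁅x₄, x₅⁆ * x₆⁻¹,
    x₆ ^ 2, ⁅x₁, x₆⁆, ⁅x₂, x₆⁆, ⁅x₃, x₆⁆, ⁅x₄, x₆⁆, ⁅x₅, x₆⁆ }

/-- The group `G(96, 201)`. -/
abbrev G96_201 : Type := PresentedGroup rels96_201

/-- Relators for the group with label `(96, 202)` in the GAP database of small groups:
the central product of `D₈ = ⟨x₁, x₂⟩` and `SL(2,3) = ⟨x₃, x₄, x₅⟩`.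
A relation `u = v` is written `u * v⁻¹`. -/
def rels96_202 : Set (FreeGroup (Fin 6)) :=
  { x₁ ^ 2,
    x₂ ^ 2, ⁅x₁, x₂⁆ * x₆⁻¹,
    x₃ ^ 3, ⁅x₁, x₃⁆, ⁅x₂, x₃⁆,
    x₄ ^ 2 * x₆⁻¹, ⁅x₁, x₄⁆, ⁅x₂, x₄⁆, ⁅x₃, x₄⁆ * (x₅⁻¹)⁻¹,
    x₅ ^ 2 * x₆⁻¹, ⁅x₁, x₅⁆, ⁅x₂, x₅⁆, ⁅x₃, x₅⁆ * (x₄ * x₅⁻¹)⁻¹, ⁅x₄, x₅⁆ * x₆⁻¹,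
    x₆ ^ 2, ⁅x₁, x₆⁆, ⁅x₂, x₆⁆, ⁅x₃, x₆⁆, ⁅x₄, x₆⁆, ⁅x₅, x₆⁆ }

/-- The group `G(96, 202)`. -/
abbrev G96_202 : Type := PresentedGroup rels96_202

/-- Relators for the group with label `(96, 204)` in the GAP database of small groups:
the extra-special group `⟨x₂, …, x₆⟩` of order `32` (central product of two
copies of `D₈`) extended by `⟨x₁⟩` of order `3`.
A relation `u = v` is written `u * v⁻¹`. -/
def rels96_204 : Set (FreeGroup (Fin 6)) :=
  { x₁ ^ 3,
    x₂ ^ 2, ⁅x₁, x₂⁆ * x₃⁻¹,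
    x₃ ^ 2, ⁅x₁, x₃⁆ * (x₂ * x₃)⁻¹, ⁅x₂, x₃⁆,
    x₄ ^ 2, ⁅x₁, x₄⁆ * x₅⁻¹, ⁅x₂, x₄⁆, ⁅x₃, x₄⁆ * x₆⁻¹,
    x₅ ^ 2, ⁅x₁, x₅⁆ * (x₄ * x₅)⁻¹, ⁅x₂, x₅⁆ * x₆⁻¹, ⁅x₃, x₅⁆, ⁅x₄, x₅⁆,
    x₆ ^ 2, ⁅x₁, x₆⁆, ⁅x₂, x₆⁆, ⁅x₃, x₆⁆, ⁅x₄, x₆⁆, ⁅x₅, x₆⁆ }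

/-- The group `G(96, 204)`. -/
abbrev G96_204 : Type := PresentedGroup rels96_204

end SmallGroups

/-! If `z` is central, the action relations say that the two strands form a dual pair: `⁅u i, w j⁆`
is `z` for `i = j` and `1` otherwise, up to inverting the `r₁ⱼ`. Commutation with the `w j` then
maps a subgroup onto `⟨z⟩ ^ 4` with `⟨z⟩` in the kernel, so `o(z) ^ 5` divides the group order
(`IsDualPair.card_dvd`). In order 96 this forces `o(z) = 2`, and a subgroup of order 32 containing
the pair and `z` is extraspecial with centre `⟨z⟩`.

The work lies in making `z` central. When `z` lies in every non-trivial normal subgroup and the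
centre is trivial, an involution centralized by a Sylow 2-subgroup has three conjugates forming a
normal four-group that contains `z`. `ConjTriple.false_of_actionRelations` excludes this by
permutation actions on three and on four points. Passing to a quotient maximal with `z ≠ 1` puts `z`
in the monolith of `G`. The Sylow 2-subgroup `Q` must then be normal (`exists_extraspecialData`):
otherwise an element of order three would generate a normal subgroup missing `z`.

On `Q/⟨z⟩`, a space of dimension four over the field of two elements, commutators give a symplectic
form and squares a quadratic form. An element `s` of order three preserves both. If it fixes a
non-zero vector, `Q` splits into a fixed hyperbolic plane and a rotated quaternion plane; the type
of the fixed plane gives the first two groups. If it fixes none, the third group results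
(`exists_relations`).

Every dual pair of `G` lies in the proper subgroup `Q` (`mem_ker_of_dual`), so no structure
generates `G`. Prestructures are exactly the lifts of pairs of dual bases of `Q/⟨z⟩`; there are
`|GL₄(𝔽₂)| · 2⁸ = 20160 · 256`. An automorphism fixing one is trivial, so the number of orbits is
this total divided by `|Aut G|`, which is counted in explicit models of order 96 as 576, 192 and
576. -/

section Commutators

/-! ### Commutators with values in a central cyclic subgroup, and dual pairs. -/

variable {G : Type*} [Group G]

theorem conj_eq_of_mem_center {z : G} (hz : z ∈ Subgroup.center G) (g : G) : g * z * g⁻¹ = z := by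
  rw [Subgroup.mem_center_iff.1 hz g, mul_inv_cancel_right]

theorem zpowers_le_center {z : G} (hz : z ∈ Subgroup.center G) :
    Subgroup.zpowers z ≤ Subgroup.center G := by
  simpa [Subgroup.zpowers_le] using hz

theorem normal_of_le_center {N : Subgroup G} (h : N ≤ Subgroup.center G) : N.Normal :=
  ⟨fun n hn g => by rwa [conj_eq_of_mem_center (h hn)]⟩

theorem commutator_mul_left {x y w : G} (h : ⁅y, w⁆ ∈ Subgroup.center G) :
    ⁅x * y, w⁆ = ⁅x, w⁆ * ⁅y, w⁆ := by
  have h1 : ⁅x * y, w⁆ = (x * ⁅y, w⁆ * x⁻¹) * ⁅x, w⁆ := by simp only [commutatorElement_def]; group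
  rw [h1, conj_eq_of_mem_center h, Subgroup.mem_center_iff.1 h]

theorem commutator_inv_left {x w : G} (h : ⁅x, w⁆ ∈ Subgroup.center G) :
    ⁅x⁻¹, w⁆ = ⁅x, w⁆⁻¹ := by
  have := commutator_mul_left (x := x⁻¹) h
  rw [inv_mul_cancel, commutatorElement_one_left] at this
  exact eq_inv_of_mul_eq_one_left this.symm

theorem commutator_pow_left {x w : G} (h : ⁅x, w⁆ ∈ Subgroup.center G) (n : ℕ) :
    ⁅x ^ n, w⁆ = ⁅x, w⁆ ^ n := by
  induction n with
  | zero => simp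
  | succ n ih => rw [pow_succ, commutator_mul_left h, ih, pow_succ]

theorem mem_zpowers_of_orderOf_two {z x : G} (hz : orderOf z = 2) :
    x ∈ Subgroup.zpowers z ↔ x = 1 ∨ x = z := by
  have hz2 : z ^ 2 = 1 := by rw [← hz, pow_orderOf_eq_one]
  constructor
  · rintro ⟨k, rfl⟩
    rcases Int.even_or_odd' k with ⟨m, rfl | rfl⟩
    · left; simp [zpow_mul, hz2]
    · right; simp [zpow_add, zpow_mul, hz2]
  · rintro (rfl | rfl)
    · exact one_mem _
    · exact Subgroup.mem_zpowers _

/-- The elements of `A` whose commutators with all `w j` are powers of a central element `z`. -/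
def commutatorPreimage {ι : Type*} {z : G} (hz : z ∈ Subgroup.center G) (w : ι → G)
    (A : Subgroup G) : Subgroup G where
  carrier := {x | x ∈ A ∧ ∀ j, ⁅x, w j⁆ ∈ Subgroup.zpowers z}
  mul_mem' := by
    rintro x y ⟨hx, hx'⟩ ⟨hy, hy'⟩
    refine ⟨mul_mem hx hy, fun j => ?_⟩
    rw [commutator_mul_left (zpowers_le_center hz (hy' j))]
    exact mul_mem (hx' j) (hy' j)
  one_mem' := ⟨one_mem _, fun j => by simp⟩
  inv_mem' := by
    rintro x ⟨hx, hx'⟩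
    refine ⟨inv_mem hx, fun j => ?_⟩
    rw [commutator_inv_left (zpowers_le_center hz (hx' j))]
    exact inv_mem (hx' j)

/-- The homomorphism `x ↦ (⁅x, w j⁆)ⱼ`. -/
def commutatorHom {ι : Type*} {z : G} (hz : z ∈ Subgroup.center G) (w : ι → G)
    (A : Subgroup G) : commutatorPreimage hz w A →* (ι → Subgroup.zpowers z) where
  toFun x j := ⟨⁅(x : G), w j⁆, x.2.2 j⟩
  map_one' := by ext; simp
  map_mul' x y := by
    ext j
    simp only [Subgroup.coe_mul, Pi.mul_apply]
    exact commutator_mul_left (zpowers_le_center hz (y.2.2 j))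

/-- Two families of elements whose mutual commutators form `z` times the identity matrix. -/
def IsDualPair {ι : Type*} [DecidableEq ι] (z : G) (u w : ι → G) : Prop :=
  ∀ i j, ⁅u i, w j⁆ = if i = j then z else 1

theorem IsDualPair.symm {ι : Type*} [DecidableEq ι] {z : G} {u w : ι → G} (h : IsDualPair z u w)
    (hz : z⁻¹ = z) : IsDualPair z w u := by
  intro i j
  rw [← commutatorElement_inv, h j i]
  by_cases hij : i = j <;> simp [hij, eq_comm, hz]

theorem mem_centralizer_range {ι : Type*} {w : ι → G} {x : G} :
    x ∈ Subgroup.centralizer (Set.range w) ↔ ∀ j, ⁅x, w j⁆ = 1 := by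
  rw [Subgroup.mem_centralizer_iff_commutator_eq_one]
  simp only [Set.forall_mem_range]
  exact forall_congr' fun j => by rw [← commutatorElement_inv, inv_eq_one]

/-- First isomorphism theorem for `commutatorHom`: the `u i` map to the standard generators of the
product of copies of `⟨z⟩`, so it is onto, and its kernel is the part of `A` centralizing all `w j`.
-/
theorem IsDualPair.card_preimage {ι : Type*} [Fintype ι] [DecidableEq ι] {z : G}
    (hz : z ∈ Subgroup.center G) {u w : ι → G} (h : IsDualPair z u w) {A : Subgroup G}
    (hu : ∀ i, u i ∈ A) :
    Nat.card (commutatorPreimage hz w A) =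
      orderOf z ^ Fintype.card ι * Nat.card ↥(A ⊓ Subgroup.centralizer (Set.range w)) := by
  have hmem : ∀ i, u i ∈ commutatorPreimage hz w A := fun i =>
    ⟨hu i, fun j => by rw [h i j]; split_ifs <;> simp⟩
  have hsurj : Function.Surjective (commutatorHom hz w A) := by
    rw [← MonoidHom.range_eq_top, eq_top_iff]
    rintro f -
    refine Subgroup.pi_mem_of_mulSingle_mem f fun i => ?_
    obtain ⟨k, hk⟩ := (f i).2
    refine ⟨⟨u i, hmem i⟩ ^ k, ?_⟩
    rw [map_zpow]
    ext j
    have hf : f i = (⟨z, Subgroup.mem_zpowers z⟩ : Subgroup.zpowers z) ^ k := by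
      ext; simpa using hk.symm
    rw [hf]
    by_cases hij : i = j
    · subst hij
      simp [commutatorHom, h i i]
    · rw [Pi.mulSingle_eq_of_ne (Ne.symm hij)]
      simp [commutatorHom, h i j, hij]
  have hker : Nat.card (commutatorHom hz w A).ker =
      Nat.card ↥(A ⊓ Subgroup.centralizer (Set.range w)) := by
    have : ((commutatorHom hz w A).ker).map (commutatorPreimage hz w A).subtype =
        A ⊓ Subgroup.centralizer (Set.range w) := by
      ext x
      rw [Subgroup.mem_map, Subgroup.mem_inf, mem_centralizer_range]
      constructor
      · rintro ⟨y, hy, rfl⟩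
        refine ⟨y.2.1, fun j => ?_⟩
        have := congrFun (MonoidHom.mem_ker.1 hy) j
        simpa [commutatorHom] using congrArg Subtype.val this
      · rintro ⟨hx, hx'⟩
        refine ⟨⟨x, hx, fun j => by rw [hx' j]; exact one_mem _⟩, ?_, rfl⟩
        rw [MonoidHom.mem_ker]
        ext j
        simp [commutatorHom, hx' j]
    rw [← this]
    exact (Nat.card_congr (Subgroup.equivMapOfInjective _ _
      (Subgroup.subtype_injective _)).toEquiv)
  rw [← Subgroup.card_mul_index (commutatorHom hz w A).ker, hker, Subgroup.index_ker,
    MonoidHom.range_eq_top.2 hsurj, mul_comm]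
  congr 1
  rw [Nat.card_congr (Subgroup.topEquiv).toEquiv, Nat.card_pi]
  simp [Nat.card_zpowers]

/-- The kernel in `card_preimage` contains `⟨z⟩`, which supplies the extra factor. This is the
source of every order estimate below. -/
theorem IsDualPair.card_dvd {ι : Type*} [Fintype ι] [DecidableEq ι] {z : G}
    (hz : z ∈ Subgroup.center G) {u w : ι → G} (h : IsDualPair z u w) {A : Subgroup G}
    (hu : ∀ i, u i ∈ A) (hzA : z ∈ A) :
    orderOf z ^ (Fintype.card ι + 1) ∣ Nat.card A := by
  refine dvd_trans ?_ (Subgroup.card_dvd_of_le (show commutatorPreimage hz w A ≤ A from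
    fun x hx => hx.1))
  rw [h.card_preimage hz hu, pow_succ]
  refine mul_dvd_mul_left _ ?_
  rw [← Nat.card_zpowers]
  refine Subgroup.card_dvd_of_le ?_
  rw [Subgroup.zpowers_le]
  refine ⟨hzA, mem_centralizer_range.2 fun j => ?_⟩
  rw [commutatorElement_eq_one_iff_commute]
  exact (Subgroup.mem_center_iff.1 hz (w j)).symm

section Extremal

variable [Finite G] {ι : Type*} [Fintype ι] [DecidableEq ι] {z : G} (hz : z ∈ Subgroup.center G)
  {u w : ι → G} (h : IsDualPair z u w) {A : Subgroup G} (hu : ∀ i, u i ∈ A) (hzA : z ∈ A)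
  (hA : Nat.card A = orderOf z ^ (Fintype.card ι + 1))

include hz h hu hzA hA

/-- When `|A|` attains the lower bound there is no room left: the preimage is all of `A` and the
kernel is exactly `⟨z⟩`. The lemmas of this section draw the extraspecial structure of `A` from
this. -/
theorem IsDualPair.commutatorPreimage_eq : commutatorPreimage hz w A = A := by
  have hle : commutatorPreimage hz w A ≤ A := fun x hx => hx.1
  refine Subgroup.eq_of_le_of_card_ge hle ?_
  rw [hA, pow_succ, h.card_preimage hz hu, ← Nat.card_zpowers]
  refine Nat.mul_le_mul_left _ (Subgroup.card_le_of_le ?_)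
  rw [Subgroup.zpowers_le]
  refine ⟨hzA, mem_centralizer_range.2 fun j => ?_⟩
  rw [commutatorElement_eq_one_iff_commute]
  exact (Subgroup.mem_center_iff.1 hz (w j)).symm

theorem IsDualPair.commutator_mem {x : G} (hx : x ∈ A) (j : ι) :
    ⁅x, w j⁆ ∈ Subgroup.zpowers z := by
  rw [← h.commutatorPreimage_eq hz hu hzA hA] at hx
  exact hx.2 j

theorem IsDualPair.mem_zpowers {x : G} (hx : x ∈ A) (hxw : ∀ j, ⁅x, w j⁆ = 1) :
    x ∈ Subgroup.zpowers z := by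
  have hcard := h.card_preimage hz hu
  rw [h.commutatorPreimage_eq hz hu hzA hA, hA, pow_succ] at hcard
  have hpos : 0 < orderOf z ^ Fintype.card ι := pow_pos (orderOf_pos z) _
  have h2 := Nat.eq_of_mul_eq_mul_left hpos hcard
  have hle : Subgroup.zpowers z ≤ A ⊓ Subgroup.centralizer (Set.range w) := by
    rw [Subgroup.zpowers_le]
    refine ⟨hzA, mem_centralizer_range.2 fun j => ?_⟩
    rw [commutatorElement_eq_one_iff_commute]
    exact (Subgroup.mem_center_iff.1 hz (w j)).symm
  rw [Subgroup.eq_of_le_of_card_ge hle (by rw [Nat.card_zpowers]; exact h2.ge)]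
  exact ⟨hx, mem_centralizer_range.2 hxw⟩

/-- On `A` the map `x ↦ ⁅x, w j⁆` is a homomorphism to an abelian group, so it kills `⁅x, y⁆`; an
element of `A` killed for every `j` is a power of `z`. -/
theorem IsDualPair.commutator_mem_zpowers {x y : G} (hx : x ∈ A) (hy : y ∈ A) :
    ⁅x, y⁆ ∈ Subgroup.zpowers z := by
  have hc : ∀ {x}, x ∈ A → ∀ j, ⁅x, w j⁆ ∈ Subgroup.center G := fun hx j =>
    zpowers_le_center hz (h.commutator_mem hz hu hzA hA hx j)
  refine h.mem_zpowers hz hu hzA hA ?_ fun j => ?_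
  · exact mul_mem (mul_mem (mul_mem hx hy) (inv_mem hx)) (inv_mem hy)
  · rw [commutatorElement_def x y, commutator_mul_left (hc (inv_mem hy) j),
      commutator_mul_left (hc (inv_mem hx) j), commutator_mul_left (hc hy j),
      commutator_inv_left (hc hx j), commutator_inv_left (hc hy j)]
    rw [Subgroup.mem_center_iff.1 (hc hy j)]
    group

theorem IsDualPair.pow_mem_zpowers {x : G} (hx : x ∈ A) : x ^ orderOf z ∈ Subgroup.zpowers z := by
  refine h.mem_zpowers hz hu hzA hA (pow_mem hx _) fun j => ?_
  have hm := h.commutator_mem hz hu hzA hA hx j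
  rw [commutator_pow_left (zpowers_le_center hz hm)]
  obtain ⟨k, hk⟩ := hm
  rw [← hk]
  change (z ^ k) ^ orderOf z = 1
  rw [← zpow_natCast, zpow_comm]
  simp [pow_orderOf_eq_one]

end Extremal

end Commutators

/-! ### Tuples satisfying the action relations, viewed as dual pairs. -/

namespace KodairaTuple

variable {G H : Type*} [Group G] [Group H] {b : ℕ}

/-- The image of a tuple under a group homomorphism. -/
def mapHom (f : G →* H) (P : KodairaTuple G b) : KodairaTuple H b where
  r₁ j := f (P.r₁ j)
  t₁ j := f (P.t₁ j)
  r₂ j := f (P.r₂ j)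
  t₂ j := f (P.t₂ j)
  z := f P.z

theorem ActionRelations.mapHom {P : KodairaTuple G b} (h : P.ActionRelations) (f : G →* H) :
    (P.mapHom f).ActionRelations where
  r₁_r₂_lt j k hjk := by simpa [KodairaTuple.mapHom] using congrArg f (h.r₁_r₂_lt j k hjk)
  r₁_r₂_eq j := by simpa [KodairaTuple.mapHom] using congrArg f (h.r₁_r₂_eq j)
  r₁_r₂_gt j k hjk := by simpa [KodairaTuple.mapHom] using congrArg f (h.r₁_r₂_gt j k hjk)
  r₁_t₂_lt j k hjk := by simpa [KodairaTuple.mapHom] using congrArg f (h.r₁_t₂_lt j k hjk)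
  r₁_t₂_eq j := by simpa [KodairaTuple.mapHom] using congrArg f (h.r₁_t₂_eq j)
  r₁_t₂_gt j k hjk := by simpa [KodairaTuple.mapHom] using congrArg f (h.r₁_t₂_gt j k hjk)
  r₁_z j := by simpa [KodairaTuple.mapHom] using congrArg f (h.r₁_z j)
  t₁_r₂_lt j k hjk := by simpa [KodairaTuple.mapHom] using congrArg f (h.t₁_r₂_lt j k hjk)
  t₁_r₂_eq j := by simpa [KodairaTuple.mapHom] using congrArg f (h.t₁_r₂_eq j)
  t₁_r₂_gt j k hjk := by simpa [KodairaTuple.mapHom] using congrArg f (h.t₁_r₂_gt j k hjk)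
  t₁_t₂_lt j k hjk := by simpa [KodairaTuple.mapHom] using congrArg f (h.t₁_t₂_lt j k hjk)
  t₁_t₂_eq j := by simpa [KodairaTuple.mapHom] using congrArg f (h.t₁_t₂_eq j)
  t₁_t₂_gt j k hjk := by simpa [KodairaTuple.mapHom] using congrArg f (h.t₁_t₂_gt j k hjk)
  t₁_z j := by simpa [KodairaTuple.mapHom] using congrArg f (h.t₁_z j)

theorem ActionRelations.of_mapHom {P : KodairaTuple G b} {f : G →* H}
    (hf : Function.Injective f) (h : (P.mapHom f).ActionRelations) : P.ActionRelations where
  r₁_r₂_lt j k hjk := hf (by simpa [KodairaTuple.mapHom] using h.r₁_r₂_lt j k hjk)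
  r₁_r₂_eq j := hf (by simpa [KodairaTuple.mapHom] using h.r₁_r₂_eq j)
  r₁_r₂_gt j k hjk := hf (by simpa [KodairaTuple.mapHom] using h.r₁_r₂_gt j k hjk)
  r₁_t₂_lt j k hjk := hf (by simpa [KodairaTuple.mapHom] using h.r₁_t₂_lt j k hjk)
  r₁_t₂_eq j := hf (by simpa [KodairaTuple.mapHom] using h.r₁_t₂_eq j)
  r₁_t₂_gt j k hjk := hf (by simpa [KodairaTuple.mapHom] using h.r₁_t₂_gt j k hjk)
  r₁_z j := hf (by simpa [KodairaTuple.mapHom] using h.r₁_z j)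
  t₁_r₂_lt j k hjk := hf (by simpa [KodairaTuple.mapHom] using h.t₁_r₂_lt j k hjk)
  t₁_r₂_eq j := hf (by simpa [KodairaTuple.mapHom] using h.t₁_r₂_eq j)
  t₁_r₂_gt j k hjk := hf (by simpa [KodairaTuple.mapHom] using h.t₁_r₂_gt j k hjk)
  t₁_t₂_lt j k hjk := hf (by simpa [KodairaTuple.mapHom] using h.t₁_t₂_lt j k hjk)
  t₁_t₂_eq j := hf (by simpa [KodairaTuple.mapHom] using h.t₁_t₂_eq j)
  t₁_t₂_gt j k hjk := hf (by simpa [KodairaTuple.mapHom] using h.t₁_t₂_gt j k hjk)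
  t₁_z j := hf (by simpa [KodairaTuple.mapHom] using h.t₁_z j)

/-- The elements indexed by the first strand. -/
def fst (P : KodairaTuple G b) : Fin b ⊕ Fin b → G := Sum.elim P.r₁ P.t₁

/-- The elements indexed by the second strand, ordered so as to be dual to `fst`. -/
def snd (P : KodairaTuple G b) : Fin b ⊕ Fin b → G := Sum.elim P.t₂ P.r₂

theorem exists_restrict (P : KodairaTuple G b) {K : Subgroup G} (h₁ : ∀ i, P.fst i ∈ K)
    (h₂ : ∀ i, P.snd i ∈ K) (hz : P.z ∈ K) : ∃ Q : KodairaTuple K b, Q.mapHom K.subtype = P :=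
  ⟨⟨fun j => ⟨_, h₁ (.inl j)⟩, fun j => ⟨_, h₁ (.inr j)⟩, fun j => ⟨_, h₂ (.inr j)⟩,
    fun j => ⟨_, h₂ (.inl j)⟩, ⟨_, hz⟩⟩, rfl⟩

variable {P : KodairaTuple G b}

/-- Every right-hand side collapses when `z` does. It is applied to images of a tuple under
homomorphisms that kill `z`. -/
theorem ActionRelations.commute_of_z_eq_one (h : P.ActionRelations) (hz : P.z = 1)
    (i k : Fin b ⊕ Fin b) : Commute (P.fst i) (P.snd k) := by
  rw [← commutatorElement_eq_one_iff_commute]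
  rcases i with j | j <;> rcases k with k | k <;> rcases lt_trichotomy j k with hjk | rfl | hjk <;>
    simp only [fst, snd, Sum.elim_inl, Sum.elim_inr]
  · exact h.r₁_t₂_lt _ _ hjk
  · simp [h.r₁_t₂_eq, hz]
  · simp [h.r₁_t₂_gt _ _ hjk, hz]
  · exact h.r₁_r₂_lt _ _ hjk
  · exact h.r₁_r₂_eq _
  · simp [h.r₁_r₂_gt _ _ hjk, hz]
  · exact h.t₁_t₂_lt _ _ hjk
  · simp [h.t₁_t₂_eq, hz]
  · simp [h.t₁_t₂_gt _ _ hjk, hz]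
  · exact h.t₁_r₂_lt _ _ hjk
  · simp [h.t₁_r₂_eq, hz]
  · simp [h.t₁_r₂_gt _ _ hjk, hz]

/-- When `z` is central, the two strands are dual families with respect to the commutator. -/
theorem ActionRelations.isDualPair_of_mem_center (h : P.ActionRelations)
    (hz : P.z ∈ Subgroup.center G) :
    IsDualPair P.z (Sum.elim (fun j => (P.r₁ j)⁻¹) P.t₁) P.snd := by
  have hc : ∀ g : G, ⁅g, P.z⁆ = 1 := fun g =>
    commutatorElement_eq_one_iff_mul_comm.2 (Subgroup.mem_center_iff.1 hz g)
  have hc' : ∀ g, g * P.z = P.z * g := Subgroup.mem_center_iff.1 hz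
  have hci : ∀ g : G, ⁅P.z⁻¹, g⁆ = 1 := fun g =>
    commutatorElement_eq_one_iff_mul_comm.2
      (Subgroup.mem_center_iff.1 (inv_mem hz) g).symm
  -- The relation for `r₁ⱼ` and `t₂ⱼ` gives `z⁻¹` and the one for `t₁ⱼ` and `r₂ⱼ` gives `z`;
  -- inverting the `r₁ⱼ` makes the signs agree.
  have hr : ∀ j y e, e ∈ Subgroup.center G → ⁅P.r₁ j, y⁆ = e → ⁅(P.r₁ j)⁻¹, y⁆ = e⁻¹ := by
    intro j y e he hj
    rw [commutator_inv_left (by rwa [hj]), hj]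
  rintro (j | j) (k | k) <;> rcases lt_trichotomy j k with hjk | rfl | hjk <;>
    simp only [snd, Sum.elim_inl, Sum.elim_inr]
  · rw [hr _ _ _ (one_mem _) (h.r₁_t₂_lt _ _ hjk)]; simp [hjk.ne]
  · rw [hr _ _ _ (inv_mem hz) (h.r₁_t₂_eq _)]; simp
  · rw [hr _ _ _ (one_mem _) ((h.r₁_t₂_gt _ _ hjk).trans (hci _))]; simp [hjk.ne']
  · rw [hr _ _ _ (one_mem _) (h.r₁_r₂_lt _ _ hjk)]; simp
  · rw [hr _ _ _ (one_mem _) (h.r₁_r₂_eq _)]; simp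
  · rw [hr _ _ _ (one_mem _) ((h.r₁_r₂_gt _ _ hjk).trans ?_)]; · simp
    rw [mul_assoc _ _ P.z, hc', mul_assoc _ _ (P.z * _), ← mul_assoc (P.r₂ k), hc' (P.r₂ k)]
    group
  · rw [h.t₁_t₂_lt _ _ hjk]; simp
  · rw [h.t₁_t₂_eq, hc]; simp
  · rw [h.t₁_t₂_gt _ _ hjk, hc' (P.t₂ j)⁻¹]
    simp only [mul_assoc, inv_mul_cancel_left, mul_inv_cancel_left]
    rw [← mul_assoc (P.t₂ k), hc' (P.t₂ k), mul_assoc, ← mul_assoc _ P.z⁻¹,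
      Subgroup.mem_center_iff.1 (inv_mem hz) (P.t₂ j)⁻¹]
    group
    rw [← hc' (P.t₂ k)]
    simp
  · rw [h.t₁_r₂_lt _ _ hjk]; simp [hjk.ne]
  · rw [h.t₁_r₂_eq, hc']; simp
  · rw [h.t₁_r₂_gt _ _ hjk, hc]; simp [hjk.ne']

/-- When `z² = 1` the inversion of the `r₁ⱼ` is invisible. -/
theorem ActionRelations.isDualPair (h : P.ActionRelations) (hz : P.z ∈ Subgroup.center G)
    (hz2 : P.z ^ 2 = 1) : IsDualPair P.z P.fst P.snd := by
  have hzz : P.z⁻¹ = P.z := by rw [inv_eq_iff_mul_eq_one, ← pow_two, hz2]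
  have h1 := h.isDualPair_of_mem_center hz
  rintro (j | j) k
  · have h2 := h1 (.inl j) k
    have := commutator_inv_left (x := (P.r₁ j)⁻¹) (w := P.snd k) (by
      rw [Sum.elim_inl] at h2
      rw [h2]; split_ifs
      · exact hz
      · exact one_mem _)
    rw [inv_inv] at this
    simp only [fst, Sum.elim_inl] at h2 ⊢
    rw [this, h2]
    split_ifs <;> simp [hzz]
  · exact h1 (.inr j) k

/-- A central dual pair of order two gives back the relations. -/
theorem ActionRelations.of_isDualPair (hz : P.z ∈ Subgroup.center G)
    (hz2 : P.z ^ 2 = 1) (h : IsDualPair P.z P.fst P.snd) : P.ActionRelations := by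
  have hzz : P.z⁻¹ = P.z := by rw [inv_eq_iff_mul_eq_one, ← pow_two, hz2]
  have hzm : P.z * P.z = 1 := by rw [← pow_two, hz2]
  have hc : ∀ g : G, ⁅g, P.z⁆ = 1 := fun g =>
    commutatorElement_eq_one_iff_mul_comm.2 (Subgroup.mem_center_iff.1 hz g)
  have hc' : ∀ g, g * P.z = P.z * g := Subgroup.mem_center_iff.1 hz
  have hcl : ∀ g : G, ⁅P.z, g⁆ = 1 := fun g =>
    commutatorElement_eq_one_iff_mul_comm.2 (Subgroup.mem_center_iff.1 hz g).symm
  have hrt : ∀ j k, ⁅P.r₁ j, P.t₂ k⁆ = if j = k then P.z else 1 := fun j k => by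
    simpa [fst, snd] using h (.inl j) (.inl k)
  have hrr : ∀ j k, ⁅P.r₁ j, P.r₂ k⁆ = 1 := fun j k => by
    simpa [fst, snd] using h (.inl j) (.inr k)
  have htt : ∀ j k, ⁅P.t₁ j, P.t₂ k⁆ = 1 := fun j k => by
    simpa [fst, snd] using h (.inr j) (.inl k)
  have htr : ∀ j k, ⁅P.t₁ j, P.r₂ k⁆ = if j = k then P.z else 1 := fun j k => by
    simpa [fst, snd] using h (.inr j) (.inr k)
  have hc'' : ∀ g h, g * (P.z * h) = P.z * (g * h) := fun g h => by
    rw [← mul_assoc, hc', mul_assoc]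
  have hzm' : ∀ g, P.z * (P.z * g) = g := fun g => by rw [← mul_assoc, hzm, one_mul]
  constructor
  · exact fun j k _ => hrr j k
  · exact fun j => hrr j j
  · intro j k _
    rw [hrr, hzz]
    simp only [mul_assoc, hc'', hzm']
    simp
  · intro j k hjk; simp [hrt, hjk.ne]
  · intro j; simp [hrt, hzz]
  · intro j k hjk; simp [hrt, hzz, hcl, hjk.ne']
  · intro j; rw [hc, hc]
  · intro j k hjk; simp [htr, hjk.ne]
  · intro j; rw [htr, hc']; simp
  · intro j k hjk; rw [htr, hc]; simp [hjk.ne']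
  · exact fun j k _ => htt j k
  · intro j; rw [htt, hc]
  · intro j k _
    rw [htt, hzz]
    simp only [mul_assoc, hc'', hzm']
    simp
  · intro j; rw [hc, hc]

/-- `r₂ⱼ r₁ⱼ` commutes with `z`, and so does `t₂ⱼ t₁ⱼ`. -/
theorem ActionRelations.commute_snd_mul_fst (h : P.ActionRelations) (j : Fin b) :
    Commute (P.r₂ j * P.r₁ j) P.z ∧ Commute (P.t₂ j * P.t₁ j) P.z := by
  have key : ∀ x y : G, ⁅x, P.z⁆ = ⁅y⁻¹, P.z⁆ → Commute (y * x) P.z := by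
    intro x y hxy
    have h1 : x * P.z * x⁻¹ = y⁻¹ * P.z * y := by
      simpa [commutatorElement_def] using hxy
    rw [mul_inv_eq_iff_eq_mul] at h1
    rw [commute_iff_eq, mul_assoc, h1]
    group
  exact ⟨key _ _ (h.r₁_z j), key _ _ (h.t₁_z j)⟩

end KodairaTuple

/-! ### Commutative-transitive groups and permutations of three or four points. -/

namespace KodairaTuple

variable {G : Type*} [Group G]

/-- If commutativity is transitive on non-trivial elements, then a prestructure has `z = 1`. -/
theorem ActionRelations.z_eq_one_of_commTransitive {P : KodairaTuple G 2} (h : P.ActionRelations)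
    (ht : ∀ x y w : G, y ≠ 1 → Commute x y → Commute y w → Commute x w) : P.z = 1 := by
  have h12 : (0 : Fin 2) < 1 := by decide
  by_cases ha : P.r₁ 0 = 1
  · simpa [ha] using (h.r₁_t₂_eq 0).symm
  by_cases hc : P.r₂ 1 = 1
  · have := h.t₁_r₂_eq 1
    rw [hc, commutatorElement_one_right, eq_comm, mul_eq_one_iff_eq_inv] at this
    simpa using this
  -- Consecutive elements of the chain `r₁ 1`, `r₂ 1`, `r₁ 0`, `t₂ 1` commute, so transitivity makes
  -- the ends commute; but their commutator is `z⁻¹`.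
  have e1 : Commute (P.r₁ 1) (P.r₂ 1) := commutatorElement_eq_one_iff_commute.1 (h.r₁_r₂_eq 1)
  have e2 : Commute (P.r₁ 0) (P.r₂ 1) := commutatorElement_eq_one_iff_commute.1 (h.r₁_r₂_lt 0 1 h12)
  have e3 : Commute (P.r₁ 0) (P.t₂ 1) := commutatorElement_eq_one_iff_commute.1 (h.r₁_t₂_lt 0 1 h12)
  have e4 : Commute (P.r₁ 1) (P.t₂ 1) := ht _ _ _ ha (ht _ _ _ hc e1 e2.symm) e3
  have := h.r₁_t₂_eq 1
  rw [commutatorElement_eq_one_iff_commute.2 e4] at this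
  exact inv_eq_one.1 this.symm

theorem perm_three_commTransitive : ∀ x y w : Equiv.Perm (Fin 3), y ≠ 1 → x * y = y * x →
    y * w = w * y → x * w = w * x := by decide +kernel

theorem perm_four_commTransitive : ∀ y : Equiv.Perm (Fin 4), y ≠ 1 → Equiv.Perm.sign y = 1 →
    ∀ x, Equiv.Perm.sign x = 1 → x * y = y * x → ∀ w, Equiv.Perm.sign w = 1 →
    y * w = w * y → x * w = w * x := by decide +kernel

/-- The odd permutations are 4-cycles, excluded by `s ^ 6 = 1`, and transpositions, which equal
their cube and have fixed points. -/
theorem perm_four_even : ∀ s : Equiv.Perm (Fin 4), s ^ 6 = 1 →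
    ((∃ i, (s ^ 3) i = i) → s ^ 3 = 1) → Equiv.Perm.sign s = 1 := by decide +kernel

/-- If `X` is a 3-cycle, so is `Y`, and a product of powers of a 3-cycle fixing `0` is trivial. If
`X` is a transposition, then `Y = X`, and everything commuting with it fixes its third point `k`. -/
theorem perm_three_trichotomy : ∀ X Y : Equiv.Perm (Fin 3), X * Y = Y * X → (X * Y) 0 = 0 →
    X 0 ≠ 0 → (Equiv.Perm.sign X = 1 ∧ X ^ 3 = 1 ∧ Y ^ 3 = 1 ∧ X * Y = 1 ∧
      ∀ U, (U * X = X * U ∨ U * Y = Y * U) → Equiv.Perm.sign U = 1) ∨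
      ∃ k, k ≠ 0 ∧ ∀ U, (U * X = X * U ∨ U * Y = Y * U) → U k = k := by decide +kernel

theorem ActionRelations.exists_restrict {P : KodairaTuple G 2} (h : P.ActionRelations)
    {K : Subgroup G} (h₁ : ∀ i, P.fst i ∈ K)
    (h₂ : ∀ i, P.snd i ∈ K) (hz : P.z ∈ K) :
    ∃ Q : KodairaTuple K 2, Q.ActionRelations ∧ Q.mapHom K.subtype = P := by
  obtain ⟨Q, rfl⟩ := P.exists_restrict h₁ h₂ hz
  exact ⟨Q, .of_mapHom K.subtype_injective h, rfl⟩

theorem ActionRelations.z_eq_one_of_perm_three {P : KodairaTuple (Equiv.Perm (Fin 3)) 2}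
    (h : P.ActionRelations) : P.z = 1 :=
  h.z_eq_one_of_commTransitive perm_three_commTransitive

theorem ActionRelations.z_eq_one_of_perm_four {P : KodairaTuple (Equiv.Perm (Fin 4)) 2}
    (h : P.ActionRelations) (h₁ : ∀ i, Equiv.Perm.sign (P.fst i) = 1)
    (h₂ : ∀ i, Equiv.Perm.sign (P.snd i) = 1) (hz : Equiv.Perm.sign P.z = 1) : P.z = 1 := by
  obtain ⟨Q, hQ, rfl⟩ := h.exists_restrict (K := alternatingGroup (Fin 4))
    (fun i => Equiv.Perm.mem_alternatingGroup.2 (h₁ i))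
    (fun i => Equiv.Perm.mem_alternatingGroup.2 (h₂ i)) (Equiv.Perm.mem_alternatingGroup.2 hz)
  have : Q.z = 1 := by
    refine hQ.z_eq_one_of_commTransitive fun x y w hy hxy hyw => ?_
    refine Subtype.ext (perm_four_commTransitive y (fun h => hy (Subtype.ext h))
      (Equiv.Perm.mem_alternatingGroup.1 y.2) x (Equiv.Perm.mem_alternatingGroup.1 x.2)
      (congrArg Subtype.val hxy) w (Equiv.Perm.mem_alternatingGroup.1 w.2)
      (congrArg Subtype.val hyw))
  change (alternatingGroup (Fin 4)).subtype Q.z = 1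
  rw [this, map_one]

end KodairaTuple

/-! ### Normal four-groups whose involutions are permuted transitively. -/

theorem fin_three_exists_ne : ∀ i j : Fin 3, ∃ k, i ≠ k ∧ j ≠ k := by decide

/-- Three commuting involutions with product `1`, permuted transitively by conjugation. -/
structure ConjTriple (H : Type*) [Group H] where
  perm : H →* Equiv.Perm (Fin 3)
  elt : Fin 3 → H
  conj : ∀ g i, g * elt i * g⁻¹ = elt (perm g i)
  ne_one : ∀ i, elt i ≠ 1
  mul_self : ∀ i, elt i * elt i = 1
  commute : ∀ i j, Commute (elt i) (elt j)
  prod : elt 0 * elt 1 * elt 2 = 1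
  transitive : ∀ i j, ∃ g, perm g i = j

namespace ConjTriple

variable {H : Type*} [Group H] (T : ConjTriple H)

theorem mul_eq : ∀ i j k : Fin 3, i ≠ j → i ≠ k → j ≠ k → T.elt i * T.elt j = T.elt k := by
  have inv : ∀ i, (T.elt i)⁻¹ = T.elt i := fun i => inv_eq_of_mul_eq_one_left (T.mul_self i)
  have h012 : T.elt 0 * T.elt 1 = T.elt 2 := by
    rw [← inv 2]; exact eq_inv_of_mul_eq_one_left T.prod
  have h120 : T.elt 1 * T.elt 2 = T.elt 0 := by
    rw [← inv 0]; exact eq_inv_of_mul_eq_one_right (by rw [← mul_assoc]; exact T.prod)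
  have h021 : T.elt 0 * T.elt 2 = T.elt 1 := by
    rw [← h012, ← mul_assoc, T.mul_self, one_mul]
  have c := fun i j => (T.commute i j).eq
  intro i j k
  fin_cases i <;> fin_cases j <;> fin_cases k <;> simp <;>
    first | exact h012 | exact h120 | exact h021 | (rw [c]; first | exact h012 | exact h120 | exact h021)

theorem elt_injective : Function.Injective T.elt := by
  intro i j hij
  by_contra hne
  obtain ⟨k, hik, hjk⟩ : ∃ k, i ≠ k ∧ j ≠ k := fin_three_exists_ne i j
  have := T.mul_eq i j k hne hik hjk
  rw [hij, T.mul_self] at this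
  exact T.ne_one k this.symm

/-- The Klein four group formed by the triple. -/
def four : Subgroup H where
  carrier := {x | x = 1 ∨ ∃ i, x = T.elt i}
  mul_mem' := by
    rintro x y (rfl | ⟨i, rfl⟩) (rfl | ⟨j, rfl⟩)
    · simp
    · right; exact ⟨j, by simp⟩
    · right; exact ⟨i, by simp⟩
    · by_cases hij : i = j
      · left; rw [hij, T.mul_self]
      · obtain ⟨k, hik, hjk⟩ : ∃ k, i ≠ k ∧ j ≠ k := fin_three_exists_ne i j
        right; exact ⟨k, T.mul_eq i j k hij hik hjk⟩
  one_mem' := Or.inl rfl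
  inv_mem' := by
    rintro x (rfl | ⟨i, rfl⟩)
    · simp
    · right; exact ⟨i, inv_eq_of_mul_eq_one_left (T.mul_self i)⟩

theorem elt_mem_four (i : Fin 3) : T.elt i ∈ T.four := Or.inr ⟨i, rfl⟩

theorem four_normal : T.four.Normal := by
  refine ⟨?_⟩
  rintro x (rfl | ⟨i, rfl⟩) g
  · simp
  · rw [T.conj]; exact T.elt_mem_four _

theorem card_four : Nat.card T.four = 4 := by
  have : Function.Bijective (fun i : Option (Fin 3) =>
      (i.elim ⟨1, one_mem _⟩ (fun i => ⟨T.elt i, T.elt_mem_four i⟩) : T.four)) := by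
    constructor
    · rintro (_ | i) (_ | j) h
      · rfl
      · exact absurd (congrArg Subtype.val h).symm (T.ne_one j)
      · exact absurd (congrArg Subtype.val h) (T.ne_one i)
      · exact congrArg some (T.elt_injective (congrArg Subtype.val h))
    · rintro ⟨x, rfl | ⟨i, rfl⟩⟩
      · exact ⟨none, rfl⟩
      · exact ⟨some i, rfl⟩
  rw [← Nat.card_eq_of_bijective _ this]
  simp

theorem mul_self_of_mem_four {x : H} (hx : x ∈ T.four) : x * x = 1 := by
  rcases hx with rfl | ⟨i, rfl⟩
  · simp
  · exact T.mul_self i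

theorem perm_eq_iff {g : H} {i j : Fin 3} : T.perm g i = j ↔ g * T.elt i * g⁻¹ = T.elt j := by
  rw [T.conj]; exact T.elt_injective.eq_iff.symm

theorem perm_apply_self {g : H} {i : Fin 3} : T.perm g i = i ↔ Commute g (T.elt i) := by
  rw [T.perm_eq_iff, mul_inv_eq_iff_eq_mul]; rfl

theorem perm_elt (i : Fin 3) : T.perm (T.elt i) = 1 := by
  ext j; rw [T.perm_apply_self.2 (T.commute i j)]; rfl

/-- The stabilizer of a point. -/
def stab (k : Fin 3) : Subgroup H := (MulAction.stabilizer (Equiv.Perm (Fin 3)) k).comap T.perm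

theorem mem_stab {k : Fin 3} {g : H} : g ∈ T.stab k ↔ T.perm g k = k := Iff.rfl

theorem mem_stab_iff_commute {k : Fin 3} {g : H} : g ∈ T.stab k ↔ Commute g (T.elt k) :=
  T.perm_apply_self

theorem card_stab (k : Fin 3) : Nat.card (T.stab k) * 3 = Nat.card H := by
  let _ : MulAction H (Fin 3) := MulAction.compHom _ T.perm
  have : MulAction.IsPretransitive H (Fin 3) := ⟨fun i j => T.transitive i j⟩
  have h := MulAction.index_stabilizer_of_transitive H k
  have e : T.stab k = MulAction.stabilizer H k := rfl
  rw [e, ← Subgroup.card_mul_index (MulAction.stabilizer H k), h]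
  simp

end ConjTriple

namespace ConjTriple

variable {H : Type*} [Group H] (T : ConjTriple H) {P : KodairaTuple H 2}

theorem orderOf_elt (i : Fin 3) : orderOf (T.elt i) = 2 :=
  orderOf_eq_prime (by rw [pow_two]; exact T.mul_self i) (T.ne_one i)

theorem card_stab_dvd (hH : Nat.card H ∣ 96) (k : Fin 3) : Nat.card (T.stab k) ∣ 32 := by
  have h := T.card_stab k
  rw [← h] at hH
  exact Nat.dvd_of_mul_dvd_mul_right (k := 3) (by norm_num) hH

theorem card_ker_dvd (hH : Nat.card H ∣ 96) : Nat.card T.perm.ker ∣ 32 :=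
  (Subgroup.card_dvd_of_le (show T.perm.ker ≤ T.stab 0 from fun g hg => by
    rw [T.mem_stab, MonoidHom.mem_ker.1 hg]; rfl)).trans (T.card_stab_dvd hH 0)

/-- Dividing `T.stab k` by its central involution `T.elt k` makes `z` central and keeps it
non-trivial. The dual pair bound gives 32 for the quotient, hence 64 for a group whose order divides
32. -/
theorem false_of_mem_stab_ne [Finite H] (hH : Nat.card H ∣ 96) (hP : P.ActionRelations)
    (hz : P.z = T.elt 0) {k : Fin 3} (hk : k ≠ 0) (h₁ : ∀ i, P.fst i ∈ T.stab k)
    (h₂ : ∀ i, P.snd i ∈ T.stab k) : False := by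
  have hzk : P.z ∈ T.stab k := by rw [hz, T.mem_stab, T.perm_elt]; rfl
  obtain ⟨Q, hQ, rfl⟩ := hP.exists_restrict h₁ h₂ hzk
  set c : T.stab k := ⟨T.elt k, by rw [T.mem_stab, T.perm_elt]; rfl⟩ with hc
  have hcc : c ∈ Subgroup.center (T.stab k) := by
    rw [Subgroup.mem_center_iff]
    rintro ⟨g, hg⟩
    exact Subtype.ext (T.mem_stab_iff_commute.1 hg)
  have hco : orderOf c = 2 := by rw [← Subgroup.orderOf_coe, T.orderOf_elt]
  have hN : (Subgroup.zpowers c).Normal := normal_of_le_center (zpowers_le_center hcc)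
  let π := QuotientGroup.mk' (Subgroup.zpowers c)
  have hcard : Nat.card (T.stab k ⧸ Subgroup.zpowers c) * 2 = Nat.card (T.stab k) := by
    rw [← hco, ← Nat.card_zpowers]
    exact (Subgroup.card_eq_card_quotient_mul_card_subgroup _).symm
  have hQz : (Q.z : H) = T.elt 0 := hz
  have hz1 : π Q.z ≠ 1 := by
    intro h
    rw [QuotientGroup.mk'_apply, QuotientGroup.eq_one_iff, mem_zpowers_of_orderOf_two hco] at h
    rcases h with h | h
    · exact T.ne_one 0 (hQz ▸ congrArg Subtype.val h)
    · exact hk (T.elt_injective (hQz ▸ congrArg Subtype.val h)).symm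
  have hzc : π Q.z ∈ Subgroup.center _ := by
    rw [Subgroup.mem_center_iff]
    intro g
    obtain ⟨g, rfl⟩ := QuotientGroup.mk'_surjective _ g
    -- An element fixing `k` either fixes the other two involutions or exchanges them, and these two
    -- differ by the factor `c`.
    have : g * Q.z * g⁻¹ = Q.z ∨ g * Q.z * g⁻¹ = Q.z * c := by
      by_cases h0 : T.perm g 0 = 0
      · left
        ext
        simp [hQz, T.conj, h0]
      · right
        ext
        simp only [Subgroup.coe_mul, InvMemClass.coe_inv, hQz, T.conj, hc]
        refine (T.mul_eq 0 k _ hk.symm (Ne.symm h0) fun hkk => hk ?_).symm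
        have hgk : T.perm g k = k := g.2
        exact ((T.perm g).injective (hgk.trans hkk))
    rw [← mul_inv_eq_iff_eq_mul, ← map_mul, ← map_inv, ← map_mul]
    rcases this with h | h
    · rw [h]
    · rw [h, map_mul]
      have : π c = 1 := (QuotientGroup.eq_one_iff _).2 (Subgroup.mem_zpowers c)
      rw [this, mul_one]
  have hzo : orderOf (π Q.z) = 2 := by
    refine orderOf_eq_prime ?_ hz1
    rw [← map_pow]
    have : Q.z ^ 2 = 1 := by
      ext
      rw [Subgroup.coe_pow, hQz, pow_two, T.mul_self]; rfl
    rw [this, map_one]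
  have hd := ((hQ.mapHom π).isDualPair_of_mem_center hzc).card_dvd hzc (A := ⊤)
    (fun _ => trivial) trivial
  rw [Subgroup.card_top, hzo] at hd
  have h64 : 64 ∣ Nat.card (T.stab k) := by
    rw [← hcard]
    exact mul_dvd_mul_right (by simpa using hd) 2
  exact absurd (h64.trans (T.card_stab_dvd hH k)) (by norm_num)

theorem perm_three_stab_zero : ∀ g x : Equiv.Perm (Fin 3), g 0 = 0 → x 0 = 0 → x ≠ 1 →
    (g = 1 ∨ g = x) ∧ x 1 = 2 := by decide

/-- Here the whole tuple lies in the centralizer `T.stab 0` of `z`, which must be extraspecial of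
order 32. Using a second stabilizer, the kernel of `T.perm` turns out abelian, and then no larger
than the four-group, which is too small for `|H| = 96`. -/
theorem false_of_mem_stab_zero [Finite H] (hH : Nat.card H ∣ 96) (hP : P.ActionRelations)
    (hz : P.z = T.elt 0) (h₁ : ∀ i, P.fst i ∈ T.stab 0) (h₂ : ∀ i, P.snd i ∈ T.stab 0) :
    False := by
  have hz0 : P.z ∈ T.stab 0 := by rw [hz, T.mem_stab, T.perm_elt]; rfl
  obtain ⟨Q, hQ, rfl⟩ := hP.exists_restrict h₁ h₂ hz0
  have hQz : (Q.z : H) = T.elt 0 := hz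
  have hzc : Q.z ∈ Subgroup.center (T.stab 0) := by
    rw [Subgroup.mem_center_iff]
    rintro ⟨g, hg⟩
    exact Subtype.ext (by simpa [hQz] using (T.mem_stab_iff_commute.1 hg).eq)
  have hzo : orderOf Q.z = 2 := by rw [← Subgroup.orderOf_coe, hQz, T.orderOf_elt]
  have hdual := hQ.isDualPair_of_mem_center hzc
  have hd := hdual.card_dvd hzc (A := ⊤) (fun _ => trivial) trivial
  have h32 : Nat.card (T.stab 0) = 32 :=
    Nat.dvd_antisymm (T.card_stab_dvd hH 0) (by simpa [hzo] using hd)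
  have hA : Nat.card (⊤ : Subgroup (T.stab 0)) =
      orderOf Q.z ^ (Fintype.card (Fin 2 ⊕ Fin 2) + 1) := by
    simp [hzo, h32]
  have hcomm : ∀ x y : H, x ∈ T.stab 0 → y ∈ T.stab 0 → ⁅x, y⁆ = 1 ∨ ⁅x, y⁆ = T.elt 0 := by
    intro x y hx hy
    have := hdual.commutator_mem_zpowers hzc (A := ⊤) (fun _ => trivial) trivial hA
      (x := ⟨x, hx⟩) (y := ⟨y, hy⟩) trivial trivial
    rw [mem_zpowers_of_orderOf_two hzo] at this
    rcases this with h | h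
    · exact Or.inl (congrArg Subtype.val h)
    · exact Or.inr ((congrArg Subtype.val h).trans hQz)
  have hcenter : ∀ x : H, x ∈ T.stab 0 → (∀ y ∈ T.stab 0, Commute x y) → x = 1 ∨ x = T.elt 0 := by
    intro x hx hxy
    have := hdual.mem_zpowers hzc (A := ⊤) (fun _ => trivial) trivial hA
      (x := ⟨x, hx⟩) trivial (fun j => commutatorElement_eq_one_iff_commute.2
        (Subtype.ext (hxy _ (Q.snd j).2)))
    rw [mem_zpowers_of_orderOf_two hzo] at this
    rcases this with h | h
    · exact Or.inl (congrArg Subtype.val h)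
    · exact Or.inr ((congrArg Subtype.val h).trans hQz)
  have he1 : T.elt 1 ∈ T.stab 0 := by rw [T.mem_stab, T.perm_elt]; rfl
  have hne1 : ¬ (T.elt 1 = 1 ∨ T.elt 1 = T.elt 0) := by
    rintro (h | h)
    · exact T.ne_one 1 h
    · exact absurd (T.elt_injective h) (by decide)
  obtain ⟨x, hx, hx1⟩ : ∃ x ∈ T.stab 0, T.perm x ≠ 1 := by
    by_contra! hcon
    refine hne1 (hcenter _ he1 fun y hy => ?_)
    refine (T.perm_apply_self.1 ?_).symm
    rw [hcon y hy]; rfl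
  have hle : T.perm.ker ≤ T.stab 0 := fun g hg => by
    rw [T.mem_stab, MonoidHom.mem_ker.1 hg]; rfl
  -- Conjugating by `g` shows that the commutator lies in `⟨T.elt 1⟩` as well as in `⟨T.elt 0⟩`, and
  -- these meet trivially.
  have hab : ∀ a b : H, a ∈ T.perm.ker → b ∈ T.perm.ker → Commute a b := by
    intro a b ha hb
    obtain ⟨g, hg⟩ := T.transitive 0 1
    have hn := T.perm.normal_ker
    rcases hcomm a b (hle ha) (hle hb) with h | h
    · exact commutatorElement_eq_one_iff_commute.1 h
    · have hc : ∀ a, a ∈ T.perm.ker → g⁻¹ * a * g ∈ T.perm.ker := fun a ha => by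
        simpa using hn.conj_mem a ha g⁻¹
      rcases hcomm _ _ (hle (hc a ha)) (hle (hc b hb)) with h' | h'
      · have : ⁅a, b⁆ = g * ⁅g⁻¹ * a * g, g⁻¹ * b * g⁆ * g⁻¹ := by
          simp only [commutatorElement_def]; group
        rw [h', mul_one, mul_inv_cancel] at this
        exact commutatorElement_eq_one_iff_commute.1 this
      · have : ⁅a, b⁆ = g * ⁅g⁻¹ * a * g, g⁻¹ * b * g⁆ * g⁻¹ := by
          simp only [commutatorElement_def]; group
        rw [h', T.conj, hg, h] at this
        exact absurd (T.elt_injective this) (by decide)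
  have hfix : ∀ y ∈ T.perm.ker, ⁅y, x⁆ = 1 → y = 1 ∨ y = T.elt 0 := by
    intro y hy hyx
    refine hcenter y (hle hy) fun g hg => ?_
    rcases (perm_three_stab_zero _ _ hg hx hx1).1 with h | h
    · exact hab y g hy (MonoidHom.mem_ker.2 h)
    · have : x⁻¹ * g ∈ T.perm.ker := by rw [MonoidHom.mem_ker, map_mul, map_inv, h]; simp
      have h3 := (commutatorElement_eq_one_iff_commute.1 hyx).mul_right (hab y _ hy this)
      rwa [mul_inv_cancel_left] at h3
  have hx12 := (perm_three_stab_zero _ _ hx hx hx1).2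
  have hker : T.perm.ker ≤ T.four := by
    intro y hy
    rcases hcomm y x (hle hy) hx with h | h
    · rcases hfix y hy h with rfl | rfl
      · exact one_mem _
      · exact T.elt_mem_four 0
    -- Since `x` swaps the other two involutions, `⁅T.elt 1, x⁆ = T.elt 0`; multiplying `y` by
    -- `T.elt 1` therefore makes it commute with `x`.
    · have hy1 : T.elt 1 * y ∈ T.perm.ker :=
        mul_mem (MonoidHom.mem_ker.2 (T.perm_elt 1)) hy
      have h1x : ⁅T.elt 1, x⁆ = T.elt 0 := by
        rw [← commutatorElement_inv, commutatorElement_def, T.conj, hx12, mul_inv_rev, inv_inv,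
          inv_eq_of_mul_eq_one_left (T.mul_self 2)]
        exact T.mul_eq 1 2 0 (by decide) (by decide) (by decide)
      have : ⁅T.elt 1 * y, x⁆ = 1 := by
        have e : ⁅T.elt 1 * y, x⁆ = T.elt 1 * ⁅y, x⁆ * (T.elt 1)⁻¹ * ⁅T.elt 1, x⁆ := by
          simp only [commutatorElement_def]; group
        rw [e, h, h1x, (T.commute 1 0).eq, mul_inv_cancel_right, T.mul_self]
      have e : y = T.elt 1 * (T.elt 1 * y) := by rw [← mul_assoc, T.mul_self, one_mul]
      rw [e]
      refine mul_mem (T.elt_mem_four 1) ?_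
      rcases hfix _ hy1 this with h | h
      · rw [h]; exact one_mem _
      · rw [h]; exact T.elt_mem_four 0
  have hk4 : Nat.card T.perm.ker ≤ 4 := (Subgroup.card_le_of_le hker).trans T.card_four.le
  have hH96 : Nat.card H = 96 := by rw [← T.card_stab 0, h32]
  have hr : Nat.card T.perm.range ≤ 6 := by
    refine (Subgroup.card_le_card_group _).trans ?_
    simp [Nat.card_eq_fintype_card, Fintype.card_perm, Nat.factorial]
  -- Kernel at most 4 and image at most 6 cannot give 96.
  have := Subgroup.card_mul_index T.perm.ker
  rw [Subgroup.index_ker, hH96] at this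
  nlinarith

end ConjTriple

namespace ConjTriple

variable {H : Type*} [Group H] (T : ConjTriple H) {P : KodairaTuple H 2}

theorem perm_three_pow_of_sign : ∀ x : Equiv.Perm (Fin 3), Equiv.Perm.sign x = 1 → x ^ 3 = 1 := by
  decide

/-- An element `t` moving a point, modulo whose four-group cosets everything commutes, yields an
action on the four points of `T.four * t`. -/
theorem false_of_commute_mod_four (hP : P.ActionRelations) (hz : P.z = T.elt 0) (t : H)
    (ht : T.perm t 0 ≠ 0)
    (h₁ : ∀ i, ⁅P.fst i, t⁆ ∈ T.four) (h₂ : ∀ i, ⁅P.snd i, t⁆ ∈ T.four)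
    (hs₁ : ∀ i, Equiv.Perm.sign (T.perm (P.fst i)) = 1)
    (hs₂ : ∀ i, Equiv.Perm.sign (T.perm (P.snd i)) = 1) : False := by
  have hM := T.four_normal
  let π := QuotientGroup.mk' T.four
  have hπ : ∀ x, π x = 1 ↔ x ∈ T.four := fun x => QuotientGroup.eq_one_iff x
  let Y : Subgroup H := (Subgroup.centralizer {π t}).comap π ⊓ (Equiv.Perm.sign.comp T.perm).ker
  have hY : ∀ g, g ∈ Y ↔ ⁅g, t⁆ ∈ T.four ∧ Equiv.Perm.sign (T.perm g) = 1 := by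
    intro g
    rw [Subgroup.mem_inf, Subgroup.mem_comap, Subgroup.mem_centralizer_singleton_iff, ← hπ,
      map_commutatorElement, commutatorElement_eq_one_iff_mul_comm, MonoidHom.mem_ker]
    rfl
  have hYf : T.four ≤ Y := by
    intro m hm
    rw [hY]
    constructor
    · rw [commutatorElement_def, mul_assoc, mul_assoc]
      exact mul_mem hm (by simpa [mul_assoc] using hM.conj_mem _ (inv_mem hm) t)
    · rcases hm with rfl | ⟨i, rfl⟩
      · simp
      · rw [T.perm_elt, map_one]
  obtain ⟨Q, hQ, rfl⟩ := hP.exists_restrict (K := Y) (fun i => (hY _).2 ⟨h₁ i, hs₁ i⟩)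
    (fun i => (hY _).2 ⟨h₂ i, hs₂ i⟩) (hYf (hz ▸ T.elt_mem_four 0))
  have hQz : (Q.z : H) = T.elt 0 := hz
  have ht1 : t * t⁻¹ ∈ T.four := by rw [mul_inv_cancel]; exact one_mem _
  -- The coset of `t` modulo the four-group: four points on which `Y` acts by conjugation. The aim
  -- is to land in the alternating group of degree four, where commutativity is transitive.
  let Ω := {y : H // y * t⁻¹ ∈ T.four}
  let _ : MulAction Y Ω :=
    { smul := fun g y => ⟨g * y * (g : H)⁻¹, by
        have h1 := ((hY g).1 g.2).1
        have : (g : H) * y * (g : H)⁻¹ * t⁻¹ = (g * (y * t⁻¹) * (g : H)⁻¹) * ⁅(g : H), t⁆ := by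
          rw [commutatorElement_def]; group
        rw [this]
        exact mul_mem (hM.conj_mem _ y.2 _) h1⟩
      one_smul := fun y => Subtype.ext (by change ((1 : Y) : H) * _ * ((1 : Y) : H)⁻¹ = _; simp)
      mul_smul := fun g k y => Subtype.ext (by
        change ((g * k : Y) : H) * _ * ((g * k : Y) : H)⁻¹ = g * (k * y * (k : H)⁻¹) * (g : H)⁻¹
        simp only [Subgroup.coe_mul]; group) }
  have hsmul : ∀ (g : Y) (y : Ω), ((g • y : Ω) : H) = g * y * (g : H)⁻¹ := fun _ _ => rfl
  have hcard : Nat.card Ω = 4 := by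
    rw [← T.card_four]
    exact Nat.card_congr ⟨fun y => ⟨y.1 * t⁻¹, y.2⟩, fun m => ⟨m.1 * t, by simp⟩,
      fun y => by simp, fun m => by simp⟩
  have hfin : Finite Ω := Nat.finite_of_card_ne_zero (by rw [hcard]; norm_num)
  let e : Ω ≃ Fin 4 := Finite.equivFinOfCardEq hcard
  let φ : Y →* Equiv.Perm (Fin 4) := e.permCongrHom.toMonoidHom.comp (MulAction.toPermHom Y Ω)
  have hφ : ∀ g i, φ g i = e (g • e.symm i) := fun g i => rfl
  have hφ1 : ∀ g i, φ g i = i ↔ Commute (g : H) (e.symm i : H) := by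
    intro g i
    rw [hφ, ← Equiv.eq_symm_apply, Subtype.ext_iff, hsmul, mul_inv_eq_iff_eq_mul]
    rfl
  -- an element acting trivially on the four-group acts on `Ω` by a translation
  have hker : ∀ g : Y, T.perm g = 1 → (∃ i, φ g i = i) → φ g = 1 := by
    rintro g hg ⟨i, hi⟩
    ext j
    congr 1
    rw [Equiv.Perm.one_apply, hφ1]
    rw [hφ1] at hi
    have hm : (e.symm j : H) * (e.symm i : H)⁻¹ ∈ T.four := by
      have := mul_mem (e.symm j).2 (inv_mem (e.symm i).2)
      simpa [mul_assoc] using this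
    have hc : Commute (g : H) ((e.symm j : H) * (e.symm i : H)⁻¹) := by
      rcases hm with h | ⟨k, h⟩
      · rw [h]; exact Commute.one_right _
      · rw [h]; refine T.perm_apply_self.1 ?_
        rw [hg]; rfl
    have := hc.mul_right hi
    rwa [inv_mul_cancel_right] at this
  -- Such a `g` centralizes the four-group and sends `m * t` to `m * ⁅g, t⁆ * t`, a translation by
  -- an element of order at most two.
  have hsq : ∀ g : Y, T.perm g = 1 → φ g ^ 2 = 1 := by
    intro g hg
    rw [← map_pow]
    refine hker _ (by rw [Subgroup.coe_pow, map_pow, hg, one_pow]) ?_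
    refine ⟨e ⟨t, ht1⟩, ?_⟩
    rw [hφ1, e.symm_apply_apply, Subgroup.coe_pow]
    obtain ⟨m, hm⟩ : ∃ m, m = ⁅(g : H), t⁆ := ⟨_, rfl⟩
    have hmm : m ∈ T.four := hm ▸ ((hY g).1 g.2).1
    have hgt : (g : H) * t = m * t * g := by rw [hm, commutatorElement_def]; group
    have hgm : Commute (g : H) m := by
      rcases hmm with h | ⟨k, h⟩
      · rw [h]; exact Commute.one_right _
      · rw [h]; refine T.perm_apply_self.1 ?_
        rw [hg]; rfl
    rw [commute_iff_eq, pow_two, mul_assoc, hgt, ← mul_assoc, ← mul_assoc, hgm.eq, mul_assoc m,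
      hgt, ← mul_assoc, ← mul_assoc, T.mul_self_of_mem_four hmm, one_mul, mul_assoc]
  have heven : ∀ g : Y, Equiv.Perm.sign (φ g) = 1 := by
    intro g
    have h3 : T.perm ((g ^ 3 : Y) : H) = 1 := by
      rw [Subgroup.coe_pow, map_pow]
      exact perm_three_pow_of_sign _ ((hY g).1 g.2).2
    refine KodairaTuple.perm_four_even _ ?_ ?_
    · have := hsq _ h3
      rw [map_pow, ← pow_mul] at this
      exact this
    · have := hker _ h3
      rwa [map_pow] at this
  have hz1 := (hQ.mapHom φ).z_eq_one_of_perm_four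
    (by rintro (i | i) <;> exact heven _) (by rintro (i | i) <;> exact heven _) (heven _)
  -- Acting trivially, `z` fixes the point `t`, that is, commutes with it; but `t` moves `z = T.elt
  -- 0` under conjugation.
  have hz2 : φ Q.z (e ⟨t, ht1⟩) = e ⟨t, ht1⟩ := by
    rw [show φ Q.z = 1 from hz1]; rfl
  rw [hφ1, e.symm_apply_apply, hQz] at hz2
  exact ht (T.perm_apply_self.2 hz2.symm)

/-- The four-group acts trivially on itself, so the strands have commuting images in `S₃`, and each
product `snd i * fst i.swap` fixes `0` because it commutes with `z`. Either all images fix `0`, or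
all fix another point, or all are even and some `snd i` acts as a 3-cycle; each case has its own
contradiction above. -/
theorem false_of_actionRelations [Finite H] (hH : Nat.card H ∣ 96) (hP : P.ActionRelations)
    (hz : P.z = T.elt 0) : False := by
  have hS := (hP.mapHom T.perm).commute_of_z_eq_one
    (by change T.perm P.z = 1; rw [hz, T.perm_elt])
  have hfs : ∀ i k, T.perm (P.fst i) * T.perm (P.snd k) = T.perm (P.snd k) * T.perm (P.fst i) := by
    rintro (i | i) (k | k)
    · exact hS (.inl i) (.inl k)
    · exact hS (.inl i) (.inr k)
    · exact hS (.inr i) (.inl k)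
    · exact hS (.inr i) (.inr k)
  have hpair : ∀ i, (T.perm (P.snd i) * T.perm (P.fst i.swap)) 0 = 0 := by
    intro i
    rw [← map_mul, T.perm_apply_self, ← hz]
    rcases i with i | i
    · exact (hP.commute_snd_mul_fst i).2
    · exact (hP.commute_snd_mul_fst i).1
  by_cases h0 : ∀ i, P.snd i ∈ T.stab 0
  · refine T.false_of_mem_stab_zero hH hP hz (fun i => ?_) h0
    have h1 := hpair i.swap
    rw [Sum.swap_swap, ← hfs] at h1
    have h2 : T.perm (P.snd i.swap) 0 = 0 := h0 _
    rw [Equiv.Perm.mul_apply, h2] at h1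
    exact h1
  push Not at h0
  obtain ⟨i, hi⟩ := h0
  rcases KodairaTuple.perm_three_trichotomy _ _ (hfs i.swap i).symm (hpair i) hi with
    ⟨hX, hX3, hY3, hXY, hU⟩ | ⟨k, hk, hU⟩
  swap
  · exact T.false_of_mem_stab_ne hH hP hz hk (fun j => hU _ (Or.inl (hfs j i)))
      (fun j => hU _ (Or.inr (hfs _ j).symm))
  have hM := T.four_normal
  let π := QuotientGroup.mk' T.four
  have hπ : ∀ x, π x = 1 ↔ x ∈ T.four := fun x => QuotientGroup.eq_one_iff x
  -- As 96 divides `64 * 3` and `64 ≡ 1` modulo 3, the 64th power removes the 2-part of an element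
  -- and preserves 3-cycles.
  have hpow : ∀ x : H, (x ^ 64) ^ 3 = 1 := by
    intro x
    obtain ⟨c, hc⟩ := (orderOf_dvd_natCard x).trans hH
    rw [← pow_mul, show 64 * 3 = orderOf x * (c * 2) by rw [← mul_assoc, ← hc]; norm_num,
      pow_mul, pow_orderOf_eq_one, one_pow]
  have h64 : ∀ X : Equiv.Perm (Fin 3), X ^ 3 = 1 → X ^ 64 = X := by
    intro X hX
    rw [show 64 = 3 * 21 + 1 by norm_num, pow_succ, pow_mul, hX, one_pow, one_mul]
  have hM1 := (hP.mapHom π).commute_of_z_eq_one (by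
    change π P.z = 1; rw [hπ, hz]; exact T.elt_mem_four 0)
  have hMfs : ∀ i k, Commute (π (P.fst i)) (π (P.snd k)) := by
    rintro (i | i) (k | k)
    · exact hM1 (.inl i) (.inl k)
    · exact hM1 (.inl i) (.inr k)
    · exact hM1 (.inr i) (.inl k)
    · exact hM1 (.inr i) (.inr k)
  set t := P.snd i ^ 64 with ht
  set u := P.fst i.swap ^ 64 with hu
  -- The product is killed by 3, since the factors commute modulo the four-group, and by 32, since
  -- `t * u` lies in the kernel of `T.perm`. So `t` and `u⁻¹` agree there, and both strands commute
  -- with `t` modulo the four-group.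
  have htu : π t * π u = 1 := by
    have h3 : (π t * π u) ^ 3 = 1 := by
      have hc : Commute (π t) (π u) := by
        rw [ht, hu, map_pow, map_pow]
        exact ((hMfs _ _).symm.pow_pow _ _)
      rw [hc.mul_pow, ← map_pow, ← map_pow, hpow, hpow, map_one, one_mul]
    have hk : t * u ∈ T.perm.ker := by
      rw [MonoidHom.mem_ker, map_mul, map_pow, map_pow, h64 _ hX3, h64 _ hY3, hXY]
    have h32 : (t * u) ^ 32 = 1 := by
      have : orderOf (t * u) ∣ 32 :=
        (Subgroup.orderOf_dvd_natCard _ hk).trans (T.card_ker_dvd hH)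
      exact orderOf_dvd_iff_pow_eq_one.1 this
    have h32' : (π t * π u) ^ 32 = 1 := by rw [← map_mul, ← map_pow, h32, map_one]
    have : (π t * π u) ^ 33 = 1 := by
      rw [show 33 = 3 * 11 by norm_num, pow_mul, h3, one_pow]
    rwa [pow_succ, h32', one_mul] at this
  refine T.false_of_commute_mod_four hP hz t ?_ (fun j => ?_) (fun j => ?_)
    (fun j => hU _ (Or.inl (hfs j i))) (fun j => hU _ (Or.inr (hfs _ j).symm))
  · rw [ht, map_pow, h64 _ hX3]
    exact hi
  · rw [← hπ, map_commutatorElement, commutatorElement_eq_one_iff_commute, ht, map_pow]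
    exact (hMfs j i).pow_right _
  · rw [← hπ, map_commutatorElement, commutatorElement_eq_one_iff_commute,
      eq_inv_of_mul_eq_one_left htu, hu, map_pow]
    exact ((hMfs _ j).symm.pow_right _).inv_right

end ConjTriple

/-! ### Centrality of `z` when it lies in every non-trivial normal subgroup. -/

section

variable {H : Type*} [Group H]

theorem sylow_two_index_dvd [Finite H] (hH : Nat.card H ∣ 96) (S : Sylow 2 H) :
    (S : Subgroup H).index ∣ 3 := by
  have h1 : (S : Subgroup H).index ∣ 32 * 3 := (Subgroup.index_dvd_card _).trans hH
  have h2 : Nat.Coprime (S : Subgroup H).index 32 := by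
    have := (Nat.Prime.coprime_iff_not_dvd Nat.prime_two).2 S.not_dvd_index
    exact (this.symm.pow_right 5)
  exact h2.dvd_of_dvd_mul_left h1

/-- A non-trivial normal subgroup contained in a Sylow subgroup `S` contains an element of order
`p` centralized by `S`. -/
theorem exists_orderOf_eq_mem_centralizer [Finite H] {p : ℕ} [Fact p.Prime] (S : Sylow p H) {Q : Subgroup H}
    (hQ : Q.Normal) (hQS : Q ≤ S) (hne : Q ≠ ⊥) :
    ∃ x ∈ Q, orderOf x = p ∧ ∀ g ∈ S, Commute g x := by
  have hQp : IsPGroup p Q := S.isPGroup'.to_le hQS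
  let _ : MulAction S Q := MulAction.compHom Q
    ((MulAut.conjNormal (H := Q)).comp (S : Subgroup H).subtype)
  have hsmul : ∀ (s : S) (x : Q), ((s • x : Q) : H) = s * x * (s : H)⁻¹ := fun s x =>
    MulAut.conjNormal_apply _ _
  have hfix : ∀ x : Q, x ∈ MulAction.fixedPoints S Q ↔ ∀ g ∈ S, Commute g (x : H) := by
    intro x
    constructor
    · intro h g hg
      have := congrArg Subtype.val (h ⟨g, hg⟩)
      rw [hsmul, mul_inv_eq_iff_eq_mul] at this
      exact this
    · intro h s
      ext
      rw [hsmul, mul_inv_eq_iff_eq_mul]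
      exact h s s.2
  have hdvd : p ∣ Nat.card Q :=
    hQp.card_eq_or_dvd.resolve_left fun h => hne (Subgroup.card_eq_one.1 h)
  obtain ⟨b, hb, hb1⟩ := S.isPGroup'.exists_fixed_point_of_prime_dvd_card_of_fixed_point Q hdvd
    (a := 1) ((hfix 1).2 fun g _ => by simp)
  rw [hfix] at hb
  set C : Subgroup H := Q ⊓ Subgroup.centralizer (S : Set H) with hC
  have hbC : (b : H) ∈ C := ⟨b.2, Subgroup.mem_centralizer_iff.2 fun g hg => hb g hg⟩
  have hCp : IsPGroup p C := hQp.to_le inf_le_left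
  have hCdvd : p ∣ Nat.card C := hCp.card_eq_or_dvd.resolve_left fun h => by
    rw [Subgroup.card_eq_one] at h
    rw [h, Subgroup.mem_bot] at hbC
    exact hb1 (Subtype.ext hbC.symm)
  obtain ⟨x, hx⟩ := exists_prime_orderOf_dvd_card' p hCdvd
  refine ⟨x, x.2.1, by rw [Subgroup.orderOf_coe, hx], fun g hg => ?_⟩
  exact Subgroup.mem_centralizer_iff.1 x.2.2 g hg

theorem fin_three_mul_perm {M : Type*} [Monoid M] (f : Fin 3 → M) (hc : ∀ i j, Commute (f i) (f j))
    (s : Equiv.Perm (Fin 3)) : f (s 0) * f (s 1) * f (s 2) = f 0 * f 1 * f 2 := by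
  have h01 := (hc 0 1).eq
  have h02 := (hc 0 2).eq
  have h12 := (hc 1 2).eq
  have key : ∀ a b c : Fin 3, a ≠ b → a ≠ c → b ≠ c → f a * f b * f c = f 0 * f 1 * f 2 := by
    intro a b c
    fin_cases a <;> fin_cases b <;> fin_cases c <;> simp
    · rw [mul_assoc, ← h12, mul_assoc]
    · rw [← h01]
    · rw [mul_assoc, ← h02, ← mul_assoc, ← h01]
    · rw [← h02, mul_assoc, ← h12, mul_assoc]
    · rw [← h12, mul_assoc, ← h02, ← mul_assoc, ← h01]
  exact key _ _ _ (s.injective.ne (by decide)) (s.injective.ne (by decide))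
    (s.injective.ne (by decide))

theorem zpowers_normal_of_mem_center {x : H} (hx : x ∈ Subgroup.center H) :
    (Subgroup.zpowers x).Normal := normal_of_le_center (zpowers_le_center hx)

/-- A non-trivial centre would contain `z`, so failure means trivial centre. Then `H` is not a
2-group, and it acts on the three cosets of a Sylow 2-subgroup; a faithful action is impossible
inside `S₃`, and otherwise the core yields a `ConjTriple` whose four-group contains `z`. -/
theorem KodairaTuple.ActionRelations.mem_center [Finite H] (hH : Nat.card H ∣ 96) {P : KodairaTuple H 2}
    (hP : P.ActionRelations) (hz1 : P.z ≠ 1)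
    (hmin : ∀ N : Subgroup H, N.Normal → N ≠ ⊥ → P.z ∈ N) : P.z ∈ Subgroup.center H := by
  by_contra hzc
  have hncenter : ∀ x : H, x ∈ Subgroup.center H → x = 1 := by
    intro x hx
    by_contra hx1
    exact hzc (zpowers_le_center hx (hmin _ (zpowers_normal_of_mem_center hx)
      (by rwa [Ne, Subgroup.zpowers_eq_bot])))
  obtain ⟨S⟩ : Nonempty (Sylow 2 H) := inferInstance
  rcases (Nat.dvd_prime Nat.prime_three).1 (sylow_two_index_dvd hH S) with h1 | h3
  · rw [Subgroup.index_eq_one] at h1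
    have hp : IsPGroup 2 H := by
      have := S.isPGroup'
      rw [h1] at this
      exact this.of_equiv Subgroup.topEquiv
    have : Nontrivial H := ⟨⟨_, _, hz1⟩⟩
    have hnt := (Subgroup.nontrivial_iff_ne_bot _).2 hp.bot_lt_center.ne'
    obtain ⟨⟨x, hx⟩, hx1⟩ := exists_ne (1 : Subgroup.center H)
    exact hx1 (Subtype.ext (hncenter x hx))
  have e : H ⧸ (S : Subgroup H) ≃ Fin 3 := Finite.equivFinOfCardEq h3
  let ρ : H →* Equiv.Perm (Fin 3) :=
    e.permCongrHom.toMonoidHom.comp (MulAction.toPermHom H (H ⧸ (S : Subgroup H)))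
  have hρ : ∀ g i, ρ g i = e (g • e.symm i) := fun _ _ => rfl
  by_cases hQ : (S : Subgroup H).normalCore = ⊥
  · have hinj : Function.Injective ρ := by
      have hi : Function.Injective (MulAction.toPermHom H (H ⧸ (S : Subgroup H))) := by
        rw [← MonoidHom.ker_eq_bot_iff, ← Subgroup.normalCore_eq_ker, hQ]
      exact fun a b hab => hi (e.permCongrHom.injective hab)
    exact hz1 (hinj ((hP.mapHom ρ).z_eq_one_of_perm_three.trans (map_one ρ).symm))
  obtain ⟨x, hxQ, hxo, hxS⟩ := exists_orderOf_eq_mem_centralizer S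
    (Subgroup.normalCore_normal _) (Subgroup.normalCore_le _) hQ
  have hx1 : x ≠ 1 := by
    rintro rfl
    simp at hxo
  -- The conjugates of `x` depend only on the coset, because `S` centralizes `x`.
  let c : H ⧸ (S : Subgroup H) → H := fun q => Quotient.liftOn' q (fun g => g * x * g⁻¹) (by
    intro a b hab
    rw [QuotientGroup.leftRel_apply] at hab
    have := (hxS _ hab).eq
    calc a * x * a⁻¹ = a * (x * (a⁻¹ * b)) * b⁻¹ := by group
      _ = b * x * b⁻¹ := by rw [← this]; group)
  have hc : ∀ g q, g * c q * g⁻¹ = c (g • q) := by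
    intro g q
    induction q using QuotientGroup.induction_on with
    | H a =>
      change g * (a * x * a⁻¹) * g⁻¹ = (g * a) * x * (g * a)⁻¹
      group
  have hcex : ∀ q, ∃ g, c q = g * x * g⁻¹ := by
    intro q
    induction q using QuotientGroup.induction_on with
    | H a => exact ⟨a, rfl⟩
  have hQn := Subgroup.normalCore_normal (S : Subgroup H)
  have hcQ : ∀ q, c q ∈ (S : Subgroup H).normalCore := by
    intro q
    obtain ⟨g, hg⟩ := hcex q
    rw [hg]
    exact hQn.conj_mem _ hxQ g
  have hcomm : ∀ q, ∀ y ∈ (S : Subgroup H).normalCore, Commute (c q) y := by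
    intro q y hy
    obtain ⟨g, hg⟩ := hcex q
    have := hxS (g⁻¹ * y * g) (Subgroup.normalCore_le _ (by simpa using hQn.conj_mem _ hy g⁻¹))
    rw [hg, commute_iff_eq]
    calc g * x * g⁻¹ * y = g * (x * (g⁻¹ * y * g)) * g⁻¹ := by group
      _ = y * (g * x * g⁻¹) := by rw [← this.eq]; group
  have hcρ : ∀ g i, g * c (e.symm i) * g⁻¹ = c (e.symm (ρ g i)) := by
    intro g i
    rw [hc, hρ, e.symm_apply_apply]
  -- Conjugation permutes three commuting factors, so their product is central, hence trivial.
  have hw : c (e.symm 0) * c (e.symm 1) * c (e.symm 2) = 1 := by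
    apply hncenter
    rw [Subgroup.mem_center_iff]
    intro g
    rw [← mul_inv_eq_iff_eq_mul]
    have := fin_three_mul_perm (fun i => c (e.symm i)) (fun i j => hcomm _ _ (hcQ _)) (ρ g)
    simp only [← hcρ] at this
    refine Eq.trans ?_ this
    group
  let T : ConjTriple H :=
    { perm := ρ
      elt := fun i => c (e.symm i)
      conj := hcρ
      ne_one := fun i h => by
        obtain ⟨g, hg⟩ := hcex (e.symm i)
        rw [hg, conj_eq_one_iff] at h
        exact hx1 h
      mul_self := fun i => by
        obtain ⟨g, hg⟩ := hcex (e.symm i)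
        have : x * x = 1 := by rw [← pow_two, ← hxo, pow_orderOf_eq_one]
        rw [hg, conj_mul, this]
        simp
      commute := fun i j => hcomm _ _ (hcQ _)
      prod := hw
      transitive := fun i j => by
        obtain ⟨g, hg⟩ := MulAction.exists_smul_eq H (e.symm i) (e.symm j)
        exact ⟨g, by rw [hρ, hg, e.apply_symm_apply]⟩ }
  have hzT : P.z ∈ T.four := hmin _ T.four_normal fun h => by
    have := T.elt_mem_four 0
    rw [h, Subgroup.mem_bot] at this
    exact T.ne_one 0 this
  rcases hzT with h | ⟨i, hi⟩
  · exact hz1 h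
  · obtain ⟨g, hg⟩ := T.transitive i 0
    refine T.false_of_actionRelations hH (hP.mapHom (MulAut.conj g).toMonoidHom) ?_
    change g * P.z * g⁻¹ = T.elt 0
    rw [hi, T.conj, hg]

/-- Now `o(z) ^ 5` divides 96, while `3 ^ 5 > 96`. -/
theorem KodairaTuple.ActionRelations.orderOf_z [Finite H] (hH : Nat.card H ∣ 96) {P : KodairaTuple H 2}
    (hP : P.ActionRelations) (hz1 : P.z ≠ 1)
    (hmin : ∀ N : Subgroup H, N.Normal → N ≠ ⊥ → P.z ∈ N) :
    orderOf P.z = 2 ∧ 32 ∣ Nat.card H := by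
  have hzc := hP.mem_center hH hz1 hmin
  have hd := (hP.isDualPair_of_mem_center hzc).card_dvd hzc (A := ⊤) (fun _ => trivial) trivial
  rw [Subgroup.card_top, Fintype.card_sum, Fintype.card_fin] at hd
  have hpos : 1 < orderOf P.z := by
    have h0 := orderOf_pos P.z
    have h1 : orderOf P.z ≠ 1 := by rwa [Ne, orderOf_eq_one_iff]
    omega
  have h96 : orderOf P.z ^ 5 ≤ 96 := Nat.le_of_dvd (by norm_num) (hd.trans hH)
  have h2 : orderOf P.z = 2 := by
    by_contra hne
    have : 3 ^ 5 ≤ orderOf P.z ^ 5 := Nat.pow_le_pow_left (by omega) 5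
    omega
  rw [h2] at hd
  exact ⟨h2, by simpa using hd⟩

end

/-! ### The element `z` and the Sylow 2-subgroup of a monolithic group of order 96. -/

section

variable {G : Type*} [Group G]

theorem perm_three_conj_cycle : ∀ X g : Equiv.Perm (Fin 3), X ≠ 1 → X ^ 3 = 1 →
    g * X * g⁻¹ = X ∨ g * X * g⁻¹ = X⁻¹ := by decide +kernel

theorem perm_three_commuting_swaps : ∀ X Y : Equiv.Perm (Fin 3), X ^ 3 ≠ 1 → Y ^ 3 ≠ 1 →
    X * Y = Y * X → ∃ k : Fin 3, ∀ U : Equiv.Perm (Fin 3), (U * X = X * U ∨ U * Y = Y * U) →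
      U k = k := by decide +kernel

theorem perm_three_mul_swap : ∀ X : Equiv.Perm (Fin 3), X ^ 3 ≠ 1 → ∀ W : Equiv.Perm (Fin 3),
    (∃ k : Fin 3, W k = k) ∨ ∃ k : Fin 3, (W * X) k = k := by decide +kernel

theorem mem_monolith_of_forall {z : G} : z ∈ monolith G ↔
    ∀ N : Subgroup G, N.Normal → N ≠ ⊥ → z ∈ N := by
  simp [monolith, Subgroup.mem_sInf]

/-- A homomorphism to `S₃` whose kernel is a `2`-group: if an element of order `3` centralizes the
kernel, then it spans a normal subgroup. -/
theorem zpowers_normal_of_commute_ker {ρ : G →* Equiv.Perm (Fin 3)}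
    (hker : Nat.card ρ.ker ∣ 32) {s : G} (hs : orderOf s = 3) (hc : ∀ q ∈ ρ.ker, Commute s q) :
    (Subgroup.zpowers s).Normal := by
  have hs3 : s ^ 3 = 1 := by rw [← hs, pow_orderOf_eq_one]
  have hq1 : ∀ q ∈ ρ.ker, q ^ 3 = 1 → q = 1 := by
    intro q hq h3
    have h32 : q ^ 32 = 1 :=
      orderOf_dvd_iff_pow_eq_one.1 ((Subgroup.orderOf_dvd_natCard _ hq).trans hker)
    have : q ^ 33 = 1 := by rw [show 33 = 3 * 11 by norm_num, pow_mul, h3, one_pow]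
    rwa [pow_succ, h32, one_mul] at this
  have hρs : ρ s ≠ 1 := by
    intro h
    have := hq1 s h hs3
    rw [this, orderOf_one] at hs
    omega
  have key : ∀ g, g * s * g⁻¹ ∈ Subgroup.zpowers s := by
    intro g
    have hcube : (g * s * g⁻¹) ^ 3 = 1 := by rw [conj_pow, hs3, mul_one, mul_inv_cancel]
    -- A conjugate of `s` is `s` or `s⁻¹` times an element of the kernel. That factor commutes with
    -- `s`, so its cube is trivial, and in a 2-group it is trivial itself.
    rcases perm_three_conj_cycle (ρ s) (ρ g) hρs (by rw [← map_pow, hs3, map_one]) with h | h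
    · have hq : g * s * g⁻¹ * s⁻¹ ∈ ρ.ker := by
        rw [MonoidHom.mem_ker, map_mul, map_mul, map_mul, map_inv, h, map_inv, mul_inv_cancel]
      have e : g * s * g⁻¹ = (g * s * g⁻¹ * s⁻¹) * s := by group
      have h1 : (g * s * g⁻¹ * s⁻¹) ^ 3 = 1 := by
        rw [e, ((hc _ hq).symm).mul_pow, hs3, mul_one] at hcube
        exact hcube
      rw [e, hq1 _ hq h1, one_mul]
      exact Subgroup.mem_zpowers s
    · have hq : g * s * g⁻¹ * s ∈ ρ.ker := by
        rw [MonoidHom.mem_ker, map_mul, map_mul, map_mul, map_inv, h, inv_mul_cancel]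
      have e : g * s * g⁻¹ = (g * s * g⁻¹ * s) * s⁻¹ := by group
      have h1 : (g * s * g⁻¹ * s) ^ 3 = 1 := by
        rw [e, ((hc _ hq).inv_left.symm).mul_pow, inv_pow, hs3, inv_one, mul_one] at hcube
        exact hcube
      rw [e, hq1 _ hq h1, one_mul]
      exact inv_mem (Subgroup.mem_zpowers s)
  refine ⟨?_⟩
  rintro _ ⟨k, rfl⟩ g
  change g * s ^ k * g⁻¹ ∈ _
  rw [← conj_zpow]
  exact zpow_mem (key g) k

/-- `⁅s, q⁆ ^ 3 = ⁅s ^ 3, q⁆ = 1` inside a group of order two. -/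
theorem commute_of_commutator_mem {z s q : G} (hz : z ∈ Subgroup.center G) (hz2 : orderOf z = 2)
    (hs : s ^ 3 = 1) (h : ⁅s, q⁆ ∈ Subgroup.zpowers z) : Commute s q := by
  have h3 : ⁅s, q⁆ ^ 3 = 1 := by
    rw [← commutator_pow_left (zpowers_le_center hz h), hs, commutatorElement_one_left]
  rw [mem_zpowers_of_orderOf_two hz2] at h
  rcases h with h | h
  · exact commutatorElement_eq_one_iff_commute.1 h
  · rw [h] at h3
    have := orderOf_dvd_of_pow_eq_one h3
    rw [hz2] at this
    omega

theorem exists_perm_of_card [Finite G] (hG : Nat.card G = 96) :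
    ∃ ρ : G →* Equiv.Perm (Fin 3), (∀ i j, ∃ g, ρ g i = j) ∧
      (∀ k : Fin 3, Nat.card ((MulAction.stabilizer (Equiv.Perm (Fin 3)) k).comap ρ) = 32) ∧
      Nat.card ρ.ker ∣ 32 ∧ 16 ≤ Nat.card ρ.ker := by
  obtain ⟨S⟩ : Nonempty (Sylow 2 G) := inferInstance
  have hS3 : (S : Subgroup G).index = 3 := by
    rcases (Nat.dvd_prime Nat.prime_three).1 (sylow_two_index_dvd hG.dvd S) with h1 | h3
    · exfalso
      rw [Subgroup.index_eq_one] at h1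
      have hp : IsPGroup 2 G := by
        have := S.isPGroup'
        rw [h1] at this
        exact this.of_equiv Subgroup.topEquiv
      obtain ⟨n, hn⟩ := IsPGroup.iff_card.1 hp
      have : 3 ∣ 2 ^ n := by rw [← hn, hG]; norm_num
      exact absurd (Nat.prime_three.dvd_of_dvd_pow this) (by norm_num)
    · exact h3
  let e : G ⧸ (S : Subgroup G) ≃ Fin 3 := Finite.equivFinOfCardEq hS3
  let ρ : G →* Equiv.Perm (Fin 3) :=
    e.permCongrHom.toMonoidHom.comp (MulAction.toPermHom G (G ⧸ (S : Subgroup G)))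
  have hρ : ∀ g i, ρ g i = e (g • e.symm i) := fun _ _ => rfl
  have htrans : ∀ i j, ∃ g, ρ g i = j := fun i j => by
    obtain ⟨g, hg⟩ := MulAction.exists_smul_eq G (e.symm i) (e.symm j)
    exact ⟨g, by rw [hρ, hg, e.apply_symm_apply]⟩
  have hstab : ∀ k : Fin 3, Nat.card ((MulAction.stabilizer (Equiv.Perm (Fin 3)) k).comap ρ) = 32 := by
    intro k
    let _ : MulAction G (Fin 3) := MulAction.compHom _ ρ
    have : MulAction.IsPretransitive G (Fin 3) := ⟨fun i j => htrans i j⟩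
    have h := MulAction.index_stabilizer_of_transitive G k
    have h2 := Subgroup.card_mul_index (MulAction.stabilizer G k)
    rw [h, hG] at h2
    have e : (MulAction.stabilizer (Equiv.Perm (Fin 3)) k).comap ρ =
      MulAction.stabilizer G k := rfl
    rw [e]
    rw [Nat.card_eq_fintype_card (α := Fin 3), Fintype.card_fin] at h2
    omega
  refine ⟨ρ, htrans, hstab, ?_, ?_⟩
  · rw [← hstab 0]
    refine Subgroup.card_dvd_of_le fun g hg => ?_
    rw [Subgroup.mem_comap, MonoidHom.mem_ker.1 hg]
    exact one_mem _
  · have hr : Nat.card ρ.range ≤ 6 := by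
      refine (Subgroup.card_le_card_group _).trans ?_
      simp [Nat.card_eq_fintype_card, Fintype.card_perm, Nat.factorial]
    have := Subgroup.card_mul_index ρ.ker
    rw [Subgroup.index_ker, hG] at this
    nlinarith

namespace KodairaTuple.ActionRelations

variable [Finite G] {P : KodairaTuple G 2}

/-- Divide by a normal subgroup `N` maximal among those missing `z`. In the quotient `z` lies in
every non-trivial normal subgroup, so 32 divides its order and `|N|` is 1 or 3. Order 3 would give
two normal subgroups of coprime order, contradicting monolithicity. -/
theorem z_mem_monolith (hG : Nat.card G = 96) (hm : IsMonolithic G)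
    (hP : P.ActionRelations) (hz1 : P.z ≠ 1) : P.z ∈ monolith G := by
  rw [mem_monolith_of_forall]
  obtain ⟨N, ⟨hN, hzN⟩, hmax⟩ := (Set.toFinite {N : Subgroup G | N.Normal ∧ P.z ∉ N}).exists_maximal
    ⟨⊥, inferInstance, hz1⟩
  let π := QuotientGroup.mk' N
  have hcardN := Subgroup.card_eq_card_quotient_mul_card_subgroup N
  have h32 := ((hP.mapHom π).orderOf_z (by rw [← hG, hcardN]; exact dvd_mul_right _ _)
    (fun h => hzN ((QuotientGroup.eq_one_iff _).1 h)) (by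
      intro K hK hK1
      by_contra hzK
      have hle : N ≤ K.comap π := fun n hn => by
        rw [Subgroup.mem_comap, show π n = 1 from (QuotientGroup.eq_one_iff _).2 hn]
        exact one_mem _
      have := hmax (show K.comap π ∈ {N : Subgroup G | N.Normal ∧ P.z ∉ N} from
        ⟨hK.comap π, hzK⟩) hle
      apply hK1
      rw [eq_bot_iff]
      intro k hk
      obtain ⟨g, rfl⟩ := QuotientGroup.mk'_surjective N k
      exact (QuotientGroup.eq_one_iff _).2 (this hk))).2
  obtain ⟨m, hm32⟩ := h32
  have hN3 : Nat.card N ∣ 3 := by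
    rw [hG, hm32, show 96 = 32 * 3 by norm_num, mul_assoc] at hcardN
    exact ⟨m, by linarith [Nat.eq_of_mul_eq_mul_left (by norm_num) hcardN, mul_comm m (Nat.card N)]⟩
  rcases (Nat.dvd_prime Nat.prime_three).1 hN3 with h1 | h3
  · intro K hK hK1
    by_contra hzK
    have hbot := Subgroup.card_eq_one.1 h1
    have := hmax (show K ∈ {N : Subgroup G | N.Normal ∧ P.z ∉ N} from ⟨hK, hzK⟩)
      (by rw [hbot]; exact bot_le)
    rw [hbot] at this
    exact hK1 (eq_bot_iff.2 this)
  · exfalso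
    obtain ⟨ρ, -, -, hk, hk16⟩ := exists_perm_of_card hG
    apply hm
    have h1 : monolith G ≤ N := sInf_le ⟨hN, by
      rintro rfl
      simp at h3⟩
    have h2 : monolith G ≤ ρ.ker := sInf_le ⟨inferInstance, by
      intro h
      rw [h] at hk16
      simp at hk16⟩
    have d1 := Subgroup.card_dvd_of_le h1
    have d2 := (Subgroup.card_dvd_of_le h2).trans hk
    rw [h3] at d1
    have := Nat.dvd_gcd d1 d2
    exact Subgroup.card_eq_one.1 (Nat.dvd_one.1 (by simpa using this))

end KodairaTuple.ActionRelations

/-- An extraspecial group `Q` of order `32` with centre `⟨z⟩`, together with a dual pair, inside a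
group of order `96` whose non-trivial normal subgroups contain `z`. -/
structure ExtraspecialData (G : Type*) [Group G] where
  card : Nat.card G = 96
  z : G
  hom : G →* Equiv.Perm (Fin 3)
  card_ker : Nat.card hom.ker = 32
  z_mem_center : z ∈ Subgroup.center G
  orderOf_z : orderOf z = 2
  z_mem : ∀ N : Subgroup G, N.Normal → N ≠ ⊥ → z ∈ N
  u : Fin 2 ⊕ Fin 2 → G
  w : Fin 2 ⊕ Fin 2 → G
  u_mem : ∀ i, u i ∈ hom.ker
  w_mem : ∀ i, w i ∈ hom.ker
  dual : IsDualPair z u w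

theorem mul_self_eq_one_of_orderOf_two {z : G} (h : orderOf z = 2) : z * z = 1 := by
  rw [← pow_two, ← h, pow_orderOf_eq_one]

theorem inv_eq_self_of_orderOf_two {z : G} (h : orderOf z = 2) : z⁻¹ = z :=
  inv_eq_of_mul_eq_one_left (mul_self_eq_one_of_orderOf_two h)

theorem pow_three_mem_ker [Finite G] (hG : Nat.card G = 96) {ρ : G →* Equiv.Perm (Fin 3)}
    (h : Nat.card ρ.ker = 32) (g : G) : g ^ 3 ∈ ρ.ker := by
  have := Subgroup.card_mul_index ρ.ker
  rw [h, hG] at this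
  have h3 : ρ.ker.index = 3 := by omega
  have := Subgroup.pow_index_mem ρ.ker g
  rwa [h3] at this

theorem IsDualPair.cube_left {ι : Type*} [DecidableEq ι] {z : G} {u w : ι → G}
    (hz : z ∈ Subgroup.center G) (hz2 : orderOf z = 2) (h : IsDualPair z u w) :
    IsDualPair z (fun i => u i ^ 3) w := by
  intro i j
  have hij := h i j
  rw [commutator_pow_left (by rw [hij]; split_ifs; exacts [hz, one_mem _]), hij]
  split_ifs
  · rw [pow_succ, pow_two, mul_self_eq_one_of_orderOf_two hz2, one_mul]
  · simp

theorem IsDualPair.cube_right {ι : Type*} [DecidableEq ι] {z : G} {u w : ι → G}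
    (hz : z ∈ Subgroup.center G) (hz2 : orderOf z = 2) (h : IsDualPair z u w) :
    IsDualPair z u (fun i => w i ^ 3) :=
  (((h.symm (inv_eq_self_of_orderOf_two hz2)).cube_left hz hz2).symm
    (inv_eq_self_of_orderOf_two hz2))

/-- The point is that the Sylow 2-subgroup is normal. If one strand has only even images in `S₃`,
its cubes lie in the kernel and force order 32 there. Otherwise both strands contain an element
acting as the same transposition, the whole tuple fixes its third point `k`, and the stabilizer of
`k` is extraspecial; this leads to an element of order three centralizing the kernel. -/
theorem KodairaTuple.ActionRelations.exists_extraspecialData [Finite G] {P : KodairaTuple G 2}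
    (hG : Nat.card G = 96) (hm : IsMonolithic G)
    (hP : P.ActionRelations) (hz1 : P.z ≠ 1) : ∃ E : ExtraspecialData G, E.z = P.z := by
  have hmin := mem_monolith_of_forall.1 (hP.z_mem_monolith hG hm hz1)
  have hzc := hP.mem_center hG.dvd hz1 hmin
  have hz2 := (hP.orderOf_z hG.dvd hz1 hmin).1
  have hinv := inv_eq_self_of_orderOf_two hz2
  have hd := hP.isDualPair hzc (by rw [pow_two, mul_self_eq_one_of_orderOf_two hz2])
  obtain ⟨ρ, htrans, hstab, hk32, hk16⟩ := exists_perm_of_card hG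
  have hzk : P.z ∈ ρ.ker := hmin _ inferInstance fun h => by
    rw [h] at hk16
    simp at hk16
  -- Cubing moves the pair into a kernel of index three and keeps it dual, since `z ^ 3 = z`.
  suffices hk : Nat.card ρ.ker = 32 from
    ⟨{ card := hG, z := P.z, hom := ρ, card_ker := hk, z_mem_center := hzc, orderOf_z := hz2
       z_mem := hmin, u := fun i => P.fst i ^ 3, w := fun i => P.snd i ^ 3
       u_mem := fun i => pow_three_mem_ker hG hk _
       w_mem := fun i => pow_three_mem_ker hG hk _
       dual := (hd.cube_left hzc hz2).cube_right hzc hz2 }, rfl⟩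
  by_cases h1 : ∀ i, ρ (P.fst i) ^ 3 = 1
  · refine Nat.dvd_antisymm hk32 ?_
    have := (hd.cube_left hzc hz2).card_dvd hzc (A := ρ.ker)
      (fun i => by rw [MonoidHom.mem_ker, map_pow, h1]) hzk
    rw [hz2] at this
    simpa using this
  by_cases h2 : ∀ i, ρ (P.snd i) ^ 3 = 1
  · refine Nat.dvd_antisymm hk32 ?_
    have := ((hd.symm hinv).cube_left hzc hz2).card_dvd hzc (A := ρ.ker)
      (fun i => by rw [MonoidHom.mem_ker, map_pow, h2]) hzk
    rw [hz2] at this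
    simpa using this
  exfalso
  push Not at h1 h2
  obtain ⟨i, hi⟩ := h1
  obtain ⟨j, hj⟩ := h2
  have hS := (hP.mapHom ρ).commute_of_z_eq_one hzk
  have hfs : ∀ i k, ρ (P.fst i) * ρ (P.snd k) = ρ (P.snd k) * ρ (P.fst i) := by
    rintro (i | i) (k | k)
    · exact hS (.inl i) (.inl k)
    · exact hS (.inl i) (.inr k)
    · exact hS (.inr i) (.inl k)
    · exact hS (.inr i) (.inr k)
  obtain ⟨k, hU⟩ := perm_three_commuting_swaps _ _ hi hj (hfs i j)
  have hW := perm_three_mul_swap _ hi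
  set A := (MulAction.stabilizer (Equiv.Perm (Fin 3)) k).comap ρ with hA
  have hmemA : ∀ g, g ∈ A ↔ ρ g k = k := fun g => Iff.rfl
  have hkle : ∀ q ∈ ρ.ker, q ∈ A := fun q hq => by
    rw [hmemA, MonoidHom.mem_ker.1 hq]; rfl
  have hcA : ∀ x ∈ A, ∀ y ∈ A, ⁅x, y⁆ ∈ Subgroup.zpowers P.z := fun x hx y hy =>
    hd.commutator_mem_zpowers hzc (A := A) (fun i => hU _ (Or.inr (hfs i j)))
      (hkle _ hzk) (by rw [hstab, hz2]; rfl) hx hy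
  have hn := ρ.normal_ker
  have hzn := zpowers_normal_of_mem_center hzc
  have hcA' : ∀ g : G, (∃ k', ρ g k' = k') → ∀ q ∈ ρ.ker, ⁅g, q⁆ ∈ Subgroup.zpowers P.z := by
    rintro g ⟨k', hk'⟩ q hq
    obtain ⟨x, hx⟩ := htrans k' k
    have h1 : x * g * x⁻¹ ∈ A := by
      have hx' : (ρ x)⁻¹ k = k' := Equiv.Perm.inv_eq_iff_eq.2 hx.symm
      rw [hmemA, map_mul, map_mul, map_inv, Equiv.Perm.mul_apply, Equiv.Perm.mul_apply, hx', hk',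
        hx]
    have := hzn.conj_mem _ (hcA _ h1 _ (hkle _ (hn.conj_mem _ hq x))) x⁻¹
    convert this using 1
    simp only [commutatorElement_def]
    group
  -- Either `g` has a fixed point, or its product with an element acting as a transposition has one;
  -- so every `g` is a product of elements already treated.
  have hall : ∀ g : G, ∀ q ∈ ρ.ker, ⁅g, q⁆ ∈ Subgroup.zpowers P.z := by
    intro g q hq
    rcases hW (ρ g) with h | h
    · exact hcA' g h q hq
    · have h1 := hcA' (g * P.fst i) (by simpa using h) q hq
      have h2 := hcA (P.fst i) (hU _ (Or.inr (hfs i j))) q (hkle q hq)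
      rw [← mul_inv_cancel_right g (P.fst i), commutator_mul_left]
      · rw [commutator_inv_left (zpowers_le_center hzc h2)]
        exact mul_mem h1 (inv_mem h2)
      · rw [commutator_inv_left (zpowers_le_center hzc h2)]
        exact inv_mem (zpowers_le_center hzc h2)
  obtain ⟨s, hs⟩ := exists_prime_orderOf_dvd_card' (G := G) 3 (by rw [hG]; norm_num)
  have hsn := zpowers_normal_of_commute_ker hk32 hs fun q hq =>
    commute_of_commutator_mem hzc hz2 (by rw [← hs, pow_orderOf_eq_one]) (hall s q hq)
  have := Subgroup.orderOf_dvd_natCard _ (hmin _ hsn (by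
    rw [Ne, Subgroup.zpowers_eq_bot]
    rintro rfl
    simp at hs))
  rw [hz2, Nat.card_zpowers, hs] at this
  omega

end

/-! ### The extraspecial kernel: it contains all prestructures and detects automorphisms. -/

namespace ExtraspecialData

variable {G : Type*} [Group G] (E : ExtraspecialData G)

include E

theorem finite : Finite G := Nat.finite_of_card_ne_zero (by rw [E.card]; norm_num)

theorem z_ne_one : E.z ≠ 1 := fun h => by simpa [h] using E.orderOf_z

theorem z_mul_z : E.z * E.z = 1 := mul_self_eq_one_of_orderOf_two E.orderOf_z

theorem z_inv : E.z⁻¹ = E.z := inv_eq_self_of_orderOf_two E.orderOf_z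

theorem mem_zpowers {x : G} : x ∈ Subgroup.zpowers E.z ↔ x = 1 ∨ x = E.z :=
  mem_zpowers_of_orderOf_two E.orderOf_z

theorem commute_z (g : G) : Commute g E.z := Subgroup.mem_center_iff.1 E.z_mem_center g

theorem z_mem_ker : E.z ∈ E.hom.ker := E.z_mem _ inferInstance fun h => by
  have := E.card_ker
  rw [h] at this
  simp at this

theorem card_ker_eq :
    Nat.card E.hom.ker = orderOf E.z ^ (Fintype.card (Fin 2 ⊕ Fin 2) + 1) := by
  rw [E.card_ker, E.orderOf_z]; rfl

theorem isMonolithic : IsMonolithic G := fun h => by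
  have := mem_monolith_of_forall.2 E.z_mem
  rw [h, Subgroup.mem_bot] at this
  exact E.z_ne_one this

/-- Exchange the two families of the dual pair. -/
def swap : ExtraspecialData G :=
  { E with
    u := E.w
    w := E.u
    u_mem := E.w_mem
    w_mem := E.u_mem
    dual := E.dual.symm E.z_inv }

/-- Replace the dual pair by another one. -/
def withPair {u w : Fin 2 ⊕ Fin 2 → G} (hu : ∀ i, u i ∈ E.hom.ker) (hw : ∀ i, w i ∈ E.hom.ker)
    (h : IsDualPair E.z u w) : ExtraspecialData G :=
  { E with
    u := u
    w := w
    u_mem := hu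
    w_mem := hw
    dual := h }

theorem commutator_mem {x y : G} (hx : x ∈ E.hom.ker) (hy : y ∈ E.hom.ker) :
    ⁅x, y⁆ = 1 ∨ ⁅x, y⁆ = E.z := by
  have := E.finite
  rw [← E.mem_zpowers]
  exact E.dual.commutator_mem_zpowers E.z_mem_center E.u_mem E.z_mem_ker E.card_ker_eq hx hy

theorem mul_self_mem {x : G} (hx : x ∈ E.hom.ker) : x * x = 1 ∨ x * x = E.z := by
  have := E.finite
  have h := E.dual.pow_mem_zpowers E.z_mem_center E.u_mem E.z_mem_ker E.card_ker_eq hx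
  rwa [E.orderOf_z, pow_two, E.mem_zpowers] at h

theorem eq_of_commute_w {x : G} (hx : x ∈ E.hom.ker) (h : ∀ j, Commute x (E.w j)) :
    x = 1 ∨ x = E.z := by
  have := E.finite
  rw [← E.mem_zpowers]
  exact E.dual.mem_zpowers E.z_mem_center E.u_mem E.z_mem_ker E.card_ker_eq hx fun j =>
    commutatorElement_eq_one_iff_commute.2 (h j)

theorem eq_of_commute {x : G} (hx : x ∈ E.hom.ker) (h : ∀ y ∈ E.hom.ker, Commute x y) :
    x = 1 ∨ x = E.z := E.eq_of_commute_w hx fun j => h _ (E.w_mem j)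

/-- The dual pair bound applied to `E.hom.ker ⊓ K` already gives 32: the `u i` and `z` generate the
kernel. -/
theorem ker_le {K : Subgroup G} (hu : ∀ i, E.u i ∈ K) (hz : E.z ∈ K) : E.hom.ker ≤ K := by
  have := E.finite
  have hd := E.dual.card_dvd E.z_mem_center (A := E.hom.ker ⊓ K)
    (fun i => ⟨E.u_mem i, hu i⟩) ⟨E.z_mem_ker, hz⟩
  rw [← E.card_ker_eq] at hd
  have := Subgroup.eq_of_le_of_card_ge (inf_le_left : E.hom.ker ⊓ K ≤ E.hom.ker)
    (Nat.le_of_dvd Nat.card_pos hd)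
  rw [← this]
  exact inf_le_right

/-- Otherwise `⟨s⟩` would be normal of order three and could not contain the involution `z`. -/
theorem exists_not_commute {s : G} (hs : orderOf s = 3) : ∃ q ∈ E.hom.ker, ¬ Commute s q := by
  have := E.finite
  by_contra! h
  have hsn := zpowers_normal_of_commute_ker (by rw [E.card_ker]) hs h
  have := Subgroup.orderOf_dvd_natCard _ (E.z_mem _ hsn (by
    rw [Ne, Subgroup.zpowers_eq_bot]
    rintro rfl
    simp at hs))
  rw [E.orderOf_z, Nat.card_zpowers, hs] at this
  omega

theorem pow_three_mem (g : G) : g ^ 3 ∈ E.hom.ker :=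
  have := E.finite
  pow_three_mem_ker E.card E.card_ker g

/-- An element centralizing `Q` lies in `Q`. -/
theorem mem_ker_of_commute {r : G} (h : ∀ q ∈ E.hom.ker, Commute r q) : r ∈ E.hom.ker := by
  have := E.finite
  by_contra hr
  -- Since `r ^ 63` is a power of a cube and so lies in the kernel, `r ∉ E.hom.ker` forces `r ^ 64`
  -- to have order exactly three.
  have h192 : (r ^ 64) ^ 3 = 1 := by
    rw [← pow_mul, show 64 * 3 = 96 * 2 by norm_num, pow_mul, ← E.card, pow_card_eq_one', one_pow]
  have hne : r ^ 64 ≠ 1 := by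
    intro h1
    have : r ^ 63 ∈ E.hom.ker := by
      rw [show 63 = 21 * 3 by norm_num, pow_mul]
      exact E.pow_three_mem _
    rw [show 64 = 63 + 1 by norm_num, pow_succ] at h1
    rw [eq_inv_of_mul_eq_one_right h1] at hr
    exact hr (inv_mem this)
  obtain ⟨q, hq, hn⟩ := E.exists_not_commute (orderOf_eq_prime h192 hne)
  exact hn ((h q hq).pow_left _)

theorem eq_z_of_actionRelations {P : KodairaTuple G 2} (hP : P.ActionRelations) (hz1 : P.z ≠ 1) :
    P.z = E.z := by
  have := E.finite
  have h := mem_monolith_of_forall.1 (hP.z_mem_monolith E.card E.isMonolithic hz1) _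
    (zpowers_normal_of_mem_center E.z_mem_center) (by
      rw [Ne, Subgroup.zpowers_eq_bot]; exact E.z_ne_one)
  exact (E.mem_zpowers.1 h).resolve_left hz1

/-- The cubes of the pair lie in the kernel and form a dual pair there, so `z` and the `w j ^ 3`
generate it. The even power `u i ^ 64` commutes with all of these, hence lies in the kernel, and `u
i ^ 63` lies there too. -/
theorem mem_ker_of_dual {u w : Fin 2 ⊕ Fin 2 → G} (h : IsDualPair E.z u w)
    (i : Fin 2 ⊕ Fin 2) : u i ∈ E.hom.ker := by
  have hu := h.cube_left E.z_mem_center E.orderOf_z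
  have huw := hu.cube_right E.z_mem_center E.orderOf_z
  set E' := (E.withPair (fun i => E.pow_three_mem (u i)) (fun i => E.pow_three_mem (w i)) huw).swap
    with hE'
  have hle : E.hom.ker ≤ Subgroup.centralizer {u i ^ 64} := by
    refine E'.ker_le (fun j => ?_) ?_
    · change w j ^ 3 ∈ _
      rw [Subgroup.mem_centralizer_singleton_iff]
      refine ((commutatorElement_eq_one_iff_commute.1 ?_).symm.pow_left 3).eq
      have hc : ⁅u i, w j⁆ ∈ Subgroup.center G := by
        rw [h i j]; split_ifs; exacts [E.z_mem_center, one_mem _]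
      rw [commutator_pow_left hc, h i j]
      split_ifs
      · rw [show 64 = 2 * 32 by norm_num, pow_mul, pow_two, E.z_mul_z, one_pow]
      · simp
    · rw [Subgroup.mem_centralizer_singleton_iff]
      exact (E.commute_z _).eq.symm
  have h64 := E.mem_ker_of_commute (r := u i ^ 64) fun q hq =>
    (Subgroup.mem_centralizer_singleton_iff.1 (hle hq)).symm
  have h63 : u i ^ 63 ∈ E.hom.ker := by
    rw [show 63 = 21 * 3 by norm_num, pow_mul]
    exact E.pow_three_mem _
  rw [show 64 = 63 + 1 by norm_num, pow_succ] at h64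
  exact (Subgroup.mul_mem_cancel_left _ h63).1 h64

theorem isDualPair_of_actionRelations {P : KodairaTuple G 2} (hP : P.ActionRelations)
    (hz1 : P.z ≠ 1) : IsDualPair E.z P.fst P.snd := by
  have hz := E.eq_z_of_actionRelations hP hz1
  rw [← hz]
  exact hP.isDualPair (hz ▸ E.z_mem_center) (by rw [hz, pow_two, E.z_mul_z])

theorem fst_mem {P : KodairaTuple G 2} (hP : P.ActionRelations) (hz1 : P.z ≠ 1)
    (i : Fin 2 ⊕ Fin 2) : P.fst i ∈ E.hom.ker :=
  E.mem_ker_of_dual (E.isDualPair_of_actionRelations hP hz1) i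

theorem snd_mem {P : KodairaTuple G 2} (hP : P.ActionRelations) (hz1 : P.z ≠ 1)
    (i : Fin 2 ⊕ Fin 2) : P.snd i ∈ E.hom.ker :=
  E.mem_ker_of_dual ((E.isDualPair_of_actionRelations hP hz1).symm E.z_inv) i

theorem exists_orderOf_eq_three : ∃ s : G, orderOf s = 3 :=
  have := E.finite
  exists_prime_orderOf_dvd_card' (G := G) 3 (by rw [E.card]; norm_num)

/-- An automorphism fixing a prestructure is trivial. -/
theorem mulAut_eq_one {P : KodairaTuple G 2} (hP : P.ActionRelations) (hz1 : P.z ≠ 1)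
    (φ : MulAut G) (hφ : P.map φ = P) : φ = 1 := by
  have := E.finite
  let F : Subgroup G := MonoidHom.eqLocus φ.toMonoidHom (MonoidHom.id G)
  have hF : ∀ g, g ∈ F ↔ φ g = g := fun g => Iff.rfl
  have hr₁ := congrArg KodairaTuple.r₁ hφ
  have ht₁ := congrArg KodairaTuple.t₁ hφ
  have hz := congrArg KodairaTuple.z hφ
  have hQ : E.hom.ker ≤ F := by
    refine (E.withPair (E.fst_mem hP hz1) (E.snd_mem hP hz1)
      (E.isDualPair_of_actionRelations hP hz1)).ker_le ?_ ?_
    · rintro (j | j)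
      · exact congrFun hr₁ j
      · exact congrFun ht₁ j
    · change E.z ∈ F
      rw [← E.eq_z_of_actionRelations hP hz1]
      exact hz
  obtain ⟨s, hs⟩ := E.exists_orderOf_eq_three
  have hs3 : s ^ 3 = 1 := by rw [← hs, pow_orderOf_eq_one]
  have hn := E.hom.normal_ker
  -- As `φ` is the identity on the kernel, `s` and `φ s` act on it by the same conjugation; they can
  -- differ only by an element of its centre `⟨z⟩`.
  have hc : ∀ q ∈ E.hom.ker, Commute (s⁻¹ * φ s) q := by
    intro q hq
    have h1 := hQ (hn.conj_mem q hq s)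
    rw [hF, map_mul, map_mul, map_inv, (hF q).1 (hQ hq)] at h1
    rw [commute_iff_eq, ← mul_inv_eq_iff_eq_mul]
    calc s⁻¹ * φ s * q * (s⁻¹ * φ s)⁻¹ = s⁻¹ * (φ s * q * (φ s)⁻¹) * s := by group
      _ = q := by rw [h1]; group
  have hr := E.mem_ker_of_commute hc
  have hsF : s ∈ F := by
    rw [hF]
    rcases E.eq_of_commute hr hc with h | h
    · exact (inv_mul_eq_one.1 h).symm
    · exfalso
      -- Then `φ s` would have cube `z`, although `s ^ 3 = 1`.
      have h1 : φ s = s * E.z := by rw [← h]; group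
      have h2 : (φ s) ^ 3 = 1 := by rw [← map_pow, hs3, map_one]
      rw [h1, (E.commute_z s).mul_pow, hs3, one_mul, pow_succ, pow_two, E.z_mul_z, one_mul] at h2
      exact E.z_ne_one h2
  have hd1 : 32 ∣ Nat.card F := by
    rw [← E.card_ker]; exact Subgroup.card_dvd_of_le hQ
  have hd2 : 3 ∣ Nat.card F := by
    rw [← hs]; exact Subgroup.orderOf_dvd_natCard _ hsF
  have hd : 96 ∣ Nat.card F := Nat.Coprime.mul_dvd_of_dvd_of_dvd (by norm_num) hd1 hd2
  have hFt : F = ⊤ := Subgroup.eq_top_of_le_card _ (by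
    rw [E.card]; exact Nat.le_of_dvd Nat.card_pos hd)
  ext g
  exact (hF g).1 (hFt ▸ Subgroup.mem_top g)

end ExtraspecialData

/-- The subtuple given by a pair of indices. -/
def KodairaTuple.restrict {G : Type*} {b : ℕ} (P : KodairaTuple G b) (f : Fin 2 → Fin b) :
    KodairaTuple G 2 where
  r₁ j := P.r₁ (f j)
  t₁ j := P.t₁ (f j)
  r₂ j := P.r₂ (f j)
  t₂ j := P.t₂ (f j)
  z := P.z

theorem KodairaTuple.ActionRelations.restrict {G : Type*} [Group G] {b : ℕ} {P : KodairaTuple G b}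
    (h : P.ActionRelations) {f : Fin 2 → Fin b} (hf : StrictMono f) :
    (P.restrict f).ActionRelations where
  r₁_r₂_lt _ _ hjk := h.r₁_r₂_lt _ _ (hf hjk)
  r₁_r₂_eq _ := h.r₁_r₂_eq _
  r₁_r₂_gt _ _ hjk := h.r₁_r₂_gt _ _ (hf hjk)
  r₁_t₂_lt _ _ hjk := h.r₁_t₂_lt _ _ (hf hjk)
  r₁_t₂_eq _ := h.r₁_t₂_eq _
  r₁_t₂_gt _ _ hjk := h.r₁_t₂_gt _ _ (hf hjk)
  r₁_z _ := h.r₁_z _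
  t₁_r₂_lt _ _ hjk := h.t₁_r₂_lt _ _ (hf hjk)
  t₁_r₂_eq _ := h.t₁_r₂_eq _
  t₁_r₂_gt _ _ hjk := h.t₁_r₂_gt _ _ (hf hjk)
  t₁_t₂_lt _ _ hjk := h.t₁_t₂_lt _ _ (hf hjk)
  t₁_t₂_eq _ := h.t₁_t₂_eq _
  t₁_t₂_gt _ _ hjk := h.t₁_t₂_gt _ _ (hf hjk)
  t₁_z _ := h.t₁_z _

/-- Every index belongs to an increasing pair, so results for two indices reach all the generators
of a structure with larger `b`. -/
theorem exists_strictMono_pair {b : ℕ} (hb : 2 ≤ b) (j : Fin b) :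
    ∃ f : Fin 2 → Fin b, StrictMono f ∧ ∃ i, f i = j := by
  by_cases hj : (j : ℕ) = 0
  · refine ⟨![j, ⟨1, hb⟩], ?_, 0, rfl⟩
    rw [Fin.strictMono_iff_lt_succ]
    intro i
    fin_cases i
    simp [Fin.lt_def, hj]
  · refine ⟨![⟨0, by omega⟩, j], ?_, 1, rfl⟩
    rw [Fin.strictMono_iff_lt_succ]
    intro i
    fin_cases i
    simp [Fin.lt_def]
    omega

theorem ExtraspecialData.not_isDiagonalDoubleKodairaStructure {G : Type*} [Group G]
    (E : ExtraspecialData G) {b n : ℕ} (S : KodairaTuple G b) :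
    ¬ S.IsDiagonalDoubleKodairaStructure n := by
  intro h
  have hz1 : S.z ≠ 1 := by
    intro hz
    have h1 := h.orderOf_z
    have h2 := h.two_le_n
    rw [hz, orderOf_one] at h1
    omega
  have hle : Subgroup.closure
      (Set.range S.r₁ ∪ Set.range S.t₁ ∪ Set.range S.r₂ ∪ Set.range S.t₂ ∪ {S.z}) ≤ E.hom.ker := by
    rw [Subgroup.closure_le]
    rintro x ((((⟨j, rfl⟩ | ⟨j, rfl⟩) | ⟨j, rfl⟩) | ⟨j, rfl⟩) | rfl)
    · obtain ⟨f, hf, i, rfl⟩ := exists_strictMono_pair h.two_le_b j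
      exact E.fst_mem (h.action.restrict hf) hz1 (.inl i)
    · obtain ⟨f, hf, i, rfl⟩ := exists_strictMono_pair h.two_le_b j
      exact E.fst_mem (h.action.restrict hf) hz1 (.inr i)
    · obtain ⟨f, hf, i, rfl⟩ := exists_strictMono_pair h.two_le_b j
      exact E.snd_mem (h.action.restrict hf) hz1 (.inr i)
    · obtain ⟨f, hf, i, rfl⟩ := exists_strictMono_pair h.two_le_b j
      exact E.snd_mem (h.action.restrict hf) hz1 (.inl i)
    · obtain ⟨f, hf, -⟩ := exists_strictMono_pair h.two_le_b ⟨0, by have := h.two_le_b; omega⟩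
      have := E.eq_z_of_actionRelations (h.action.restrict hf) hz1
      rw [show S.z = E.z from this]
      exact E.z_mem_ker
  rw [h.generates, top_le_iff] at hle
  have h1 := E.card_ker
  rw [hle, Subgroup.card_top, E.card] at h1
  omega

/-! ### Counting lifts of dual bases through two-to-one maps. -/

section Abstract

/-- A surjection whose fibres all have two elements, presented as the projection of a product. -/
theorem exists_equiv_prod_zmod_two {Q V : Type*} (κ : Q → V) (τ : Q → Q)
    (hs : Function.Surjective κ) (hτ : ∀ x, τ x ≠ x)
    (hf : ∀ x y, κ x = κ y ↔ x = y ∨ x = τ y) : ∃ e : Q ≃ V × ZMod 2, ∀ x, (e x).1 = κ x := by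
  classical
  choose s hs using hs
  have hκτ : ∀ x, κ (τ x) = κ x := fun x => (hf _ _).2 (Or.inr rfl)
  let f : V × ZMod 2 → Q := fun p => if p.2 = 0 then s p.1 else τ (s p.1)
  have hκf : ∀ p, κ (f p) = p.1 := by
    intro p
    by_cases h : p.2 = 0 <;> simp [f, h, hκτ, hs]
  have hbij : Function.Bijective f := by
    constructor
    · rintro ⟨a, i⟩ ⟨b, j⟩ h
      have hab : a = b := by
        have h' := congrArg κ h
        rwa [hκf, hκf] at h'
      subst hab
      have hij : ∀ i j : ZMod 2, i ≠ 0 → j ≠ 0 → i = j := by decide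
      by_cases hi : i = 0 <;> by_cases hj : j = 0
      · rw [hi, hj]
      · simp only [f, hi, hj, if_true, if_false] at h
        exact absurd h.symm (hτ _)
      · simp only [f, hi, hj, if_true, if_false] at h
        exact absurd h (hτ _)
      · rw [hij i j hi hj]
    · intro x
      rcases (hf x (s (κ x))).1 (hs _).symm with h | h
      · exact ⟨(κ x, 0), by simpa [f] using h.symm⟩
      · exact ⟨(κ x, 1), by simpa [f] using h.symm⟩
  refine ⟨(Equiv.ofBijective f hbij).symm, fun x => ?_⟩
  conv_rhs => rw [← (Equiv.ofBijective f hbij).apply_symm_apply x]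
  exact (hκf _).symm

/-- The second matrix is the inverse transpose of the first, so the count is the order of `GL₄` over
the field of two elements. -/
theorem card_mul_transpose_eq_one {ι : Type*} [Fintype ι] [DecidableEq ι]
    (hι : Fintype.card ι = 4) :
    Nat.card {p : Matrix ι ι (ZMod 2) × Matrix ι ι (ZMod 2) // p.1 * p.2.transpose = 1} = 20160 := by
  let e₁ : {p : Matrix ι ι (ZMod 2) × Matrix ι ι (ZMod 2) // p.1 * p.2.transpose = 1} ≃
      (Matrix ι ι (ZMod 2))ˣ :=
    { toFun := fun p => ⟨p.1.1, p.1.2.transpose, p.2, mul_eq_one_comm.1 p.2⟩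
      invFun := fun x => ⟨(x.val, x.inv.transpose), by simp⟩
      left_inv := fun p => by simp
      right_inv := fun x => by ext; rfl }
  let e₂ : (Matrix ι ι (ZMod 2))ˣ ≃* GL (Fin 4) (ZMod 2) :=
    Units.mapEquiv (Matrix.reindexAlgEquiv (ZMod 2) (ZMod 2)
      (Fintype.equivFinOfCardEq hι)).toMulEquiv
  rw [Nat.card_congr e₁, Nat.card_congr e₂.toEquiv, Matrix.card_GL_field]
  simp [Fin.prod_univ_succ]

/-- The number of pairs of lifts of dual bases. -/
theorem card_dual_lifts {ι Q : Type*} [Fintype ι] [DecidableEq ι] (hι : Fintype.card ι = 4)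
    (κ κ' : Q → ι → ZMod 2) (τ : Q → Q) (hτ : ∀ x, τ x ≠ x)
    (hs : Function.Surjective κ) (hs' : Function.Surjective κ')
    (hf : ∀ x y, κ x = κ y ↔ x = y ∨ x = τ y) (hf' : ∀ x y, κ' x = κ' y ↔ x = y ∨ x = τ y) :
    Nat.card {p : (ι → Q) × (ι → Q) //
      ∀ i j, ∑ k, κ (p.1 i) k * κ' (p.2 j) k = if i = j then 1 else 0} = 20160 * 256 := by
  obtain ⟨e, he⟩ := exists_equiv_prod_zmod_two κ τ hs hτ hf
  obtain ⟨e', he'⟩ := exists_equiv_prod_zmod_two κ' τ hs' hτ hf'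
  -- Each of the eight elements splits into a vector and a free bit; the duality condition sees only
  -- the vectors, and the bits contribute `2 ^ 8 = 256`.
  let E : (ι → Q) × (ι → Q) ≃
      (Matrix ι ι (ZMod 2) × Matrix ι ι (ZMod 2)) × ((ι → ZMod 2) × (ι → ZMod 2)) :=
    (Equiv.prodCongr ((Equiv.piCongrRight fun _ => e).trans (Equiv.arrowProdEquivProdArrow _ _ _))
      ((Equiv.piCongrRight fun _ => e').trans (Equiv.arrowProdEquivProdArrow _ _ _))).trans
      (Equiv.prodProdProdComm _ _ _ _)
  have hE : ∀ p, (E p).1 = (fun i => κ (p.1 i), fun i => κ' (p.2 i)) := by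
    intro p
    refine Prod.ext (funext fun i => ?_) (funext fun i => ?_)
    · exact he _
    · exact he' _
  let E₂ : {p : (ι → Q) × (ι → Q) //
      ∀ i j, ∑ k, κ (p.1 i) k * κ' (p.2 j) k = if i = j then 1 else 0} ≃
      {p : Matrix ι ι (ZMod 2) × Matrix ι ι (ZMod 2) // p.1 * p.2.transpose = 1} ×
        ((ι → ZMod 2) × (ι → ZMod 2)) :=
    (E.subtypeEquiv (q := fun r => r.1.1 * r.1.2.transpose = 1) (by
      intro p
      rw [hE, ← Matrix.ext_iff]
      rfl)).trans
      (Equiv.prodSubtypeFstEquivSubtypeProd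
        (p := fun r : Matrix ι ι (ZMod 2) × Matrix ι ι (ZMod 2) => r.1 * r.2.transpose = 1))
  rw [Nat.card_congr E₂, Nat.card_prod, card_mul_transpose_eq_one hι]
  simp [Nat.card_eq_fintype_card, hι]

end Abstract

/-! ### The symplectic space of the kernel modulo `⟨z⟩`, and the number of prestructures. -/

namespace ExtraspecialData

variable {G : Type*} [Group G] (E : ExtraspecialData G)

open Classical in
/-- `0` for the identity and `1` for all other elements. -/
noncomputable def sgn {G : Type*} [Group G] (g : G) : ZMod 2 := if g = 1 then 0 else 1

theorem sgn_one : sgn (1 : G) = 0 := if_pos rfl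

theorem sgn_z : sgn E.z = 1 := if_neg E.z_ne_one

theorem sgn_eq_zero {g : G} : sgn g = 0 ↔ g = 1 := by
  unfold sgn
  split_ifs with h <;> simp [h]

theorem sgn_mul {g h : G} (hg : g = 1 ∨ g = E.z) (hh : h = 1 ∨ h = E.z) :
    sgn (g * h) = sgn g + sgn h := by
  rcases hg with rfl | rfl <;> rcases hh with rfl | rfl <;>
    simp only [one_mul, mul_one, sgn_one, E.sgn_z, E.z_mul_z] <;> decide

theorem sgn_inj {g h : G} (hg : g = 1 ∨ g = E.z) (hh : h = 1 ∨ h = E.z) :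
    sgn g = sgn h ↔ g = h := by
  refine ⟨fun e => ?_, fun e => by rw [e]⟩
  rcases hg with rfl | rfl <;> rcases hh with rfl | rfl <;>
    simp only [sgn_one, E.sgn_z] at e <;> first | rfl | exact absurd e (by decide)

/-- The commutator form. -/
noncomputable def form {G : Type*} [Group G] (x y : G) : ZMod 2 := sgn ⁅x, y⁆

theorem form_eq_zero {x y : G} : form x y = 0 ↔ Commute x y :=
  sgn_eq_zero.trans commutatorElement_eq_one_iff_commute

theorem form_mul_left {x y w : G} (hx : x ∈ E.hom.ker) (hy : y ∈ E.hom.ker) (hw : w ∈ E.hom.ker) :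
    form (x * y) w = form x w + form y w := by
  unfold form
  rw [commutator_mul_left, E.sgn_mul (E.commutator_mem hx hw) (E.commutator_mem hy hw)]
  rcases E.commutator_mem hy hw with h | h <;> rw [h]
  exacts [one_mem _, E.z_mem_center]

theorem form_symm {x y : G} (hx : x ∈ E.hom.ker) (hy : y ∈ E.hom.ker) : form x y = form y x := by
  unfold form
  rw [← commutatorElement_inv]
  rcases E.commutator_mem hy hx with h | h <;> rw [h]
  · rw [inv_one]
  · rw [E.z_inv]

theorem form_mul_right {x y w : G} (hx : x ∈ E.hom.ker) (hy : y ∈ E.hom.ker)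
    (hw : w ∈ E.hom.ker) : form w (x * y) = form w x + form w y := by
  rw [E.form_symm hw (mul_mem hx hy), E.form_mul_left hx hy hw, E.form_symm hx hw,
    E.form_symm hy hw]

theorem form_z (x : G) : form x E.z = 0 := form_eq_zero.2 (E.commute_z x)

theorem form_u_w (i j : Fin 2 ⊕ Fin 2) : form (E.u i) (E.w j) = if i = j then 1 else 0 := by
  unfold form
  rw [E.dual i j]
  split_ifs
  · exact E.sgn_z
  · exact sgn_one

/-- Coordinates with respect to the first family of the dual pair. -/
noncomputable def coord (x : E.hom.ker) (j : Fin 2 ⊕ Fin 2) : ZMod 2 := form (x : G) (E.w j)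

theorem coord_mul (x y : E.hom.ker) : E.coord (x * y) = E.coord x + E.coord y := by
  ext j
  exact E.form_mul_left x.2 y.2 (E.w_mem j)

theorem coord_eq_iff (x y : E.hom.ker) :
    E.coord x = E.coord y ↔ x = y ∨ x = y * ⟨E.z, E.z_mem_ker⟩ := by
  have hz : E.coord ⟨E.z, E.z_mem_ker⟩ = 0 := by
    ext j
    exact form_eq_zero.2 (E.commute_z _).symm
  constructor
  · intro h
    have h1 : E.coord (y⁻¹ * x) = 0 := by
      have h2 : E.coord (y * (y⁻¹ * x)) = E.coord y := by rw [mul_inv_cancel_left, h]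
      rw [coord_mul] at h2
      simpa using h2
    rcases E.eq_of_commute_w (y⁻¹ * x).2 fun j => form_eq_zero.1 (congrFun h1 j) with h2 | h2
    · left
      exact (inv_mul_eq_one.1 (Subtype.ext h2)).symm
    · right
      rw [eq_comm, ← eq_inv_mul_iff_mul_eq]
      exact Subtype.ext h2.symm
  · rintro (rfl | rfl)
    · rfl
    · rw [coord_mul, hz, add_zero]

theorem coord_surjective : Function.Surjective E.coord := by
  let f : E.hom.ker →* Multiplicative (Fin 2 ⊕ Fin 2 → ZMod 2) :=
    { toFun := fun x => Multiplicative.ofAdd (E.coord x)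
      map_one' := by
        have h := E.coord_mul 1 1
        rw [one_mul] at h
        exact congrArg Multiplicative.ofAdd (by simpa using h)
      map_mul' := fun x y => congrArg Multiplicative.ofAdd (E.coord_mul x y) }
  have hf : ∀ i, f ⟨E.u i, E.u_mem i⟩ = Multiplicative.ofAdd (Pi.single i 1) := by
    intro i
    refine congrArg Multiplicative.ofAdd (funext fun j => ?_)
    change form (E.u i) (E.w j) = _
    rw [form_u_w, Pi.single_apply]
    simp [eq_comm]
  intro v
  have h01 : ∀ a : ZMod 2, a = 0 ∨ a = 1 := by decide
  have hv : Multiplicative.ofAdd v ∈ f.range := by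
    have : v = ∑ i, Pi.single i (v i) := (Finset.univ_sum_single v).symm
    rw [this, ofAdd_sum]
    refine Subgroup.prod_mem _ fun i _ => ?_
    rcases h01 (v i) with h | h
    · rw [h, Pi.single_zero]; exact one_mem _
    · rw [h, ← hf]; exact ⟨_, rfl⟩
  obtain ⟨x, hx⟩ := hv
  exact ⟨x, congrArg Multiplicative.toAdd hx⟩

/-- Both sides are additive in `x` and vanish at `z`; at `u i` the sum reduces to the coordinate
`form y (u i)`. These elements generate the kernel. -/
theorem form_eq_sum (x y : E.hom.ker) :
    form (x : G) (y : G) = ∑ k, E.coord x k * E.swap.coord y k := by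
  let K : Subgroup G :=
    { carrier := {g | ∃ h : g ∈ E.hom.ker, form g (y : G) =
        ∑ k, E.coord ⟨g, h⟩ k * E.swap.coord y k}
      mul_mem' := by
        rintro a b ⟨ha, ha'⟩ ⟨hb, hb'⟩
        refine ⟨mul_mem ha hb, ?_⟩
        rw [E.form_mul_left ha hb y.2, ha', hb', ← Finset.sum_add_distrib]
        refine Finset.sum_congr rfl fun k _ => ?_
        rw [← add_mul]
        congr 1
        exact (congrFun (E.coord_mul ⟨a, ha⟩ ⟨b, hb⟩) k).symm
      one_mem' := by
        refine ⟨one_mem _, ?_⟩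
        have h : ∀ k, E.coord ⟨1, one_mem _⟩ k = 0 := fun k =>
          form_eq_zero.2 (Commute.one_left _)
        simp [h, form_eq_zero.2 (Commute.one_left _)]
      inv_mem' := by
        rintro a ⟨ha, ha'⟩
        have hinv : ∀ w ∈ E.hom.ker, form a⁻¹ w = form a w := by
          intro w hw
          have h1 := E.form_mul_left (inv_mem ha) ha hw
          rw [inv_mul_cancel, form_eq_zero.2 (Commute.one_left _)] at h1
          have key : ∀ p q : ZMod 2, 0 = p + q → p = q := by decide
          exact key _ _ h1
        refine ⟨inv_mem ha, ?_⟩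
        rw [hinv _ y.2, ha']
        refine Finset.sum_congr rfl fun k _ => ?_
        congr 1
        exact (hinv _ (E.w_mem k)).symm }
  obtain ⟨_, h⟩ := E.ker_le (K := K) (fun i => ⟨E.u_mem i, by
    have h1 : ∀ k, E.coord ⟨E.u i, E.u_mem i⟩ k = if i = k then 1 else 0 := E.form_u_w i
    simp only [h1, ite_mul, one_mul, zero_mul, Finset.sum_ite_eq, Finset.mem_univ, if_true]
    exact E.form_symm (E.u_mem i) y.2⟩) ⟨E.z_mem_ker, by
    have h1 : ∀ k, E.coord ⟨E.z, E.z_mem_ker⟩ k = 0 := fun k =>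
      form_eq_zero.2 (E.commute_z _).symm
    simp only [h1, zero_mul, Finset.sum_const_zero]
    exact form_eq_zero.2 (E.commute_z _).symm⟩ x.2
  exact h

theorem isDualPair_iff {u w : Fin 2 ⊕ Fin 2 → E.hom.ker} :
    IsDualPair E.z (fun i => (u i : G)) (fun i => (w i : G)) ↔
      ∀ i j, ∑ k, E.coord (u i) k * E.swap.coord (w j) k = if i = j then 1 else 0 := by
  refine forall_congr' fun i => forall_congr' fun j => ?_
  rw [← E.form_eq_sum, ← E.sgn_inj (E.commutator_mem (u i).2 (w j).2) (by
    split_ifs; exacts [Or.inr rfl, Or.inl rfl])]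
  rw [apply_ite sgn, E.sgn_z, sgn_one]
  rfl

include E in
-- A prestructure has `z = E.z` and both strands in the kernel, so it is the same as a dual pair
-- there, that is, a lift of two dual bases.
theorem card_prestructure : Nat.card (Prestructure G) = 20160 * 256 := by
  have hn : ∀ P : Prestructure G, P.1.z ≠ 1 := by
    rintro ⟨P, n, h⟩ hz
    have h1 := h.orderOf_z
    have h2 := h.two_le_n
    rw [show P.z = 1 from hz, orderOf_one] at h1
    omega
  have ha : ∀ P : Prestructure G, P.1.ActionRelations := fun P => P.2.choose_spec.action
  let e : Prestructure G ≃ {p : (Fin 2 ⊕ Fin 2 → E.hom.ker) × (Fin 2 ⊕ Fin 2 → E.hom.ker) //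
      ∀ i j, ∑ k, E.coord (p.1 i) k * E.swap.coord (p.2 j) k = if i = j then 1 else 0} :=
    { toFun := fun P => ⟨(fun i => ⟨P.1.fst i, E.fst_mem (ha P) (hn P) i⟩,
        fun i => ⟨P.1.snd i, E.snd_mem (ha P) (hn P) i⟩),
        E.isDualPair_iff.1 (E.isDualPair_of_actionRelations (ha P) (hn P))⟩
      invFun := fun p => ⟨⟨fun j => p.1.1 (.inl j), fun j => p.1.1 (.inr j),
        fun j => p.1.2 (.inr j), fun j => p.1.2 (.inl j), E.z⟩, 2, le_rfl, E.orderOf_z,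
        .of_isDualPair E.z_mem_center (by
          change E.z ^ 2 = 1
          rw [pow_two, E.z_mul_z]) (by
          convert E.isDualPair_iff.2 p.2 using 1
          · ext i; rcases i with i | i <;> rfl
          · ext i; rcases i with i | i <;> rfl)⟩
      left_inv := fun P => by
        apply Subtype.ext
        have := E.eq_z_of_actionRelations (ha P) (hn P)
        obtain ⟨⟨r₁, t₁, r₂, t₂, z⟩, hP⟩ := P
        change z = E.z at this
        subst this
        rfl
      right_inv := fun p => by
        apply Subtype.ext
        refine Prod.ext (funext fun i => ?_) (funext fun i => ?_)
        · rcases i with i | i <;> rfl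
        · rcases i with i | i <;> rfl }
  rw [Nat.card_congr e]
  refine card_dual_lifts rfl E.coord E.swap.coord (fun x => x * (⟨E.z, E.z_mem_ker⟩ : E.hom.ker))
    (fun x h => ?_) E.coord_surjective E.swap.coord_surjective E.coord_eq_iff
    E.swap.coord_eq_iff
  exact E.z_ne_one (congrArg Subtype.val (mul_eq_left.1 h))

include E in
/-- `Aut(G)` acts freely on the prestructures of `G`. -/
theorem numPrestructuresUpToAut_mul :
    numPrestructuresUpToAut G * Nat.card (MulAut G) = 20160 * 256 := by
  have hn : ∀ P : Prestructure G, P.1.z ≠ 1 := by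
    rintro ⟨P, n, h⟩ hz
    have h1 := h.orderOf_z
    have h2 := h.two_le_n
    rw [show P.z = 1 from hz, orderOf_one] at h1
    omega
  have ha : ∀ P : Prestructure G, P.1.ActionRelations := fun P => P.2.choose_spec.action
  let act : MulAut G → Prestructure G → Prestructure G := fun φ P =>
    ⟨P.1.map φ, P.2.choose, P.2.choose_spec.two_le_n, by
      rw [← P.2.choose_spec.orderOf_z]
      exact φ.orderOf_eq _, (ha P).mapHom φ.toMonoidHom⟩
  rw [← E.card_prestructure, numPrestructuresUpToAut, ← Nat.card_prod]
  -- Moving a chosen representative of each orbit by all automorphisms hits every prestructure once,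
  -- because stabilizers are trivial.
  refine Nat.card_eq_of_bijective (fun p : Quotient (prestructureSetoid G) × MulAut G =>
    act p.2 p.1.out) ⟨?_, ?_⟩
  · rintro ⟨q, φ⟩ ⟨q', ψ⟩ h
    have h' : q.out.1.map φ = q'.out.1.map ψ := congrArg Subtype.val h
    have hq : q = q' := by
      rw [← q.out_eq, ← q'.out_eq]
      refine Quotient.sound ⟨ψ⁻¹ * φ, ?_⟩
      have h2 := congrArg (KodairaTuple.map ψ⁻¹) h'
      have h3 : ∀ P : KodairaTuple G 2, (P.map ψ).map ψ⁻¹ = P := fun P => by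
        simp [KodairaTuple.map]
      rw [h3] at h2
      exact h2
    subst hq
    refine Prod.ext rfl ?_
    have h2 := congrArg (KodairaTuple.map ψ⁻¹) h'
    have h3 : ∀ P : KodairaTuple G 2, (P.map ψ).map ψ⁻¹ = P := fun P => by
      simp [KodairaTuple.map]
    rw [h3] at h2
    have := E.mulAut_eq_one (ha q.out) (hn q.out) (ψ⁻¹ * φ) h2
    exact (inv_mul_eq_one.1 this).symm
  · intro P
    obtain ⟨φ, hφ⟩ := Quotient.exact (Quotient.out_eq (Quotient.mk (prestructureSetoid G) P))
    exact ⟨(_, φ), Subtype.ext hφ⟩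

end ExtraspecialData

/-! ### The relators as equations between six elements. -/

namespace SmallGroups

variable {G : Type*} [Group G]

theorem lift_rels96_201 (x : Fin 6 → G) : (∀ r ∈ rels96_201, FreeGroup.lift x r = 1) ↔
    (x 0 ^ 2 = x 5 ∧ x 1 ^ 2 = x 5 ∧ ⁅x 0, x 1⁆ = x 5) ∧
    (x 2 ^ 3 = 1 ∧ ⁅x 0, x 2⁆ = 1 ∧ ⁅x 1, x 2⁆ = 1) ∧
    (x 3 ^ 2 = x 5 ∧ ⁅x 0, x 3⁆ = 1 ∧ ⁅x 1, x 3⁆ = 1 ∧ ⁅x 2, x 3⁆ = (x 4)⁻¹) ∧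
    (x 4 ^ 2 = x 5 ∧ ⁅x 0, x 4⁆ = 1 ∧ ⁅x 1, x 4⁆ = 1 ∧ ⁅x 2, x 4⁆ = x 3 * (x 4)⁻¹ ∧
      ⁅x 3, x 4⁆ = x 5) ∧
    (x 5 ^ 2 = 1 ∧ ⁅x 0, x 5⁆ = 1 ∧ ⁅x 1, x 5⁆ = 1 ∧ ⁅x 2, x 5⁆ = 1 ∧ ⁅x 3, x 5⁆ = 1 ∧
      ⁅x 4, x 5⁆ = 1) := by
  simp only [rels96_201, Set.mem_insert_iff, Set.mem_singleton_iff, forall_eq_or_imp, forall_eq,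
    map_mul, map_pow, map_inv, map_commutatorElement, FreeGroup.lift_apply_of, mul_inv_eq_one,
    and_assoc]

theorem lift_rels96_202 (x : Fin 6 → G) : (∀ r ∈ rels96_202, FreeGroup.lift x r = 1) ↔
    (x 0 ^ 2 = 1 ∧ x 1 ^ 2 = 1 ∧ ⁅x 0, x 1⁆ = x 5) ∧
    (x 2 ^ 3 = 1 ∧ ⁅x 0, x 2⁆ = 1 ∧ ⁅x 1, x 2⁆ = 1) ∧
    (x 3 ^ 2 = x 5 ∧ ⁅x 0, x 3⁆ = 1 ∧ ⁅x 1, x 3⁆ = 1 ∧ ⁅x 2, x 3⁆ = (x 4)⁻¹) ∧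
    (x 4 ^ 2 = x 5 ∧ ⁅x 0, x 4⁆ = 1 ∧ ⁅x 1, x 4⁆ = 1 ∧ ⁅x 2, x 4⁆ = x 3 * (x 4)⁻¹ ∧
      ⁅x 3, x 4⁆ = x 5) ∧
    (x 5 ^ 2 = 1 ∧ ⁅x 0, x 5⁆ = 1 ∧ ⁅x 1, x 5⁆ = 1 ∧ ⁅x 2, x 5⁆ = 1 ∧ ⁅x 3, x 5⁆ = 1 ∧
      ⁅x 4, x 5⁆ = 1) := by
  simp only [rels96_202, Set.mem_insert_iff, Set.mem_singleton_iff, forall_eq_or_imp, forall_eq,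
    map_mul, map_pow, map_inv, map_commutatorElement, FreeGroup.lift_apply_of, mul_inv_eq_one,
    and_assoc]

theorem lift_rels96_204 (x : Fin 6 → G) : (∀ r ∈ rels96_204, FreeGroup.lift x r = 1) ↔
    x 0 ^ 3 = 1 ∧ (x 1 ^ 2 = 1 ∧ ⁅x 0, x 1⁆ = x 2) ∧
    (x 2 ^ 2 = 1 ∧ ⁅x 0, x 2⁆ = x 1 * x 2 ∧ ⁅x 1, x 2⁆ = 1) ∧
    (x 3 ^ 2 = 1 ∧ ⁅x 0, x 3⁆ = x 4 ∧ ⁅x 1, x 3⁆ = 1 ∧ ⁅x 2, x 3⁆ = x 5) ∧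
    (x 4 ^ 2 = 1 ∧ ⁅x 0, x 4⁆ = x 3 * x 4 ∧ ⁅x 1, x 4⁆ = x 5 ∧ ⁅x 2, x 4⁆ = 1 ∧
      ⁅x 3, x 4⁆ = 1) ∧
    (x 5 ^ 2 = 1 ∧ ⁅x 0, x 5⁆ = 1 ∧ ⁅x 1, x 5⁆ = 1 ∧ ⁅x 2, x 5⁆ = 1 ∧ ⁅x 3, x 5⁆ = 1 ∧
      ⁅x 4, x 5⁆ = 1) := by
  simp only [rels96_204, Set.mem_insert_iff, Set.mem_singleton_iff, forall_eq_or_imp, forall_eq,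
    map_mul, map_pow, map_inv, map_commutatorElement, FreeGroup.lift_apply_of, mul_inv_eq_one,
    and_assoc]

end SmallGroups

/-! ### The quadratic form of squares and norms under an element of order three. -/

namespace ExtraspecialData

variable {G : Type*} [Group G] (E : ExtraspecialData G)

theorem zmod_two_eq : ∀ a : ZMod 2, a = 0 ∨ a = 1 := by decide

theorem form_eq_one {x y : G} (hx : x ∈ E.hom.ker) (hy : y ∈ E.hom.ker) :
    form x y = 1 ↔ ⁅x, y⁆ = E.z := by
  rw [form, ← E.sgn_z, E.sgn_inj (E.commutator_mem hx hy) (Or.inr rfl)]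

/-- The squaring form. -/
noncomputable def quad {G : Type*} [Group G] (x : G) : ZMod 2 := sgn (x * x)

theorem quad_eq_zero {x : G} : quad x = 0 ↔ x * x = 1 := sgn_eq_zero

theorem quad_eq_one {x : G} (hx : x ∈ E.hom.ker) : quad x = 1 ↔ x * x = E.z := by
  rw [quad, ← E.sgn_z, E.sgn_inj (E.mul_self_mem hx) (Or.inr rfl)]

/-- `(xy)² = x² y² ⁅x, y⁆` because commutators and squares are central: `quad` is a quadratic form
with polar form `form`. -/
theorem quad_mul {x y : G} (hx : x ∈ E.hom.ker) (hy : y ∈ E.hom.ker) :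
    quad (x * y) = quad x + quad y + form x y := by
  have h1 : x * y * (x * y) = (x * x) * (y * y) * ⁅x, y⁆ := by
    have h2 : x * y * (x * y) = x * (⁅y, x⁆ * x) * (y * y) := by
      rw [commutatorElement_def]; group
    have h3 : ⁅y, x⁆ = ⁅x, y⁆ := by
      rw [← commutatorElement_inv]
      rcases E.commutator_mem hx hy with h | h <;> rw [h]
      exacts [inv_one, E.z_inv]
    have h4 : ∀ g, g * ⁅x, y⁆ = ⁅x, y⁆ * g := by
      intro g
      rcases E.commutator_mem hx hy with h | h <;> rw [h]
      · simp
      · exact E.commute_z g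
    rw [h2, h3, h4 (x * x * (y * y)), ← h4 x]
    simp only [← mul_assoc]
    rw [h4 (x * x)]
    simp only [mul_assoc]
  have hz := E.z_mul_z
  unfold quad form
  rw [h1, E.sgn_mul _ (E.commutator_mem hx hy), E.sgn_mul (E.mul_self_mem hx) (E.mul_self_mem hy)]
  rcases E.mul_self_mem hx with h | h <;> rcases E.mul_self_mem hy with h' | h' <;>
    simp [h, h', hz]

theorem sgn_congr {g h : G} (e : g = 1 ↔ h = 1) : sgn g = sgn h := by
  rcases zmod_two_eq (sgn h) with hh | hh
  · rw [hh, sgn_eq_zero, e, ← sgn_eq_zero, hh]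
  · rcases zmod_two_eq (sgn g) with hg | hg
    · rw [sgn_eq_zero, e, ← sgn_eq_zero, hh] at hg
      exact absurd hg one_ne_zero
    · rw [hg, hh]

theorem sgn_conj (s x : G) : sgn (MulAut.conj s x) = sgn x := by
  exact sgn_congr (map_eq_one_iff _ (MulAut.conj s).injective)

theorem form_conj (s x y : G) : form (MulAut.conj s x) (MulAut.conj s y) = form x y := by
  unfold form
  rw [← map_commutatorElement, sgn_conj]

theorem quad_conj (s x : G) : quad (MulAut.conj s x) = quad x := by
  unfold quad
  rw [← map_mul, sgn_conj]

theorem conj_mem (s : G) {x : G} (hx : x ∈ E.hom.ker) : MulAut.conj s x ∈ E.hom.ker :=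
  E.hom.normal_ker.conj_mem x hx s

theorem conj_z (s : G) : MulAut.conj s E.z = E.z := conj_eq_of_mem_center E.z_mem_center s

theorem conj_eq_self {s x : G} : MulAut.conj s x = x ↔ Commute s x := by
  rw [MulAut.conj_apply, mul_inv_eq_iff_eq_mul]; rfl

theorem conj_conj_conj {s : G} (hs : s ^ 3 = 1) (x : G) :
    MulAut.conj s (MulAut.conj s (MulAut.conj s x)) = x := by
  rw [← MulAut.mul_apply, ← MulAut.mul_apply, ← map_mul, ← map_mul, ← pow_two,
    ← pow_succ, hs, map_one]
  rfl

theorem quad_z : quad E.z = 0 := quad_eq_zero.2 E.z_mul_z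

theorem quad_mul_z {x : G} (hx : x ∈ E.hom.ker) : quad (x * E.z) = quad x := by
  rw [E.quad_mul hx E.z_mem_ker, E.quad_z, E.form_z, add_zero, add_zero]

theorem form_mul_z {x y : G} (hx : x ∈ E.hom.ker) (hy : y ∈ E.hom.ker) :
    form (x * E.z) y = form x y := by
  rw [E.form_mul_left hx E.z_mem_ker hy, form_eq_zero.2 (E.commute_z y).symm, add_zero]

theorem form_mul_z_right {x y : G} (hx : x ∈ E.hom.ker) (hy : y ∈ E.hom.ker) :
    form x (y * E.z) = form x y := by
  rw [E.form_mul_right hy E.z_mem_ker hx, E.form_z, add_zero]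

/-- The norm `x * xˢ * xˢˢ`. -/
def norm {G : Type*} [Group G] (s x : G) : G :=
  x * MulAut.conj s x * MulAut.conj s (MulAut.conj s x)

theorem norm_mem (s : G) {x : G} (hx : x ∈ E.hom.ker) : norm s x ∈ E.hom.ker :=
  mul_mem (mul_mem hx (E.conj_mem s hx)) (E.conj_mem s (E.conj_mem s hx))

/-- Conjugation by `s` rotates the three factors, which amounts to conjugating the norm by `x⁻¹`. So
`⁅s, norm s x⁆` lies in `⟨z⟩`, and an element with trivial cube then commutes. -/
theorem commute_norm {s : G} (hs : s ^ 3 = 1) {x : G} (hx : x ∈ E.hom.ker) :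
    Commute s (norm s x) := by
  refine commute_of_commutator_mem E.z_mem_center E.orderOf_z hs ?_
  have h1 : MulAut.conj s (norm s x) = x⁻¹ * norm s x * x := by
    rw [norm, map_mul, map_mul, conj_conj_conj hs]
    group
  have h2 : ⁅s, norm s x⁆ = ⁅x⁻¹, norm s x⁆ := by
    rw [commutatorElement_def, ← MulAut.conj_apply, h1, commutatorElement_def, inv_inv]
  rw [h2, E.mem_zpowers]
  exact E.commutator_mem (inv_mem hx) (E.norm_mem s hx)

theorem form_norm (s : G) {x y : G} (hx : x ∈ E.hom.ker) (hy : y ∈ E.hom.ker) :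
    form y (norm s x) = form y x + form y (MulAut.conj s x) +
      form y (MulAut.conj s (MulAut.conj s x)) := by
  have h1 := E.conj_mem s hx
  have h2 := E.conj_mem s h1
  rw [norm, E.form_mul_right (mul_mem hx h1) h2 hy, E.form_mul_right hx h1 hy]

/-- If the norm of `x` lies in the centre, then a multiple of `x` by a central element has
trivial norm. -/
theorem exists_norm_eq_one {s x : G} (h : norm s x = 1 ∨ norm s x = E.z) :
    norm s x = 1 ∨ norm s (x * E.z) = 1 := by
  rcases h with h | h
  · exact Or.inl h
  · right
    have hc : ∀ g, g * E.z = E.z * g := fun g => E.commute_z g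
    have : norm s (x * E.z) = norm s x * E.z * (E.z * E.z) := by
      simp only [norm, map_mul, E.conj_z, mul_assoc]
      have hc' : ∀ g h, E.z * (g * h) = g * (E.z * h) := fun g h => by
        rw [← mul_assoc, ← hc, mul_assoc]
      simp only [hc']
    rw [this, h, E.z_mul_z, one_mul]

theorem quad_inv {x : G} : quad x⁻¹ = quad x := by
  unfold quad
  rw [← mul_inv_rev]
  exact sgn_congr inv_eq_one

/-- Modulo the centre the second conjugate of `x` is the inverse of `x * xˢ`. Comparing squares
gives `q(x) = 2 q(x) + form x xˢ`. -/
theorem quad_eq_form_of_norm {s x : G} (hx : x ∈ E.hom.ker)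
    (h : norm s x = 1 ∨ norm s x = E.z) : quad x = form x (MulAut.conj s x) := by
  have h1 := E.conj_mem s hx
  have hq : quad (MulAut.conj s (MulAut.conj s x)) = quad (x * MulAut.conj s x) := by
    rcases h with h | h
    · rw [eq_inv_of_mul_eq_one_right h, quad_inv]
    · have : MulAut.conj s (MulAut.conj s x) = (x * MulAut.conj s x)⁻¹ * E.z := by
        rw [← h, norm]; group
      rw [this, E.quad_mul_z (inv_mem (mul_mem hx h1)), quad_inv]
  rw [quad_conj, quad_conj, E.quad_mul hx h1, quad_conj] at hq
  have key : ∀ a b : ZMod 2, a = a + a + b → a = b := by decide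
  exact key _ _ hq

end ExtraspecialData

/-! ### Hyperbolic pairs and the splitting off of fixed vectors. -/

namespace ExtraspecialData

variable {G : Type*} [Group G] (E : ExtraspecialData G)

theorem form_self (x : G) : form x x = 0 := form_eq_zero.2 (Commute.refl x)

/-- A family of four elements paired as `(y, y')`, `(v, v')`. -/
theorem isDualPair_of_form {y y' v v' : G} (hy : y ∈ E.hom.ker) (hy' : y' ∈ E.hom.ker)
    (hv : v ∈ E.hom.ker) (hv' : v' ∈ E.hom.ker) (h1 : form y y' = 1) (h2 : form v v' = 1)
    (h3 : form v y = 0) (h4 : form v y' = 0) (h5 : form v' y = 0) (h6 : form v' y' = 0) :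
    IsDualPair E.z (Sum.elim ![y, y'] ![v, v']) (Sum.elim ![y', y] ![v', v]) := by
  have e1 := (E.form_eq_one hy hy').1 h1
  have e1' := (E.form_eq_one hy' hy).1 (by rw [← E.form_symm hy hy', h1])
  have e2 := (E.form_eq_one hv hv').1 h2
  have e2' := (E.form_eq_one hv' hv).1 (by rw [← E.form_symm hv hv', h2])
  have c := fun {a b : G} (h : form a b = 0) =>
    commutatorElement_eq_one_iff_commute.2 (form_eq_zero.1 h)
  have c' := fun {a b : G} (h : form a b = 0) =>
    commutatorElement_eq_one_iff_commute.2 (form_eq_zero.1 h).symm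
  rintro (i | i) (j | j) <;> fin_cases i <;> fin_cases j <;>
    simp [e1, e1', e2, e2', c h3, c h4, c h5, c h6, c' h3, c' h4, c' h5, c' h6]

/-- Elements orthogonal to two hyperbolic pairs are central. -/
theorem eq_of_form_eq_zero {y y' v v' x : G} (hy : y ∈ E.hom.ker) (hy' : y' ∈ E.hom.ker)
    (hv : v ∈ E.hom.ker) (hv' : v' ∈ E.hom.ker) (h1 : form y y' = 1) (h2 : form v v' = 1)
    (h3 : form v y = 0) (h4 : form v y' = 0) (h5 : form v' y = 0) (h6 : form v' y' = 0)
    (hx : x ∈ E.hom.ker) (hxy : form x y = 0) (hxy' : form x y' = 0) (hxv : form x v = 0)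
    (hxv' : form x v' = 0) : x = 1 ∨ x = E.z := by
  refine (E.withPair (u := Sum.elim ![y, y'] ![v, v']) (w := Sum.elim ![y', y] ![v', v]) ?_ ?_
    (E.isDualPair_of_form hy hy' hv hv' h1 h2 h3 h4 h5 h6)).eq_of_commute_w hx ?_
  · rintro (i | i) <;> fin_cases i <;> assumption
  · rintro (i | i) <;> fin_cases i <;> assumption
  · rintro (i | i) <;> fin_cases i <;> exact form_eq_zero.1 (by assumption)

/-- Orthogonal projection away from a hyperbolic pair. -/
theorem exists_mul_orthogonal {y y' : G} (hy : y ∈ E.hom.ker) (hy' : y' ∈ E.hom.ker)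
    (h : form y y' = 1) {x : G} (hx : x ∈ E.hom.ker) :
    ∃ c ∈ Subgroup.closure {y, y'}, form (x * c) y = 0 ∧ form (x * c) y' = 0 := by
  have hmy : y ∈ Subgroup.closure {y, y'} := Subgroup.subset_closure (by simp)
  have hmy' : y' ∈ Subgroup.closure {y, y'} := Subgroup.subset_closure (by simp)
  have h' : form y' y = 1 := by rw [← E.form_symm hy hy', h]
  have h11 : (1 : ZMod 2) + 1 = 0 := by decide
  rcases zmod_two_eq (form x y) with a | a <;> rcases zmod_two_eq (form x y') with b | b
  · exact ⟨1, one_mem _, by rwa [mul_one], by rwa [mul_one]⟩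
  · exact ⟨y, hmy, by rw [E.form_mul_left hx hy hy, a, form_self, add_zero],
      by rw [E.form_mul_left hx hy hy', b, h, h11]⟩
  · exact ⟨y', hmy', by rw [E.form_mul_left hx hy' hy, a, h', h11],
      by rw [E.form_mul_left hx hy' hy', b, form_self, add_zero]⟩
  · refine ⟨y * y', mul_mem hmy hmy', ?_, ?_⟩
    · rw [E.form_mul_left hx (mul_mem hy hy') hy, E.form_mul_left hy hy' hy, a, h', form_self,
        zero_add, h11]
    · rw [E.form_mul_left hx (mul_mem hy hy') hy', E.form_mul_left hy hy' hy', b, h, form_self,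
        add_zero, h11]

theorem exists_form_eq_one {x : G} (hx : x ∈ E.hom.ker) (h1 : x ≠ 1) (hz : x ≠ E.z) :
    ∃ y ∈ E.hom.ker, form x y = 1 := by
  by_contra! h
  rcases E.eq_of_commute hx fun y hy => form_eq_zero.1 ((zmod_two_eq _).resolve_right (h y hy))
    with h' | h'
  exacts [h1 h', hz h']

theorem conj_conj_eq {s v : G} (hn : norm s v = 1) :
    MulAut.conj s (MulAut.conj s v) = (MulAut.conj s v)⁻¹ * v⁻¹ := by
  rw [← mul_inv_rev]
  exact eq_inv_of_mul_eq_one_right hn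

/-- An element of order three fixing a non-central element of `Q`. -/
theorem exists_of_fixed {s : G} (hs : orderOf s = 3) {y : G} (hy : y ∈ E.hom.ker) (hy1 : y ≠ 1)
    (hyz : y ≠ E.z) (hsy : Commute s y) : ∃ y' v, y' ∈ E.hom.ker ∧ v ∈ E.hom.ker ∧
      Commute s y' ∧ form y y' = 1 ∧ form v y = 0 ∧ form v y' = 0 ∧ quad v = 1 ∧
      form v (MulAut.conj s v) = 1 ∧ norm s v = 1 := by
  have hs3 : s ^ 3 = 1 := by rw [← hs, pow_orderOf_eq_one]
  have hsy' := conj_eq_self.2 hsy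
  obtain ⟨w, hw, hyw⟩ := E.exists_form_eq_one hy hy1 hyz
  have hfix : ∀ {a x : G}, MulAut.conj s a = a → form a (MulAut.conj s x) = form a x := by
    intro a x ha
    conv_lhs => rw [← ha]
    exact form_conj _ _ _
  -- All conjugates of `w` pair with the fixed `y` to 1, so the norm pairs to `1 + 1 + 1 = 1` and is
  -- itself fixed.
  set y' := norm s w with hy'
  have hy'm : y' ∈ E.hom.ker := E.norm_mem s hw
  have hsy'' : Commute s y' := E.commute_norm hs3 hw
  have hcy' := conj_eq_self.2 hsy''
  have hyy' : form y y' = 1 := by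
    rw [hy', E.form_norm s hw hy, hfix hsy', hfix hsy', hfix hsy', hyw]
    decide
  obtain ⟨x, hx, hsx⟩ := E.exists_not_commute hs
  obtain ⟨c, hc, hvy, hvy'⟩ := E.exists_mul_orthogonal hy hy'm hyy' hx
  have hcs : ∀ {a : G}, Commute a y → Commute a y' → ∀ {c}, c ∈ Subgroup.closure {y, y'} →
      Commute a c := by
    intro a h1 h2 c hc
    have : Subgroup.closure {y, y'} ≤ Subgroup.centralizer {a} := by
      rw [Subgroup.closure_le]
      rintro b (rfl | rfl) <;> rw [SetLike.mem_coe, Subgroup.mem_centralizer_singleton_iff]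
      exacts [h1.symm.eq, h2.symm.eq]
    exact (Subgroup.mem_centralizer_singleton_iff.1 (this hc)).symm
  have hcQ : ∀ {c}, c ∈ Subgroup.closure {y, y'} → c ∈ E.hom.ker := by
    intro c hc
    have : Subgroup.closure {y, y'} ≤ E.hom.ker := by
      rw [Subgroup.closure_le]
      rintro b (rfl | rfl)
      exacts [hy, hy'm]
    exact this hc
  set v := x * c with hvdef
  have hv : v ∈ E.hom.ker := mul_mem hx (hcQ hc)
  have hsv : ¬ Commute s v := fun h => hsx (by
    have := h.mul_right (hcs hsy hsy'' hc).inv_right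
    rwa [hvdef, mul_inv_cancel_right] at this)
  have hv1 : v ≠ 1 := by rintro h; exact hsv (h ▸ Commute.one_right s)
  have hvz : v ≠ E.z := by rintro h; exact hsv (h ▸ E.commute_z s)
  set v₁ := MulAut.conj s v with hv₁
  have hv₁m : v₁ ∈ E.hom.ker := E.conj_mem s hv
  have hv₁y : form v₁ y = 0 := by rw [hv₁, ← hsy', form_conj, hvy]
  have hv₁y' : form v₁ y' = 0 := by rw [hv₁, ← hcy', form_conj, hvy']
  -- The complement of the fixed pair is a plane. If `v` and its conjugate were orthogonal in it,
  -- they would agree modulo `⟨z⟩`, and `s` would commute with `v`.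
  have hvv₁ : form v v₁ = 1 := by
    refine (zmod_two_eq _).resolve_left fun h0 => ?_
    obtain ⟨t, ht, hvt⟩ := E.exists_form_eq_one hv hv1 hvz
    obtain ⟨d, hd, hty, hty'⟩ := E.exists_mul_orthogonal hy hy'm hyy' ht
    have hvd : form v (t * d) = 1 := by
      rw [E.form_mul_right ht (hcQ hd) hv, hvt,
        form_eq_zero.2 (hcs (form_eq_zero.1 hvy) (form_eq_zero.1 hvy') hd), add_zero]
    have htd := mul_mem ht (hcQ hd)
    have key : ∀ a ∈ E.hom.ker, form a y = 0 → form a y' = 0 → form a v = 0 →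
        form a (t * d) = 0 → a = 1 ∨ a = E.z := fun a ha =>
      E.eq_of_form_eq_zero hy hy'm hv htd hyy' hvd hvy hvy' hty hty' ha
    have h0' : form v₁ v = 0 := by rw [E.form_symm hv₁m hv, h0]
    rcases zmod_two_eq (form v₁ (t * d)) with hh | hh
    · rcases key v₁ hv₁m hv₁y hv₁y' h0' hh with h | h
      · rw [hv₁, map_eq_one_iff _ (MulAut.conj s).injective] at h
        exact hv1 h
      · rw [hv₁, ← E.conj_z s] at h
        exact hvz ((MulAut.conj s).injective h)
    · rcases key (v₁ * v) (mul_mem hv₁m hv)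
        (by rw [E.form_mul_left hv₁m hv hy, hv₁y, hvy, add_zero])
        (by rw [E.form_mul_left hv₁m hv hy'm, hv₁y', hvy', add_zero])
        (by rw [E.form_mul_left hv₁m hv hv, h0', form_self, add_zero])
        (by rw [E.form_mul_left hv₁m hv htd, hh, hvd]; decide) with h | h
      all_goals
        refine hsv (commute_of_commutator_mem E.z_mem_center E.orderOf_z hs3 ?_)
        have e : ⁅s, v⁆ = v₁ * v⁻¹ := by rw [commutatorElement_def, hv₁, MulAut.conj_apply]
        rw [e, E.mem_zpowers]
        rcases E.mul_self_mem (inv_mem hv) with hh | hh <;>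
          rw [← mul_one v⁻¹, ← mul_inv_cancel v⁻¹, ← mul_assoc v⁻¹, hh, inv_inv]
        · rw [one_mul]; simp [h]
        · rw [(E.commute_z v).symm.eq, ← mul_assoc, h]; simp [E.z_mul_z]
  have hv₂ := E.conj_mem s hv₁m
  have hv₁v₂ : form v₁ (MulAut.conj s v₁) = 1 := by rw [hv₁, form_conj]; exact hvv₁
  have hv₂v : form v (MulAut.conj s v₁) = 1 := by
    rw [E.form_symm hv hv₂, hv₁, ← form_conj s, conj_conj_conj hs3,
      ← hvv₁]
  -- The norm is fixed by `s` and orthogonal to `y`, `y'`, `v` and `v₁`, which span everything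
  -- modulo the centre.
  have hn : norm s v = 1 ∨ norm s v = E.z := by
    have hnm := E.norm_mem s hv
    have hcn := conj_eq_self.2 (E.commute_norm hs3 hv)
    have h1 : ∀ a ∈ E.hom.ker, MulAut.conj s a = a → form v a = 0 → form (norm s v) a = 0 := by
      intro a ha hsa h
      rw [E.form_symm hnm ha, E.form_norm s hv ha, hfix hsa, hfix hsa, hfix hsa,
        E.form_symm ha hv, h]
      decide
    have h2 : form v (norm s v) = 0 := by
      rw [E.form_norm s hv hv, form_self, ← hv₁, hvv₁, hv₂v]
      decide
    refine E.eq_of_form_eq_zero hy hy'm hv hv₁m hyy' hvv₁ hvy hvy' hv₁y hv₁y' hnm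
      (h1 y hy hsy' hvy) (h1 y' hy'm hcy' hvy') ?_ ?_
    · rw [E.form_symm hnm hv, h2]
    · rw [hfix hcn, E.form_symm hnm hv, h2]
  have hq : quad v = 1 := by rw [E.quad_eq_form_of_norm hv hn]; exact hvv₁
  rcases E.exists_norm_eq_one hn with h | h
  · exact ⟨y', v, hy'm, hv, hsy'', hyy', hvy, hvy', hq, hvv₁, h⟩
  · refine ⟨y', v * E.z, hy'm, mul_mem hv E.z_mem_ker, hsy'', hyy', ?_, ?_, ?_, ?_, h⟩
    · rw [E.form_mul_z hv hy, hvy]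
    · rw [E.form_mul_z hv hy'm, hvy']
    · rw [E.quad_mul_z hv, hq]
    · rw [map_mul, E.conj_z, E.form_mul_z hv (mul_mem hv₁m E.z_mem_ker),
        E.form_mul_z_right hv hv₁m, hvv₁]

end ExtraspecialData

/-! ### Finding the generators of the three groups. -/

namespace ExtraspecialData

variable {G : Type*} [Group G] (E : ExtraspecialData G)

open SmallGroups

theorem commutator_conj (s x : G) : ⁅s, x⁆ = MulAut.conj s x * x⁻¹ := by
  rw [commutatorElement_def, MulAut.conj_apply]

theorem commutator_z (x : G) : ⁅x, E.z⁆ = 1 :=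
  commutatorElement_eq_one_iff_commute.2 (E.commute_z x)

theorem commutator_eq_one_of_form {x y : G} (h : form x y = 0) : ⁅x, y⁆ = 1 :=
  commutatorElement_eq_one_iff_commute.2 (form_eq_zero.1 h)

theorem quad_sq_eq_z {x : G} (hx : x ∈ E.hom.ker) (h : quad x = 1) : x ^ 2 = E.z := by
  rw [pow_two, (E.quad_eq_one hx).1 h]

theorem quad_sq_eq_one {x : G} (h : quad x = 0) : x ^ 2 = 1 := by
  rw [pow_two, quad_eq_zero.1 h]

theorem inv_eq_self_of_quad {x : G} (h : quad x = 0) : x⁻¹ = x :=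
  inv_eq_of_mul_eq_one_right (quad_eq_zero.1 h)

/-- The relations common to the first two groups. -/
theorem relations_of_fixed {s y y' v : G} (hs : s ^ 3 = 1) (hv : v ∈ E.hom.ker)
    (hsy : Commute s y) (hsy' : Commute s y') (hvy : form v y = 0) (hvy' : form v y' = 0)
    (hq : quad v = 1) (hvv : form v (MulAut.conj s v) = 1) (hn : norm s v = 1) :
    (s ^ 3 = 1 ∧ ⁅y, s⁆ = 1 ∧ ⁅y', s⁆ = 1) ∧
    (MulAut.conj s v ^ 2 = E.z ∧ ⁅y, MulAut.conj s v⁆ = 1 ∧ ⁅y', MulAut.conj s v⁆ = 1 ∧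
      ⁅s, MulAut.conj s v⁆ = v⁻¹) ∧
    (v ^ 2 = E.z ∧ ⁅y, v⁆ = 1 ∧ ⁅y', v⁆ = 1 ∧ ⁅s, v⁆ = MulAut.conj s v * v⁻¹ ∧
      ⁅MulAut.conj s v, v⁆ = E.z) ∧
    (E.z ^ 2 = 1 ∧ ⁅y, E.z⁆ = 1 ∧ ⁅y', E.z⁆ = 1 ∧ ⁅s, E.z⁆ = 1 ∧ ⁅MulAut.conj s v, E.z⁆ = 1 ∧
      ⁅v, E.z⁆ = 1) := by
  have h1 := E.conj_mem s hv
  have hfix : ∀ {a : G}, Commute s a → form v a = 0 →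
      Commute a v ∧ Commute a (MulAut.conj s v) := by
    intro a ha hva
    refine ⟨(form_eq_zero.1 hva).symm, ?_⟩
    rw [← form_conj s, conj_eq_self.2 ha] at hva
    exact (form_eq_zero.1 hva).symm
  have hc := fun {a b : G} => (commutatorElement_eq_one_iff_commute (g₁ := a) (g₂ := b)).2
  have hvz : ⁅MulAut.conj s v, v⁆ = E.z := by
    rw [← E.form_eq_one h1 hv, ← E.form_symm hv h1, hvv]
  have hv2 := E.quad_sq_eq_z hv hq
  have h12 : MulAut.conj s v ^ 2 = E.z := E.quad_sq_eq_z h1 (by rw [quad_conj, hq])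
  refine ⟨⟨hs, hc hsy.symm, hc hsy'.symm⟩, ⟨h12, hc (hfix hsy hvy).2, hc (hfix hsy' hvy').2, ?_⟩,
    ⟨hv2, hc (hfix hsy hvy).1, hc (hfix hsy' hvy').1, commutator_conj s v, hvz⟩,
    by rw [pow_two, E.z_mul_z], E.commutator_z _, E.commutator_z _, E.commutator_z _,
    E.commutator_z _, E.commutator_z _⟩
  have e : v * MulAut.conj s v = E.z * (MulAut.conj s v * v) := by
    rw [← (E.form_eq_one hv h1).1 hvv, commutatorElement_def]
    group
  have e' : MulAut.conj s v * (v * MulAut.conj s v) = v := by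
    rw [e, ← mul_assoc, (E.commute_z _).eq, mul_assoc, ← mul_assoc (MulAut.conj s v), ← pow_two,
      h12, ← mul_assoc, E.z_mul_z, one_mul]
  rw [commutator_conj, conj_conj_eq hn, ← mul_inv_rev, ← mul_inv_rev, e']

/-- A square-trivial hyperbolic pair fixed by `s`, unless the fixed pair generates a quaternion
group. -/
theorem exists_fixed_pair {s y y' v : G} (hy : y ∈ E.hom.ker) (hy' : y' ∈ E.hom.ker)
    (hv : v ∈ E.hom.ker) (hsy : Commute s y) (hsy' : Commute s y') (h : form y y' = 1)
    (hvy : form v y = 0) (hvy' : form v y' = 0) (hq : ¬ (quad y = 1 ∧ quad y' = 1)) :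
    ∃ a b, a ∈ E.hom.ker ∧ b ∈ E.hom.ker ∧ Commute s a ∧ Commute s b ∧ form a b = 1 ∧
      form v a = 0 ∧ form v b = 0 ∧ quad a = 0 ∧ quad b = 0 := by
  have hm := mul_mem hy hy'
  have hsm := hsy.mul_right hsy'
  have hvm : form v (y * y') = 0 := by rw [E.form_mul_right hy hy' hv, hvy, hvy', add_zero]
  have h' : form y' y = 1 := by rw [← E.form_symm hy hy', h]
  have h11 : (1 : ZMod 2) + 1 = 0 := by decide
  -- Unless `quad y = quad y' = 1`, at least two of `y`, `y'`, `y * y'` have trivial square, and any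
  -- two of these form a hyperbolic pair.
  rcases zmod_two_eq (quad y) with a | a <;> rcases zmod_two_eq (quad y') with b | b
  · exact ⟨y, y', hy, hy', hsy, hsy', h, hvy, hvy', a, b⟩
  · exact ⟨y, y * y', hy, hm, hsy, hsm, by rw [E.form_mul_right hy hy' hy, form_self, h, zero_add],
      hvy, hvm, a, by rw [E.quad_mul hy hy', a, b, h, zero_add, h11]⟩
  · exact ⟨y', y * y', hy', hm, hsy', hsm, by rw [E.form_mul_right hy hy' hy', form_self, h',
      add_zero], hvy', hvm, b, by rw [E.quad_mul hy hy', a, b, h, add_zero, h11]⟩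
  · exact absurd ⟨a, b⟩ hq

/-- If `quad` were 1 on every non-central element, sums of two of the independent vectors `u i`
would force `form (u i) (u j) = 1`, and a sum of three would give `3 + 3 = 0`. -/
theorem exists_quad_eq_zero : ∃ v ∈ E.hom.ker, ∃ t ∈ E.hom.ker, form v t = 1 ∧ quad v = 0 := by
  have hne : ∀ {i j : Fin 2 ⊕ Fin 2}, i ≠ j → form (E.u j) (E.w i) = 0 := fun {i j} h => by
    rw [E.form_u_w, if_neg h.symm]
  have heq : ∀ i, form (E.u i) (E.w i) = 1 := fun i => by rw [E.form_u_w, if_pos rfl]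
  by_contra! hcon
  have hq : ∀ v ∈ E.hom.ker, ∀ i, form v (E.w i) = 1 → quad v = 1 := fun v hv i h =>
    (zmod_two_eq _).resolve_left (hcon v hv _ (E.w_mem i) h)
  have hu := E.u_mem
  have hqu : ∀ i, quad (E.u i) = 1 := fun i => hq _ (hu i) i (heq i)
  have hf : ∀ i j, i ≠ j → form (E.u i) (E.u j) = 1 := by
    intro i j hij
    have := hq _ (mul_mem (hu i) (hu j)) i (by
      rw [E.form_mul_left (hu i) (hu j) (E.w_mem i), heq, hne hij, add_zero])
    rw [E.quad_mul (hu i) (hu j), hqu, hqu] at this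
    have key : ∀ a : ZMod 2, 1 + 1 + a = 1 → a = 1 := by decide
    exact key _ this
  have := hq _ (mul_mem (mul_mem (hu (.inl 0)) (hu (.inl 1))) (hu (.inr 0))) (.inl 0) (by
    rw [E.form_mul_left (mul_mem (hu _) (hu _)) (hu _) (E.w_mem _),
      E.form_mul_left (hu _) (hu _) (E.w_mem _), heq, hne (by simp), hne (by simp)]; rfl)
  rw [E.quad_mul (mul_mem (hu _) (hu _)) (hu _), E.quad_mul (hu _) (hu _),
    E.form_mul_left (hu _) (hu _) (hu _), hqu, hqu, hqu, hf _ _ (by simp), hf _ _ (by simp),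
    hf _ _ (by simp)] at this
  revert this
  decide

theorem relations_of_norm {s v : G} (hq : quad v = 0)
    (hvv : form v (MulAut.conj s v) = 0) (hn : norm s v = 1) :
    MulAut.conj s v ^ 2 = 1 ∧ ⁅s, MulAut.conj s v⁆ = v ∧ v ^ 2 = 1 ∧
      ⁅s, v⁆ = MulAut.conj s v * v ∧ ⁅MulAut.conj s v, v⁆ = 1 := by
  have hq1 : quad (MulAut.conj s v) = 0 := by rw [quad_conj, hq]
  have hc : Commute (MulAut.conj s v) v := (form_eq_zero.1 hvv).symm
  refine ⟨quad_sq_eq_one hq1, ?_, quad_sq_eq_one hq, ?_,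
    commutatorElement_eq_one_iff_commute.2 hc⟩
  · rw [commutator_conj, conj_conj_eq hn, inv_eq_self_of_quad hq1, inv_eq_self_of_quad hq, hc.eq,
      mul_assoc, quad_eq_zero.1 hq1, mul_one]
  · rw [commutator_conj, inv_eq_self_of_quad hq]

/-- All norms are central, so `quad x = form x xˢ`: a vector with trivial square is orthogonal to
its conjugate, and the two span a totally singular plane. Two such planes in duality give the
generators. -/
theorem relations_of_no_fixed {s : G} (hs : s ^ 3 = 1)
    (hfix : ∀ y ∈ E.hom.ker, Commute s y → y = 1 ∨ y = E.z) :
    ∃ f : Fin 6 → G, f 5 = E.z ∧ ∀ r ∈ rels96_204, FreeGroup.lift f r = 1 := by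
  have hnorm : ∀ x ∈ E.hom.ker, norm s x = 1 ∨ norm s x = E.z := fun x hx =>
    hfix _ (E.norm_mem s hx) (E.commute_norm hs hx)
  have hnf : ∀ x ∈ E.hom.ker, ∀ y ∈ E.hom.ker, form y x + form y (MulAut.conj s x) +
      form y (MulAut.conj s (MulAut.conj s x)) = 0 := by
    intro x hx y hy
    rw [← E.form_norm s hx hy]
    rcases hnorm x hx with h | h <;> rw [h]
    · exact form_eq_zero.2 (Commute.one_right y)
    · exact E.form_z y
  have hone : ∀ x ∈ E.hom.ker, ∃ x' ∈ E.hom.ker, norm s x' = 1 ∧ quad x' = quad x ∧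
      (∀ y ∈ E.hom.ker, form y x' = form y x) ∧ 
      (∀ y ∈ E.hom.ker, form y (MulAut.conj s x') = form y (MulAut.conj s x)) := by
    intro x hx
    rcases E.exists_norm_eq_one (hnorm x hx) with h | h
    · exact ⟨x, hx, h, rfl, fun _ _ => rfl, fun _ _ => rfl⟩
    · exact ⟨x * E.z, mul_mem hx E.z_mem_ker, h, E.quad_mul_z hx,
        fun y hy => E.form_mul_z_right hy hx, fun y hy => by
          rw [map_mul, E.conj_z, E.form_mul_z_right hy (E.conj_mem s hx)]⟩
  obtain ⟨v₀, hv₀, t, ht, hvt, hqv₀⟩ := E.exists_quad_eq_zero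
  obtain ⟨v, hv, hnv, hqv, hv1, -⟩ := hone v₀ hv₀
  rw [hqv₀] at hqv
  have hvt' : form v t = 1 := by rw [E.form_symm hv ht, hv1 t ht, E.form_symm ht hv₀, hvt]
  obtain ⟨w, hw, hvw, hqw⟩ : ∃ w ∈ E.hom.ker, form v w = 1 ∧ quad w = 0 := by
    rcases zmod_two_eq (quad t) with h | h
    · exact ⟨t, ht, hvt', h⟩
    · refine ⟨t * v, mul_mem ht hv, by rw [E.form_mul_right ht hv hv, hvt', form_self, add_zero], ?_⟩
      rw [E.quad_mul ht hv, h, hqv, E.form_symm ht hv, hvt']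
      decide
  -- The values of `form v` on the three conjugates of `w` sum to zero and are not all zero, so
  -- exactly one vanishes; that conjugate is taken.
  obtain ⟨w', hw', hqw', h0, h1, h2⟩ : ∃ w ∈ E.hom.ker, quad w = 0 ∧ form v w = 0 ∧
      form v (MulAut.conj s w) = 1 ∧ form v (MulAut.conj s (MulAut.conj s w)) = 1 := by
    have hsum := hnf w hw v hv
    have hs1 := E.conj_mem s hw
    rcases zmod_two_eq (form v (MulAut.conj s w)) with h | h
    · refine ⟨MulAut.conj s w, hs1, by rw [quad_conj, hqw], h, ?_, by rw [conj_conj_conj hs, hvw]⟩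
      rw [hvw, h] at hsum
      have key : ∀ a : ZMod 2, 1 + 0 + a = 0 → a = 1 := by decide
      exact key _ hsum
    · refine ⟨MulAut.conj s (MulAut.conj s w), E.conj_mem s hs1, by rw [quad_conj, quad_conj, hqw],
        ?_, by rw [conj_conj_conj hs, hvw], by rw [conj_conj_conj hs, h]⟩
      rw [hvw, h] at hsum
      have key : ∀ a : ZMod 2, 1 + 1 + a = 0 → a = 0 := by decide
      exact key _ hsum
  obtain ⟨x, hx, hnx, hqx, hx0, hx1⟩ := hone w' hw'
  have hvs := E.conj_mem s hv
  rw [hqw'] at hqx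
  have e1 := relations_of_norm hqv (by rw [← E.quad_eq_form_of_norm hv (Or.inl hnv), hqv]) hnv
  have e2 := relations_of_norm hqx (by rw [← E.quad_eq_form_of_norm hx (Or.inl hnx), hqx]) hnx
  refine ⟨![s, MulAut.conj s v, v, MulAut.conj s x, x, E.z], rfl, (lift_rels96_204 _).2 ?_⟩
  have a1 : ⁅MulAut.conj s v, MulAut.conj s x⁆ = 1 := commutator_eq_one_of_form (by
    rw [form_conj, hx0 v hv, h0])
  have a2 : ⁅v, x⁆ = 1 := commutator_eq_one_of_form (by rw [hx0 v hv, h0])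
  have a3 : ⁅v, MulAut.conj s x⁆ = E.z := (E.form_eq_one hv (E.conj_mem s hx)).1 (by
    rw [hx1 v hv, h1])
  have a4 : ⁅MulAut.conj s v, x⁆ = E.z := (E.form_eq_one hvs hx).1 (by
    rw [hx0 _ hvs, ← form_conj s, ← form_conj s, conj_conj_conj hs, h2])
  exact ⟨hs, ⟨e1.1, e1.2.1⟩, ⟨e1.2.2.1, e1.2.2.2.1, e1.2.2.2.2⟩, ⟨e2.1, e2.2.1, a1, a3⟩,
    ⟨e2.2.2.1, e2.2.2.2.1, a4, a2, e2.2.2.2.2⟩, by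
      rw [show (![s, MulAut.conj s v, v, MulAut.conj s x, x, E.z] 5 = E.z) from rfl, pow_two,
        E.z_mul_z],
    E.commutator_z _, E.commutator_z _, E.commutator_z _, E.commutator_z _, E.commutator_z _⟩

/-- The cases are whether `s` fixes a non-central element of the kernel and, if so, whether the
fixed pair generates a quaternion group. -/
theorem exists_relations : ∃ f : Fin 6 → G, f 5 = E.z ∧
    ((∀ r ∈ rels96_201, FreeGroup.lift f r = 1) ∨ (∀ r ∈ rels96_202, FreeGroup.lift f r = 1) ∨
      ∀ r ∈ rels96_204, FreeGroup.lift f r = 1) := by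
  obtain ⟨s, hs⟩ := E.exists_orderOf_eq_three
  have hs3 : s ^ 3 = 1 := by rw [← hs, pow_orderOf_eq_one]
  by_cases hfix : ∀ y ∈ E.hom.ker, Commute s y → y = 1 ∨ y = E.z
  · obtain ⟨f, hf, h⟩ := E.relations_of_no_fixed hs3 hfix
    exact ⟨f, hf, Or.inr (Or.inr h)⟩
  · push Not at hfix
    obtain ⟨y, hy, hsy, hy1, hyz⟩ := hfix
    obtain ⟨y', v, hy', hv, hsy', hyy', hvy, hvy', hq, hvv, hn⟩ :=
      E.exists_of_fixed hs hy hy1 hyz hsy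
    by_cases h : quad y = 1 ∧ quad y' = 1
    · exact ⟨![y, y', s, MulAut.conj s v, v, E.z], rfl, Or.inl ((lift_rels96_201 _).2
        ⟨⟨E.quad_sq_eq_z hy h.1, E.quad_sq_eq_z hy' h.2, (E.form_eq_one hy hy').1 hyy'⟩,
          E.relations_of_fixed hs3 hv hsy hsy' hvy hvy' hq hvv hn⟩)⟩
    · obtain ⟨a, b, ha, hb, hsa, hsb, hab, hva, hvb, hqa, hqb⟩ :=
        E.exists_fixed_pair hy hy' hv hsy hsy' hyy' hvy hvy' h
      exact ⟨![a, b, s, MulAut.conj s v, v, E.z], rfl, Or.inr (Or.inl ((lift_rels96_202 _).2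
        ⟨⟨quad_sq_eq_one hqa, quad_sq_eq_one hqb, (E.form_eq_one ha hb).1 hab⟩,
          E.relations_of_fixed hs3 hv hsa hsb hva hvb hq hvv hn⟩))⟩

end ExtraspecialData

/-! ### Explicit models of order 96 given by bilinear cocycles. -/

/-- The elementary abelian group of order `16`, written multiplicatively in coordinates. -/
abbrev BoolVec : Type := (Bool × Bool) × (Bool × Bool)

namespace BoolVec

def add (v w : BoolVec) : BoolVec :=
  ((v.1.1 ^^ w.1.1, v.1.2 ^^ w.1.2), (v.2.1 ^^ w.2.1, v.2.2 ^^ w.2.2))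

def zero : BoolVec := ((false, false), (false, false))

/-- The powers of an automorphism of order three of the Klein four-group. -/
def rotate (k : Fin 3) (p : Bool × Bool) : Bool × Bool :=
  match k with
  | 0 => p
  | 1 => (p.1 ^^ p.2, p.1)
  | 2 => (p.2, p.1 ^^ p.2)

end BoolVec

/-- Data defining an extension of a cyclic group of order three, acting on `BoolVec` through `S`,
by the central extension of `BoolVec` with cocycle `β`. -/
structure CocycleData where
  S : Fin 3 → BoolVec → BoolVec
  β : BoolVec → BoolVec → Bool
  S_add : ∀ k v w, S k (v.add w) = (S k v).add (S k w)
  S_S : ∀ k l v, S k (S l v) = S (k + l) v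
  S_first : ∀ v, S 0 v = v
  S_zero : ∀ k, S k .zero = .zero
  β_S : ∀ k v w, β (S k v) (S k w) = β v w
  β_add_left : ∀ v v' w, β (v.add v') w = (β v w ^^ β v' w)
  β_add_right : ∀ v w w', β v (w.add w') = (β v w ^^ β v w')
  β_zero_left : ∀ v, β .zero v = false
  β_zero_right : ∀ v, β v .zero = false

namespace CocycleData

/-- The group defined by cocycle data. -/
@[ext]
structure Model (D : CocycleData) where
  vec : BoolVec
  sign : Bool
  rot : Fin 3

variable (D : CocycleData)

instance : DecidableEq D.Model := fun x y =>
  decidable_of_iff (x.rot = y.rot ∧ x.sign = y.sign ∧ x.vec = y.vec)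
    ⟨fun ⟨h₁, h₂, h₃⟩ => Model.ext h₃ h₂ h₁, fun h => h ▸ ⟨rfl, rfl, rfl⟩⟩

/-- The elements of the model as triples. -/
def modelEquiv : BoolVec × Bool × Fin 3 ≃ D.Model where
  toFun x := ⟨x.1, x.2.1, x.2.2⟩
  invFun x := (x.vec, x.sign, x.rot)
  left_inv _ := rfl
  right_inv _ := rfl

instance : Fintype D.Model := Fintype.ofEquiv _ D.modelEquiv

theorem vec_add_assoc (u v w : BoolVec) : (u.add v).add w = u.add (v.add w) := by
  simp [BoolVec.add]

theorem vec_add_self (v : BoolVec) : v.add v = .zero := by simp [BoolVec.add, BoolVec.zero]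

theorem vec_zero_add (v : BoolVec) : BoolVec.add .zero v = v := by simp [BoolVec.add, BoolVec.zero]

theorem vec_add_zero (v : BoolVec) : v.add .zero = v := by simp [BoolVec.add, BoolVec.zero]

instance : Mul D.Model where
  mul x y :=
    ⟨x.vec.add (D.S x.rot y.vec), (x.sign ^^ y.sign) ^^ D.β x.vec (D.S x.rot y.vec),
      x.rot + y.rot⟩

instance : One D.Model where
  one := ⟨.zero, false, 0⟩

instance : Inv D.Model where
  inv x := ⟨D.S (-x.rot) x.vec, x.sign ^^ D.β x.vec x.vec, -x.rot⟩

theorem mul_def (x y : D.Model) : x * y =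
    ⟨x.vec.add (D.S x.rot y.vec), (x.sign ^^ y.sign) ^^ D.β x.vec (D.S x.rot y.vec),
      x.rot + y.rot⟩ := rfl

theorem one_def : (1 : D.Model) = ⟨.zero, false, 0⟩ := rfl

theorem inv_def (x : D.Model) :
    x⁻¹ = ⟨D.S (-x.rot) x.vec, x.sign ^^ D.β x.vec x.vec, -x.rot⟩ := rfl

/-- Associativity is the cocycle identity: bilinearity and invariance of `β` under the rotations
reduce both sides to the same three values of `β`. -/
instance : Group D.Model where
  mul_assoc := by
    rintro ⟨u, d, k⟩ ⟨v, e, l⟩ ⟨w, f, m⟩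
    simp only [mul_def]
    refine Model.ext ?_ ?_ (add_assoc _ _ _)
    · simp only [D.S_add, D.S_S, vec_add_assoc]
    · simp only [D.S_add, D.S_S, D.β_add_left, D.β_add_right]
      rw [← D.β_S k v, D.S_S]
      generalize D.β u (D.S k v) = b₁
      generalize D.β u (D.S (k + l) w) = b₂
      generalize D.β (D.S k v) (D.S (k + l) w) = b₃
      revert d e f b₁ b₂ b₃
      decide
  one_mul := by
    rintro ⟨v, e, k⟩
    simp [mul_def, one_def, D.S_first, vec_zero_add, D.β_zero_left]
  mul_one := by
    rintro ⟨v, e, k⟩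
    simp [mul_def, one_def, D.S_zero, vec_add_zero, D.β_zero_right]
  inv_mul_cancel := by
    rintro ⟨v, e, k⟩
    have h : ∀ a b : Bool, (((a ^^ b) ^^ a) ^^ b) = false := by decide
    simp only [mul_def, inv_def, one_def, vec_add_self, D.β_S, h, neg_add_cancel]

theorem card_model : Nat.card D.Model = 96 := by
  rw [← Nat.card_congr D.modelEquiv, Nat.card_eq_fintype_card]
  simp [BoolVec]

/-- The central involution. -/
def zeta : D.Model := ⟨.zero, true, 0⟩

end CocycleData

namespace SmallGroups

open BoolVec

set_option maxRecDepth 4000 in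
/-- The central product of `SL(2,3)` with a quaternion group, or with a dihedral group,
according to whether `q` holds. -/
def centralProductData (q : Bool) : CocycleData where
  S k v := (v.1, rotate k v.2)
  -- `β v v` is the square of `v`. On the first two coordinates it is `ab`, plus `a + b` when `q`
  -- holds: dihedral or quaternion. On the last two it is always the quaternion form.
  β v w :=
    (((q && ((v.1.1 && w.1.1) ^^ (v.1.2 && w.1.2))) ^^ (v.1.2 && w.1.1))) ^^
      ((v.2.1 && w.2.1) ^^ (v.2.2 && w.2.2) ^^ (v.2.2 && w.2.1))
  S_add := by decide +kernel
  S_S := by decide +kernel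
  S_first := by decide +kernel
  S_zero := by decide +kernel
  β_S := by cases q <;> decide +kernel
  β_add_left := by cases q <;> decide +kernel
  β_add_right := by cases q <;> decide +kernel
  β_zero_left := by cases q <;> decide +kernel
  β_zero_right := by cases q <;> decide +kernel

/-- The extra-special group of order `32` and plus type, extended by an automorphism of order
three. -/
def plusTypeData : CocycleData where
  S k v := (rotate k v.1, rotate k v.2)
  -- The two coordinate planes are totally singular and dual, the first coordinate pairing with the
  -- fourth and the second with the third.
  β v w := (v.2.1 && w.1.2) ^^ (v.2.2 && w.1.1)
  S_add := by decide +kernel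
  S_S := by decide +kernel
  S_first := by decide +kernel
  S_zero := by decide +kernel
  β_S := by decide +kernel
  β_add_left := by decide +kernel
  β_add_right := by decide +kernel
  β_zero_left := by decide +kernel
  β_zero_right := by decide +kernel

/-- The images in the model of the generators of the first two groups. -/
def centralProductGen (q : Bool) : Fin 6 → (centralProductData q).Model :=
  ![⟨((true, false), (false, false)), false, 0⟩, ⟨((false, true), (false, false)), false, 0⟩,
    ⟨zero, false, 1⟩, ⟨((false, false), (true, false)), false, 0⟩,
    ⟨((false, false), (false, true)), false, 0⟩, (centralProductData q).zeta]

/-- The images in the model of the generators of the third group. -/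
def plusTypeGen : Fin 6 → plusTypeData.Model :=
  ![⟨zero, false, 1⟩, ⟨((true, false), (false, false)), false, 0⟩,
    ⟨((false, true), (false, false)), false, 0⟩, ⟨((false, false), (true, false)), false, 0⟩,
    ⟨((false, false), (false, true)), false, 0⟩, plusTypeData.zeta]

theorem lift_centralProductGen_true :
    ∀ r ∈ rels96_201, FreeGroup.lift (centralProductGen true) r = 1 := by
  rw [lift_rels96_201]
  decide +kernel

theorem lift_centralProductGen_false :
    ∀ r ∈ rels96_202, FreeGroup.lift (centralProductGen false) r = 1 := by
  rw [lift_rels96_202]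
  decide +kernel

theorem lift_plusTypeGen : ∀ r ∈ rels96_204, FreeGroup.lift plusTypeGen r = 1 := by
  rw [lift_rels96_204]
  decide +kernel

end SmallGroups

/-! ### Upper bounds for the orders of the presented groups. -/

/-- Adjoining to a finite subgroup an element that normalizes it and has a power in it. -/
theorem card_closure_insert_le {G : Type*} [Group G] {x : G} {S : Set G} {p m : ℕ} (hp : 0 < p)
    (hS : Finite (Subgroup.closure S) ∧ Nat.card (Subgroup.closure S) ≤ m)
    (hpow : x ^ p ∈ Subgroup.closure S) (hx : ∀ s ∈ S, ⁅x, s⁆ ∈ Subgroup.closure S) :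
    Finite (Subgroup.closure (insert x S)) ∧
      Nat.card (Subgroup.closure (insert x S)) ≤ p * m := by
  obtain ⟨hfin, hcard⟩ := hS
  rw [Set.insert_eq, Set.union_comm, Subgroup.closure_union, ← Subgroup.zpowers_eq_closure]
  set K := Subgroup.closure S with hK
  have hconj : K ≤ K.comap (MulAut.conj x).toMonoidHom := by
    rw [hK, Subgroup.closure_le]
    intro s hs
    have := mul_mem (hx s hs) (Subgroup.subset_closure hs)
    rwa [commutatorElement_def, inv_mul_cancel_right] at this
  have : Finite (K : Set G) := hfin
  have hnorm : Subgroup.zpowers x ≤ Subgroup.normalizer (K : Set G) :=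
    Subgroup.zpowers_le.2 (Subgroup.mem_normalizer_fintype fun k hk => hconj hk)
  -- Every element is `k * x ^ i` with `k` in `K` and `0 ≤ i < p`, the rest of the exponent being
  -- absorbed into `K` through `x ^ p`.
  have hf : Function.Surjective fun a : K × Fin p => (⟨a.1 * x ^ (a.2 : ℕ),
      mul_mem (Subgroup.mem_sup_left a.1.2)
        (Subgroup.mem_sup_right (pow_mem (Subgroup.mem_zpowers x) _))⟩ :
          (K ⊔ Subgroup.zpowers x : Subgroup G)) := by
    rintro ⟨g, hg⟩
    rw [← SetLike.mem_coe, Subgroup.coe_mul_of_right_le_normalizer_left _ _ hnorm] at hg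
    obtain ⟨k, hk, _, ⟨n, rfl⟩, rfl⟩ := hg
    have hp' : (0 : ℤ) < p := by exact_mod_cast hp
    refine ⟨(⟨k * (x ^ p) ^ (n / p), mul_mem hk (zpow_mem hpow _)⟩,
      ⟨(n % p).toNat, by have := Int.emod_lt_of_pos n hp'; omega⟩), Subtype.ext ?_⟩
    change k * (x ^ p) ^ (n / p) * x ^ (n % p).toNat = k * x ^ n
    rw [← zpow_natCast x (n % p).toNat, Int.toNat_of_nonneg (Int.emod_nonneg n hp'.ne'),
      ← zpow_natCast x p, ← zpow_mul, mul_assoc, ← zpow_add, Int.mul_ediv_add_emod]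
  refine ⟨Finite.of_surjective _ hf, (Nat.card_le_card_of_surjective _ hf).trans ?_⟩
  rw [Nat.card_prod, Nat.card_fin, mul_comm]
  exact Nat.mul_le_mul_left p hcard

/-- A group with a polycyclic generating sequence of six elements. -/
theorem card_le_of_polycyclic {G : Type*} [Group G] {x : Fin 6 → G}
    (hgen : Subgroup.closure (Set.range x) = ⊤) {p : Fin 6 → ℕ} (hp : ∀ i, 0 < p i)
    (hpow : ∀ i, x i ^ p i ∈ Subgroup.closure (x '' Set.Ioi i))
    (hcomm : ∀ i j, i < j → ⁅x i, x j⁆ ∈ Subgroup.closure (x '' Set.Ioi i)) :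
    Finite G ∧ Nat.card G ≤ ∏ i, p i := by
  have step : ∀ (i : Fin 6) (S : Set G) (m : ℕ), S = x '' Set.Ioi i →
      (Finite (Subgroup.closure S) ∧ Nat.card (Subgroup.closure S) ≤ m) →
      Finite (Subgroup.closure (insert (x i) S)) ∧
        Nat.card (Subgroup.closure (insert (x i) S)) ≤ p i * m := by
    rintro i S m rfl h
    refine card_closure_insert_le (hp i) h (hpow i) ?_
    rintro _ ⟨j, hj, rfl⟩
    exact hcomm i j hj
  have h5 := step 5 ∅ 1 (by
    rw [show Set.Ioi (5 : Fin 6) = ∅ by ext i; fin_cases i <;> simp]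
    simp) (by
    rw [Subgroup.closure_empty]
    exact ⟨inferInstance, by simp⟩)
  rw [insert_empty_eq, mul_one] at h5
  have h := step 0 {x 1, x 2, x 3, x 4, x 5} _ ?_ <| step 1 {x 2, x 3, x 4, x 5} _ ?_ <|
    step 2 {x 3, x 4, x 5} _ ?_ <| step 3 {x 4, x 5} _ ?_ <| step 4 {x 5} _ ?_ h5
  rotate_left
  · rw [show Set.Ioi (0 : Fin 6) = {1, 2, 3, 4, 5} by ext i; fin_cases i <;> simp]
    simp [Set.image_insert_eq]
  · rw [show Set.Ioi (1 : Fin 6) = {2, 3, 4, 5} by ext i; fin_cases i <;> simp]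
    simp [Set.image_insert_eq]
  · rw [show Set.Ioi (2 : Fin 6) = {3, 4, 5} by ext i; fin_cases i <;> simp]
    simp [Set.image_insert_eq]
  · rw [show Set.Ioi (3 : Fin 6) = {4, 5} by ext i; fin_cases i <;> simp]
    simp [Set.image_insert_eq]
  · rw [show Set.Ioi (4 : Fin 6) = {5} by ext i; fin_cases i <;> simp]
    simp
  have hrange : (insert (x 0) {x 1, x 2, x 3, x 4, x 5} : Set G) = Set.range x := by
    ext g
    simp [Fin.exists_fin_succ, eq_comm]
  rw [hrange, hgen, Subgroup.card_top] at h
  refine ⟨(Subgroup.topEquiv (G := G)).toEquiv.finite_iff.1 h.1, h.2.trans_eq ?_⟩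
  simp [Fin.prod_univ_succ]

namespace SmallGroups

theorem closure_range_of (rels : Set (FreeGroup (Fin 6))) :
    Subgroup.closure (Set.range fun i => (PresentedGroup.of i : PresentedGroup rels)) = ⊤ :=
  PresentedGroup.closure_range_of rels

theorem lift_of_eq_one {rels : Set (FreeGroup (Fin 6))} (r) (hr : r ∈ rels) :
    FreeGroup.lift (fun i => (PresentedGroup.of i : PresentedGroup rels)) r = 1 := by
  have h : FreeGroup.lift (fun i => (PresentedGroup.of i : PresentedGroup rels)) =
      PresentedGroup.mk rels := by
    ext i
    simp [PresentedGroup.of]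
  rw [h]
  exact PresentedGroup.one_of_mem hr

theorem card_le_201 : Finite G96_201 ∧ Nat.card G96_201 ≤ 96 := by
  obtain ⟨⟨a1, a2, a3⟩, ⟨b1, b2, b3⟩, ⟨c1, c2, c3, c4⟩, ⟨d1, d2, d3, d4, d5⟩, e1, e2, e3, e4,
    e5, e6⟩ := (lift_rels96_201 _).1 (lift_of_eq_one (rels := rels96_201))
  have hm : ∀ {i j : Fin 6}, i < j → (PresentedGroup.of j : G96_201) ∈
      Subgroup.closure ((fun i => (PresentedGroup.of i : G96_201)) '' Set.Ioi i) :=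
    fun {i j} h => Subgroup.subset_closure ⟨j, h, rfl⟩
  refine card_le_of_polycyclic (closure_range_of _) (p := ![2, 2, 3, 2, 2, 2]) (by decide) ?_ ?_
  · intro i
    fin_cases i <;> simp [a1, a2, b1, c1, d1, e1, hm]
  · intro i j hij
    fin_cases i <;> fin_cases j <;> first
      | simp at hij; done
      | simp [hm, mul_mem, a3, b2, b3, c2, c3, c4, d2, d3, d4, d5, e2, e3, e4, e5, e6]

theorem card_le_202 : Finite G96_202 ∧ Nat.card G96_202 ≤ 96 := by
  obtain ⟨⟨a1, a2, a3⟩, ⟨b1, b2, b3⟩, ⟨c1, c2, c3, c4⟩, ⟨d1, d2, d3, d4, d5⟩, e1, e2, e3, e4,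
    e5, e6⟩ := (lift_rels96_202 _).1 (lift_of_eq_one (rels := rels96_202))
  have hm : ∀ {i j : Fin 6}, i < j → (PresentedGroup.of j : G96_202) ∈
      Subgroup.closure ((fun i => (PresentedGroup.of i : G96_202)) '' Set.Ioi i) :=
    fun {i j} h => Subgroup.subset_closure ⟨j, h, rfl⟩
  refine card_le_of_polycyclic (closure_range_of _) (p := ![2, 2, 3, 2, 2, 2]) (by decide) ?_ ?_
  · intro i
    fin_cases i <;> simp [a1, a2, b1, c1, d1, e1, hm]
  · intro i j hij
    fin_cases i <;> fin_cases j <;> first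
      | simp at hij; done
      | simp [hm, mul_mem, a3, b2, b3, c2, c3, c4, d2, d3, d4, d5, e2, e3, e4, e5, e6]

theorem card_le_204 : Finite G96_204 ∧ Nat.card G96_204 ≤ 96 := by
  obtain ⟨a1, ⟨b1, b2⟩, ⟨c1, c2, c3⟩, ⟨d1, d2, d3, d4⟩, ⟨f1, f2, f3, f4, f5⟩, e1, e2, e3, e4,
    e5, e6⟩ := (lift_rels96_204 _).1 (lift_of_eq_one (rels := rels96_204))
  have hm : ∀ {i j : Fin 6}, i < j → (PresentedGroup.of j : G96_204) ∈
      Subgroup.closure ((fun i => (PresentedGroup.of i : G96_204)) '' Set.Ioi i) :=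
    fun {i j} h => Subgroup.subset_closure ⟨j, h, rfl⟩
  refine card_le_of_polycyclic (closure_range_of _) (p := ![3, 2, 2, 2, 2, 2]) (by decide) ?_ ?_
  · intro i
    fin_cases i <;> simp [a1, b1, c1, d1, f1, e1]
  · intro i j hij
    fin_cases i <;> fin_cases j <;> first
      | simp at hij; done
      | simp [hm, mul_mem, b2, c2, c3, d2, d3, d4, f2, f3, f4, f5, e2, e3, e4, e5, e6]

end SmallGroups

/-! ### Identifying the presented groups with their models. -/

namespace SmallGroups

/-- A presented group together with a concrete model of order `96`. -/
structure IsModel (rels : Set (FreeGroup (Fin 6))) (D : CocycleData) (x : Fin 6 → D.Model) :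
    Prop where
  relations : ∀ r ∈ rels, FreeGroup.lift x r = 1
  generates : ∀ m, m ∈ Subgroup.closure (Set.range x)
  card_le : Finite (PresentedGroup rels) ∧ Nat.card (PresentedGroup rels) ≤ 96
  last : x 5 = D.zeta
  zeta_mem : ∀ N : Subgroup D.Model, N.Normal → N ≠ ⊥ → D.zeta ∈ N
  prestructure : ∃ P : KodairaTuple D.Model 2, P.ActionRelations ∧ P.z = D.zeta

namespace IsModel

variable {rels : Set (FreeGroup (Fin 6))} {D : CocycleData} {x : Fin 6 → D.Model}
  (h : IsModel rels D x)

include h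

/-- The presented group has at most 96 elements and maps onto a model of order 96. -/
theorem exists_mulEquiv : ∃ e : PresentedGroup rels ≃* D.Model,
    ∀ i, e (PresentedGroup.of i) = x i := by
  have := h.card_le.1
  let f := PresentedGroup.toGroup h.relations
  have hf : ∀ i, f (PresentedGroup.of i) = x i := fun i => PresentedGroup.toGroup.of h.relations
  have hsurj : Function.Surjective f := by
    rw [← MonoidHom.range_eq_top, eq_top_iff]
    intro m _
    refine (Subgroup.closure_le f.range).2 ?_ (h.generates m)
    rintro _ ⟨i, rfl⟩
    exact ⟨_, hf i⟩
  have hbij : Function.Bijective f := by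
    rw [Nat.bijective_iff_surjective_and_card]
    refine ⟨hsurj, le_antisymm (by rw [D.card_model]; exact h.card_le.2) ?_⟩
    exact Nat.card_le_card_of_surjective f hsurj
  exact ⟨MulEquiv.ofBijective f hbij, hf⟩

theorem card : Nat.card (PresentedGroup rels) = 96 := by
  obtain ⟨e, -⟩ := h.exists_mulEquiv
  rw [Nat.card_congr e.toEquiv, D.card_model]

theorem of_last_mem (N : Subgroup (PresentedGroup rels)) (hN : N.Normal) (hN' : N ≠ ⊥) :
    PresentedGroup.of 5 ∈ N := by
  obtain ⟨e, he⟩ := h.exists_mulEquiv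
  have := h.zeta_mem (N.map e.toMonoidHom) (hN.map _ e.surjective) (by
    rwa [Ne, Subgroup.map_eq_bot_iff_of_injective _ e.injective])
  obtain ⟨n, hn, hne⟩ := this
  have : n = PresentedGroup.of 5 := e.injective (by rw [he, h.last, ← hne]; rfl)
  rwa [← this]

theorem of_last_ne_one : (PresentedGroup.of 5 : PresentedGroup rels) ≠ 1 := by
  obtain ⟨e, he⟩ := h.exists_mulEquiv
  intro h1
  have := he 5
  rw [h1, map_one, h.last] at this
  exact Bool.false_ne_true (congrArg CocycleData.Model.sign this)

theorem isMonolithic : IsMonolithic (PresentedGroup rels) := fun h1 => by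
  have := mem_monolith_of_forall.2 h.of_last_mem
  rw [h1, Subgroup.mem_bot] at this
  exact h.of_last_ne_one this

theorem exists_extraspecialData : Nonempty (ExtraspecialData (PresentedGroup rels)) := by
  have := h.card_le.1
  obtain ⟨e, he⟩ := h.exists_mulEquiv
  obtain ⟨P, hP, hz⟩ := h.prestructure
  obtain ⟨E, -⟩ := (hP.mapHom e.symm.toMonoidHom).exists_extraspecialData h.card h.isMonolithic (by
    change e.symm P.z ≠ 1
    rw [hz, ← h.last, ← he, e.symm_apply_apply]
    exact h.of_last_ne_one)
  exact ⟨E⟩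

/-- A non-trivial kernel would contain the last generator. So elements of a group of order 96 that
satisfy the relations with non-trivial last entry already give an isomorphism. -/
theorem injective_of_ne_one {H : Type*} [Group H] (φ : PresentedGroup rels →* H)
    (hφ : φ (PresentedGroup.of 5) ≠ 1) : Function.Injective φ := by
  rw [← MonoidHom.ker_eq_bot_iff]
  by_contra hk
  exact hφ (h.of_last_mem _ φ.normal_ker hk)

theorem nonempty_mulEquiv {G : Type*} [Group G] (hG : Nat.card G = 96) {f : Fin 6 → G}
    (hf : ∀ r ∈ rels, FreeGroup.lift f r = 1) (hf5 : f 5 ≠ 1) :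
    Nonempty (G ≃* PresentedGroup rels) := by
  have : Finite G := Nat.finite_of_card_ne_zero (by rw [hG]; norm_num)
  have hinj := h.injective_of_ne_one (PresentedGroup.toGroup hf) (by
    rwa [PresentedGroup.toGroup.of])
  have hbij : Function.Bijective (PresentedGroup.toGroup hf) :=
    (Nat.bijective_iff_injective_and_card _).2 ⟨hinj, by rw [h.card, hG]⟩
  exact ⟨(MulEquiv.ofBijective _ hbij).symm⟩

/-- Automorphisms correspond to the families of elements satisfying the relations whose last
element is non-trivial. -/
theorem card_mulAut : Nat.card (MulAut (PresentedGroup rels)) =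
    Nat.card {f : Fin 6 → D.Model // (∀ r ∈ rels, FreeGroup.lift f r = 1) ∧ f 5 ≠ 1} := by
  have := h.card_le.1
  obtain ⟨e, he⟩ := h.exists_mulEquiv
  let F (φ : MulAut (PresentedGroup rels)) : PresentedGroup rels →* D.Model :=
    (e : PresentedGroup rels →* D.Model).comp (φ : PresentedGroup rels →* PresentedGroup rels)
  have hlift : ∀ φ, FreeGroup.lift (fun i => F φ (PresentedGroup.of i)) =
      (F φ).comp (PresentedGroup.mk rels) := by
    intro φ
    refine FreeGroup.ext_hom _ _ fun i => ?_
    simp [PresentedGroup.of]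
  refine Nat.card_congr (Equiv.ofBijective (fun φ => ⟨fun i => F φ (PresentedGroup.of i), ?_, ?_⟩)
    ⟨?_, ?_⟩)
  · intro r hr
    rw [hlift, MonoidHom.comp_apply, PresentedGroup.one_of_mem hr, map_one]
  · intro h1
    exact h.of_last_ne_one ((φ.trans e).injective (h1.trans (map_one _).symm))
  · intro φ ψ hφψ
    have : F φ = F ψ := PresentedGroup.ext fun i => congrFun (congrArg Subtype.val hφψ) i
    ext g
    exact e.injective (DFunLike.congr_fun this g)
  · rintro ⟨f, hf, hf5⟩
    have hinj := h.injective_of_ne_one (PresentedGroup.toGroup hf) (by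
      rwa [PresentedGroup.toGroup.of])
    have hbij : Function.Bijective (PresentedGroup.toGroup hf) :=
      (Nat.bijective_iff_injective_and_card _).2 ⟨hinj, by rw [h.card, D.card_model]⟩
    refine ⟨(MulEquiv.ofBijective _ hbij).trans e.symm, Subtype.ext (funext fun i => ?_)⟩
    change e (e.symm (PresentedGroup.toGroup hf (PresentedGroup.of i))) = f i
    rw [e.apply_symm_apply, PresentedGroup.toGroup.of]

/-- Here `a` is the order of the automorphism group and `N` the number of orbits of its free action
on the `20160 * 256` prestructures. -/
theorem summary {a N : ℕ} (ha : 0 < a) (haN : N * a = 20160 * 256)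
    (hcount : Nat.card {f : Fin 6 → D.Model //
      (∀ r ∈ rels, FreeGroup.lift f r = 1) ∧ f 5 ≠ 1} = a) :
    Nat.card (PresentedGroup rels) = 96 ∧ IsMonolithic (PresentedGroup rels) ∧
      numPrestructuresUpToAut (PresentedGroup rels) = N ∧
      ∀ (b n : ℕ) (S : KodairaTuple (PresentedGroup rels) b),
        ¬ S.IsDiagonalDoubleKodairaStructure n := by
  obtain ⟨E⟩ := h.exists_extraspecialData
  refine ⟨h.card, h.isMonolithic, ?_, fun b n S => E.not_isDiagonalDoubleKodairaStructure S⟩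
  have := E.numPrestructuresUpToAut_mul
  rw [h.card_mulAut, hcount, ← haN] at this
  exact Nat.eq_of_mul_eq_mul_right ha this

end IsModel

end SmallGroups

/-! ### Verification of the model properties. -/

namespace CocycleData

variable (D : CocycleData)

theorem mem_of_commutator_eq {z g h : D.Model} {N : Subgroup D.Model} (hN : N.Normal)
    (hg : g ∈ N) (h1 : ⁅g, h⁆ = z) : z ∈ N := by
  rw [← h1, commutatorElement_def, mul_assoc, mul_assoc, ← mul_assoc h]
  exact mul_mem hg (hN.conj_mem _ (inv_mem hg) h)

/-- A normal subgroup is closed under commutators with arbitrary elements, so it suffices to reach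
`zeta` from each `g ≠ 1` by at most two commutators with generators. This makes the monolith a
finite check. -/
theorem zeta_mem_of_normal {ι : Type*} (x : ι → D.Model) (hD : ∀ g, g ≠ 1 → g = D.zeta ∨
    (∃ i, ⁅g, x i⁆ = D.zeta) ∨ ∃ i j, ⁅⁅g, x i⁆, x j⁆ = D.zeta)
    (N : Subgroup D.Model) (hN : N.Normal) (hN' : N ≠ ⊥) :
    D.zeta ∈ N := by
  obtain ⟨g, hg, hg1⟩ := N.bot_or_exists_ne_one.resolve_left hN'
  rcases hD g hg1 with h | ⟨h, hh⟩ | ⟨h, k, hh⟩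
  · rwa [← h]
  · exact D.mem_of_commutator_eq hN hg hh
  · exact D.mem_of_commutator_eq hN (D.mem_of_commutator_eq hN hg rfl) hh

/-- Two commuting pairs of elements with commutator `zeta` yield a prestructure. -/
theorem exists_actionRelations (hc : ∀ g : D.Model, g * D.zeta = D.zeta * g)
    (u v : Fin 2 → D.Model)
    (huv : ∀ i j, ⁅u i, v j⁆ = if i = j then D.zeta else 1) (hvu : ∀ i j, ⁅v i, u j⁆ =
      if i = j then D.zeta else 1) (huu : ∀ i j, ⁅u i, u j⁆ = 1) (hvv : ∀ i j, ⁅v i, v j⁆ = 1) :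
    ∃ P : KodairaTuple D.Model 2, P.ActionRelations ∧ P.z = D.zeta := by
  refine ⟨⟨u, v, u, v, D.zeta⟩, .of_isDualPair (Subgroup.mem_center_iff.2 hc) ?_ ?_, rfl⟩
  · rw [pow_two, mul_def]
    simp [zeta, one_def, D.S_zero, vec_zero_add, D.β_zero_right]
  · rintro (i | i) (j | j)
    · simpa [KodairaTuple.fst, KodairaTuple.snd] using huv i j
    · simpa [KodairaTuple.fst, KodairaTuple.snd] using huu i j
    · simpa [KodairaTuple.fst, KodairaTuple.snd] using hvv i j
    · simpa [KodairaTuple.fst, KodairaTuple.snd] using hvu i j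

end CocycleData

namespace SmallGroups

theorem centralProduct_zeta_mem (q : Bool) (N : Subgroup (centralProductData q).Model) :
    N.Normal → N ≠ ⊥ → (centralProductData q).zeta ∈ N :=
  CocycleData.zeta_mem_of_normal _ (centralProductGen q) (by cases q <;> decide +kernel) N

theorem plusType_zeta_mem (N : Subgroup plusTypeData.Model) :
    N.Normal → N ≠ ⊥ → plusTypeData.zeta ∈ N :=
  CocycleData.zeta_mem_of_normal _ plusTypeGen (by decide +kernel) N

theorem centralProduct_prestructure (q : Bool) :
    ∃ P : KodairaTuple (centralProductData q).Model 2, P.ActionRelations ∧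
      P.z = (centralProductData q).zeta :=
  CocycleData.exists_actionRelations _ (by cases q <;> decide +kernel)
    ![centralProductGen q 0, centralProductGen q 3] ![centralProductGen q 1, centralProductGen q 4]
    (by cases q <;> decide +kernel) (by cases q <;> decide +kernel)
    (by cases q <;> decide +kernel) (by cases q <;> decide +kernel)

theorem plusType_prestructure :
    ∃ P : KodairaTuple plusTypeData.Model 2, P.ActionRelations ∧ P.z = plusTypeData.zeta :=
  CocycleData.exists_actionRelations _ (by decide +kernel) ![plusTypeGen 1, plusTypeGen 2]
    ![plusTypeGen 4, plusTypeGen 3] (by decide +kernel) (by decide +kernel) (by decide +kernel)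
    (by decide +kernel)

theorem mem_closure_of_word {G : Type*} [Group G] {x : Fin 6 → G} {m : G} (e : Fin 6 → ℕ)
    (h : m = x 0 ^ e 0 * x 1 ^ e 1 * x 2 ^ e 2 * x 3 ^ e 3 * x 4 ^ e 4 * x 5 ^ e 5) :
    m ∈ Subgroup.closure (Set.range x) := by
  have hx : ∀ i, x i ^ e i ∈ Subgroup.closure (Set.range x) := fun i =>
    pow_mem (Subgroup.subset_closure (Set.mem_range_self i)) _
  rw [h]
  exact mul_mem (mul_mem (mul_mem (mul_mem (mul_mem (hx 0) (hx 1)) (hx 2)) (hx 3)) (hx 4)) (hx 5)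

theorem centralProduct_generates (q : Bool) (m : (centralProductData q).Model) :
    m ∈ Subgroup.closure (Set.range (centralProductGen q)) := by
  -- The power of the rotation precedes `x₄` and `x₅` in the word and rotates their contribution,
  -- whence the rotation by `-m.rot` in the exponents.
  refine mem_closure_of_word ![m.vec.1.1.toNat, m.vec.1.2.toNat, m.rot,
    (BoolVec.rotate (-m.rot) m.vec.2).1.toNat, (BoolVec.rotate (-m.rot) m.vec.2).2.toNat,
    m.sign.toNat] ?_
  revert m
  cases q <;> decide +kernel

theorem plusType_generates (m : plusTypeData.Model) :
    m ∈ Subgroup.closure (Set.range plusTypeGen) := by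
  refine mem_closure_of_word ![m.rot, (BoolVec.rotate (-m.rot) m.vec.1).1.toNat,
    (BoolVec.rotate (-m.rot) m.vec.1).2.toNat, (BoolVec.rotate (-m.rot) m.vec.2).1.toNat,
    (BoolVec.rotate (-m.rot) m.vec.2).2.toNat, m.sign.toNat] ?_
  revert m
  decide +kernel

theorem isModel_201 : IsModel rels96_201 (centralProductData true) (centralProductGen true) where
  relations := lift_centralProductGen_true
  generates := centralProduct_generates true
  card_le := card_le_201
  last := rfl
  zeta_mem := centralProduct_zeta_mem true
  prestructure := centralProduct_prestructure true

theorem isModel_202 : IsModel rels96_202 (centralProductData false) (centralProductGen false) where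
  relations := lift_centralProductGen_false
  generates := centralProduct_generates false
  card_le := card_le_202
  last := rfl
  zeta_mem := centralProduct_zeta_mem false
  prestructure := centralProduct_prestructure false

theorem isModel_204 : IsModel rels96_204 plusTypeData plusTypeGen where
  relations := lift_plusTypeGen
  generates := plusType_generates
  card_le := card_le_204
  last := rfl
  zeta_mem := plusType_zeta_mem
  prestructure := plusType_prestructure

end SmallGroups

/-! ### Counting the generating families in the models. -/

section Counting

variable {α β : Type*}

/-- Eliminates the generators that the relations express through the others. -/
theorem card_subtype_eq_of_section {P : α → Prop} (F : β → α) (π : α → β)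
    (hπ : ∀ b, π (F b) = b) (hF : ∀ a, P a → F (π a) = a) :
    Nat.card {a // P a} = Nat.card {b // P (F b)} :=
  Nat.card_congr
    { toFun a := ⟨π a, by rw [hF _ a.2]; exact a.2⟩
      invFun b := ⟨F b, b.2⟩
      left_inv a := Subtype.ext (hF _ a.2)
      right_inv b := Subtype.ext (hπ _) }

/-- Counts one variable at a time, so that partial conditions prune the search before the next
variable is enumerated. -/
theorem card_subtype_prod [Fintype α] [Finite β] (p : α → Prop) (q : α → β → Prop)
    [DecidablePred p] :
    Nat.card {t : α × β // p t.1 ∧ q t.1 t.2} =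
      ∑ a, if p a then Nat.card {b // q a b} else 0 := by
  let e : {t : α × β // p t.1 ∧ q t.1 t.2} ≃ (a : α) × {b // p a ∧ q a b} :=
    { toFun t := ⟨t.1.1, t.1.2, t.2⟩
      invFun s := ⟨(s.1, s.2.1), s.2.2⟩
      left_inv _ := rfl
      right_inv _ := rfl }
  rw [Nat.card_congr e, Nat.card_sigma]
  refine Finset.sum_congr rfl fun a _ => ?_
  split_ifs with h <;> simp [h]

theorem card_subtype_eq_sum [Fintype α] (p : α → Prop) [DecidablePred p] :
    Nat.card {a // p a} = ∑ a, if p a then 1 else 0 := by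
  rw [Nat.card_eq_fintype_card, Fintype.card_subtype, Finset.card_filter]

end Counting

namespace SmallGroups

section CentralProduct

variable {G : Type*} [Group G]

/-- The relations between the elements `s = x₃` and `v = x₅`. -/
def SLRel (s v : G) : Prop :=
  v ^ 2 ≠ 1 ∧ (v ^ 2) ^ 2 = 1 ∧ ⁅s, s * v * s⁻¹⁆ = v⁻¹ ∧ (s * v * s⁻¹) ^ 2 = v ^ 2 ∧
    ⁅s * v * s⁻¹, v⁆ = v ^ 2 ∧ ⁅s, v ^ 2⁆ = 1 ∧ ⁅s * v * s⁻¹, v ^ 2⁆ = 1 ∧ ⁅v, v ^ 2⁆ = 1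

/-- The relations between `s = x₃`, `v = x₅` and one of `x₁` and `x₂`. -/
def CentralizerRel (q : Bool) (s v y : G) : Prop :=
  y ^ 2 = (if q then v ^ 2 else 1) ∧ ⁅y, s⁆ = 1 ∧ ⁅y, v⁆ = 1 ∧ ⁅y, s * v * s⁻¹⁆ = 1 ∧
    ⁅y, v ^ 2⁆ = 1

instance [DecidableEq G] (s v : G) : Decidable (SLRel s v) := by unfold SLRel; infer_instance

instance [DecidableEq G] (q : Bool) (s v y : G) : Decidable (CentralizerRel q s v y) := by
  unfold CentralizerRel; infer_instance

/-- The defining relations of the first two groups. -/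
def CentralProductRel (q : Bool) (x : Fin 6 → G) : Prop :=
  (x 0 ^ 2 = (if q then x 5 else 1) ∧ x 1 ^ 2 = (if q then x 5 else 1) ∧ ⁅x 0, x 1⁆ = x 5) ∧
    (x 2 ^ 3 = 1 ∧ ⁅x 0, x 2⁆ = 1 ∧ ⁅x 1, x 2⁆ = 1) ∧
    (x 3 ^ 2 = x 5 ∧ ⁅x 0, x 3⁆ = 1 ∧ ⁅x 1, x 3⁆ = 1 ∧ ⁅x 2, x 3⁆ = (x 4)⁻¹) ∧
    (x 4 ^ 2 = x 5 ∧ ⁅x 0, x 4⁆ = 1 ∧ ⁅x 1, x 4⁆ = 1 ∧ ⁅x 2, x 4⁆ = x 3 * (x 4)⁻¹ ∧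
      ⁅x 3, x 4⁆ = x 5) ∧
    (x 5 ^ 2 = 1 ∧ ⁅x 0, x 5⁆ = 1 ∧ ⁅x 1, x 5⁆ = 1 ∧ ⁅x 2, x 5⁆ = 1 ∧ ⁅x 3, x 5⁆ = 1 ∧
      ⁅x 4, x 5⁆ = 1)

/-- The relations give `x₄ = s v s⁻¹` and `x₆ = v²` for `s = x₃`, `v = x₅`, leaving four unknowns.
-/
theorem card_centralProductRel [Fintype G] [DecidableEq G] (q : Bool) :
    Nat.card {x : Fin 6 → G // CentralProductRel q x ∧ x 5 ≠ 1} =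
      ∑ s : G, if s ^ 3 = 1 then ∑ v : G, if SLRel s v then
        ∑ y : G, if CentralizerRel q s v y then
          ∑ y' : G, if CentralizerRel q s v y' ∧ ⁅y, y'⁆ = v ^ 2 then 1 else 0
        else 0 else 0 else 0 := by
  rw [card_subtype_eq_of_section
    (fun t : G × G × G × G =>
      ![t.2.2.1, t.2.2.2, t.1, t.1 * t.2.1 * t.1⁻¹, t.2.1, t.2.1 ^ 2])
    (fun x => (x 2, x 4, x 0, x 1)) (fun _ => rfl)]
  · simp only [← card_subtype_eq_sum, ← card_subtype_prod]
    refine Nat.card_congr (Equiv.subtypeEquivRight ?_)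
    rintro ⟨s, v, y, y'⟩
    constructor
    · rintro ⟨⟨⟨a1, a2, a3⟩, ⟨b1, b2, b3⟩, ⟨c1, c2, c3, c4⟩, ⟨-, d2, d3, -, d5⟩,
        e1, e2, e3, e4, e5, e6⟩, f⟩
      exact ⟨b1, ⟨f, e1, c4, c1, d5, e4, e5, e6⟩, ⟨a1, b2, d2, c2, e2⟩, ⟨a2, b3, d3, c3, e3⟩, a3⟩
    · rintro ⟨b1, ⟨f, e1, c4, c1, d5, e4, e5, e6⟩, ⟨a1, b2, d2, c2, e2⟩, ⟨a2, b3, d3, c3, e3⟩, a3⟩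
      exact ⟨⟨⟨a1, a2, a3⟩, ⟨b1, b2, b3⟩, ⟨c1, c2, c3, c4⟩, ⟨rfl, d2, d3, rfl, d5⟩,
        e1, e2, e3, e4, e5, e6⟩, f⟩
  · rintro x ⟨⟨-, -, -, ⟨h1, -, -, h2, -⟩, -⟩, -⟩
    have h3 : x 2 * x 4 * (x 2)⁻¹ = x 3 := by
      rw [commutatorElement_def] at h2
      exact mul_right_cancel h2
    funext i
    fin_cases i
    exacts [rfl, rfl, rfl, h3, rfl, h1]

theorem card_gen_201 : Nat.card {f : Fin 6 → (centralProductData true).Model //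
    (∀ r ∈ rels96_201, FreeGroup.lift f r = 1) ∧ f 5 ≠ 1} = 576 := by
  simp only [lift_rels96_201]
  exact (card_centralProductRel true).trans (by decide +kernel)

theorem card_gen_202 : Nat.card {f : Fin 6 → (centralProductData false).Model //
    (∀ r ∈ rels96_202, FreeGroup.lift f r = 1) ∧ f 5 ≠ 1} = 192 := by
  simp only [lift_rels96_202]
  exact (card_centralProductRel false).trans (by decide +kernel)

end CentralProduct

section PlusType

variable {G : Type*} [Group G]

/-- The relations between the elements `s = x₁` and `v`, where `v` is `x₃` or `x₅`. -/
def ModuleRel (s v : G) : Prop :=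
  v * v = 1 ∧ ⁅s, s * v * s⁻¹⁆ = v

/-- The relations between the elements `s = x₁`, `v = x₃` and `w = x₅`. -/
def PairingRel (s v w z : G) : Prop :=
  z ≠ 1 ∧ ⁅s * v * s⁻¹, w⁆ = z ∧ ⁅v, w⁆ = 1 ∧ ⁅s * v * s⁻¹, v⁆ = 1 ∧ ⁅s * w * s⁻¹, w⁆ = 1 ∧
    ⁅s * v * s⁻¹, s * w * s⁻¹⁆ = 1 ∧ z ^ 2 = 1 ∧ ⁅s, z⁆ = 1 ∧ ⁅s * v * s⁻¹, z⁆ = 1 ∧ ⁅v, z⁆ = 1 ∧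
    ⁅s * w * s⁻¹, z⁆ = 1 ∧ ⁅w, z⁆ = 1

instance [DecidableEq G] (s v : G) : Decidable (ModuleRel s v) := by
  unfold ModuleRel; infer_instance

instance [DecidableEq G] (s v w z : G) : Decidable (PairingRel s v w z) := by
  unfold PairingRel; infer_instance

/-- Here `x₂` and `x₄` are the conjugates by `s = x₁` of `v = x₃` and `w = x₅`, and `x₆ = ⁅x₃, x₄⁆`,
leaving three unknowns. -/
theorem card_rels96_204 [Fintype G] [DecidableEq G] :
    Nat.card {x : Fin 6 → G // (∀ r ∈ rels96_204, FreeGroup.lift x r = 1) ∧ x 5 ≠ 1} =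
      ∑ s : G, if s ^ 3 = 1 then ∑ v : G, if ModuleRel s v then
        ∑ w : G, if ModuleRel s w ∧ PairingRel s v w ⁅v, s * w * s⁻¹⁆ then 1 else 0
        else 0 else 0 := by
  simp only [lift_rels96_204]
  rw [card_subtype_eq_of_section
    (fun t : G × G × G =>
      ![t.1, t.1 * t.2.1 * t.1⁻¹, t.2.1, t.1 * t.2.2 * t.1⁻¹, t.2.2,
        ⁅t.2.1, t.1 * t.2.2 * t.1⁻¹⁆])
    (fun x => (x 0, x 2, x 4)) (fun _ => rfl)]
  · simp only [← card_subtype_eq_sum, ← card_subtype_prod]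
    refine Nat.card_congr (Equiv.subtypeEquivRight ?_)
    rintro ⟨s, v, w⟩
    have key : ∀ v : G, v * v = 1 → ⁅s, v⁆ = s * v * s⁻¹ * v := fun v hv => by
      rw [commutatorElement_def, inv_eq_of_mul_eq_one_right hv]
    have sq : ∀ {v : G}, v * v = 1 → v ^ 2 = 1 ∧ (s * v * s⁻¹) ^ 2 = 1 := fun {v} hv => by
      rw [conj_pow, pow_two, hv, mul_one, mul_inv_cancel]
      exact ⟨rfl, rfl⟩
    constructor
    · rintro ⟨⟨a, ⟨b1, b2⟩, ⟨c1, -, c3⟩, ⟨d1, d2, d3, d4⟩, ⟨f1, -, f3, f4, f5⟩,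
        e1, e2, e3, e4, e5, e6⟩, f⟩
      exact ⟨a, ⟨(pow_two v).symm.trans c1, b2⟩, ⟨(pow_two w).symm.trans f1, d2⟩,
        f, f3, f4, c3, f5, d3, e1, e2, e3, e4, e5, e6⟩
    · rintro ⟨a, ⟨c1, b2⟩, ⟨f1, d2⟩, f, f3, f4, c3, f5, d3, e1, e2, e3, e4, e5, e6⟩
      exact ⟨⟨a, ⟨(sq c1).2, b2⟩, ⟨(sq c1).1, key v c1, c3⟩, ⟨(sq f1).2, d2, d3, rfl⟩,
        ⟨(sq f1).1, key w f1, f3, f4, f5⟩,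
        e1, e2, e3, e4, e5, e6⟩, f⟩
  · rintro x ⟨⟨-, -, ⟨c1, c2, -⟩, ⟨-, -, -, d4⟩, ⟨f1, f2, -⟩, -⟩, -⟩
    have key : ∀ v u : G, v ^ 2 = 1 → ⁅x 0, v⁆ = u * v → x 0 * v * (x 0)⁻¹ = u := by
      intro v u hv h
      rw [commutatorElement_def, inv_eq_of_mul_eq_one_right ((pow_two v).symm.trans hv)] at h
      exact mul_right_cancel h
    have h1 := key _ _ c1 c2
    have h3 := key _ _ f1 f2
    funext i
    fin_cases i
    exacts [rfl, h1, rfl, h3, rfl, (congrArg (fun a => ⁅x 2, a⁆) h3).trans d4]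

theorem card_gen_204 : Nat.card {f : Fin 6 → plusTypeData.Model //
    (∀ r ∈ rels96_204, FreeGroup.lift f r = 1) ∧ f 5 ≠ 1} = 576 :=
  card_rels96_204.trans (by decide +kernel)

end PlusType

end SmallGroups

theorem proposition5p5 :
    (∀ (G : Type*) [Group G], Nat.card G = 96 → IsMonolithic G →
      ∀ n : ℕ, (∃ P : KodairaTuple G 2, P.IsPrestructure n) →
        n = 2 ∧
          (Nonempty (G ≃* SmallGroups.G96_201) ∨ Nonempty (G ≃* SmallGroups.G96_202) ∨
            Nonempty (G ≃* SmallGroups.G96_204))) ∧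
    (Nat.card SmallGroups.G96_201 = 96 ∧ IsMonolithic SmallGroups.G96_201 ∧
      numPrestructuresUpToAut SmallGroups.G96_201 = 8960 ∧
      ∀ (b n : ℕ) (S : KodairaTuple SmallGroups.G96_201 b),
        ¬ S.IsDiagonalDoubleKodairaStructure n) ∧
    (Nat.card SmallGroups.G96_202 = 96 ∧ IsMonolithic SmallGroups.G96_202 ∧
      numPrestructuresUpToAut SmallGroups.G96_202 = 26880 ∧
      ∀ (b n : ℕ) (S : KodairaTuple SmallGroups.G96_202 b),
        ¬ S.IsDiagonalDoubleKodairaStructure n) ∧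
    (Nat.card SmallGroups.G96_204 = 96 ∧ IsMonolithic SmallGroups.G96_204 ∧
      numPrestructuresUpToAut SmallGroups.G96_204 = 8960 ∧
      ∀ (b n : ℕ) (S : KodairaTuple SmallGroups.G96_204 b),
        ¬ S.IsDiagonalDoubleKodairaStructure n) := by
  -- The arithmetic is `8960 * 576 = 26880 * 192 = 20160 * 256`.
  refine ⟨fun G _ hG hm n ⟨P, hP⟩ => ?_, SmallGroups.isModel_201.summary (by norm_num) (by norm_num)
    SmallGroups.card_gen_201, SmallGroups.isModel_202.summary (by norm_num) (by norm_num)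
    SmallGroups.card_gen_202, SmallGroups.isModel_204.summary (by norm_num) (by norm_num)
    SmallGroups.card_gen_204⟩
  have : Finite G := Nat.finite_of_card_ne_zero (by rw [hG]; norm_num)
  have hz1 : P.z ≠ 1 := fun hz => by
    have h1 := hP.orderOf_z
    have h2 := hP.two_le_n
    rw [hz, orderOf_one] at h1
    omega
  obtain ⟨E, hE⟩ := hP.action.exists_extraspecialData hG hm hz1
  refine ⟨by rw [← hP.orderOf_z, ← hE, E.orderOf_z], ?_⟩
  obtain ⟨f, hf5, hf⟩ := E.exists_relations
  have hf1 : f 5 ≠ 1 := hf5 ▸ E.z_ne_one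
  rcases hf with hf | hf | hf
  · exact Or.inl (SmallGroups.isModel_201.nonempty_mulEquiv hG hf hf1)
  · exact Or.inr (Or.inl (SmallGroups.isModel_202.nonempty_mulEquiv hG hf hf1))
  · exact Or.inr (Or.inr (SmallGroups.isModel_204.nonempty_mulEquiv hG hf hf1))
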